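/- **Skew multicategories.** A skew multicategory $\mathcal C$ has objects, sets $\mathcal C^t_n(a_1,\dots,a_n;b)$ of tight $n$-ary multimaps ($n\ge 1$), sets $\mathcal C^l_n(a_1,\dots,a_n;b)$ of loose $n$-ary multimaps ($n\ge 0$), functions $j\colon\mathcal C^t_n(\overline a;b)\to\mathcal C^l_n(\overline a;b)$ for $n\ge1$, identities $1_a\in\mathcal C^t_1(a;a)$, and substitutions $g\circ_i f$. Here $g\circ_i f$ is tight if $g$ is tight and either $i\neq1$ or $f$ is tight, and it is loose otherwise. The usual unit laws hold, as do the usual associativity laws (sequential and parallel), and substitution is compatible with $j$. A classifier is a multimap $\theta\in\mathcal C^x_n(\overline a;m)$ ($x=t,l$) for which $-\circ_1\theta\colon\mathcal C^t_1(m;b)\to\mathcal C^x_n(\overline a;b)$ is bijective for all $b$. It is left universal if $-\circ_1\theta\colon\mathcal C^t_{1+r}(m,\overline y;b)\to\mathcal C^x_{n+r}(\overline a,\overline y;b)$ is bijective for all $r\ge 0$, all $\overline y$ of length $r$ and all $b$. $\mathcal C$ is left representable if every $x$ and $\overline a$ (nonempty if $x=t$) admits a classifier and all classifiers are left universal. **Braidings.**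 Let $B_n$ be the braid group with generators $\sigma_1,\dots,\sigma_{n-1}$, let $r\mapsto|r|$ be the homomorphism $B_n\to S_n$ sending $\sigma_k$ to the transposition $(k\;k{+}1)$, and put $B^t_n=\langle\sigma_2,\dots,\sigma_{n-1}\rangle$, $B_n^l=B_n$. A braiding on $\mathcal C$ assigns to each $r\in B^x_n$ functions $r^*\colon\mathcal C^x_n(a_1,\dots,a_n;b)\to\mathcal C^x_n(a_{|r|1},\dots,a_{|r|n};b)$ with $1^*=1$ and $(rs)^*=s^*r^*$ which commute with $j$ and are compatible with substitution: * $g\circ_i r^*f=(1_{i-1}\otimes r\otimes 1)^*(g\circ_i f)$, where $1_{i-1}\otimes r\otimes 1$ is $r$ with $i-1$ trivial strands added before it and the remaining trivial strands added after it; * $r^*g\circ_i f=(r')^*(g\circ_{|r|i}f)$, where, for $f$ of arity $m$, $r'$ is obtained from $r$ by replacing the strand joining $i$ to $|r|i$ by $m$ parallel strands. It is a symmetry if $r^*=s^*$ whenever $r,s\in B_n^x$ and $|r|=|s|$. **Short structures.** The short skew multicategory $\mathcal C_s$ underlying $\mathcal C$ has the same objects. It retains only the category of tight unary multimaps, the tight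 multimaps of arity at most $4$, the loose ones of arity at most $2$, the actions of morphisms on these, $j$, and the following substitutions: tight binary into tight binary and into tight ternary; tight ternary into tight binary; nullary into tight binary, into tight ternary and into loose unary; loose unary into tight binary; tight binary into loose unary. A short braiding on $\mathcal C_s$ consists of natural isomorphisms $$\beta^3_2\colon\mathcal C^t_3(a_1,a_2,a_3;b)\to\mathcal C^t_3(a_1,a_3,a_2;b),$$ $$\beta^4_2\colon\mathcal C^t_4(a_1,a_2,a_3,a_4;b)\to\mathcal C^t_4(a_1,a_3,a_2,a_4;b),$$ $$\beta^4_3\colon\mathcal C^t_4(a_1,a_2,a_3,a_4;b)\to\mathcal C^t_4(a_1,a_2,a_4,a_3;b)$$ such that $\beta^4_2\beta^4_3\beta^4_2(h)=\beta^4_3\beta^4_2\beta^4_3(h)$ for $h$ tight $4$-ary; $g\circ_1\beta^3_2(f)=\beta^4_2(g\circ_1f)$ and $g\circ_2\beta^3_2(f)=\beta^4_3(g\circ_2f)$ for $g$ tight binary and $f$ tight ternary; and $\beta^4_3(g\circ_1f)=\beta^3_2(g)\circ_1f$, $\beta^4_2\beta^4_3(g\circ_2f)=\beta^3_2(g)\circ_3f$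 and $\beta^4_3\beta^4_2(g\circ_3f)=\beta^3_2(g)\circ_2f$ for $g$ tight ternary and $f$ tight binary. It is a short symmetry if $\beta^3_2\beta^3_2=1$. **Statement.** Each braiding on a skew multicategory $\mathcal C$ has an underlying short braiding on $\mathcal C_s$, given by $\beta^3_2=\sigma_2^*$ on tight ternary multimaps and $\beta^4_2=\sigma_2^*$, $\beta^4_3=\sigma_3^*$ on tight $4$-ary multimaps. If $\mathcal C$ is left representable, then this assignment is a bijection between the braidings on $\mathcal C$ and the short braidings on $\mathcal C_s$. Moreover, a braiding on $\mathcal C$ is a symmetry if and only if its underlying short braiding is a short symmetry, so that the bijection restricts to one between symmetries and short symmetries. -/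

import Mathlib

set_option linter.unusedVariables false
universe u v

open CategoryTheory

namespace SkewMulti

/-! ## Braid groups -/

/-- The Artin relations on generators `σ k` with `k + 1 < n` (positions are counted from `0`). -/
def braidRels (n : ℕ) : Set (FreeGroup {k : ℕ // k + 1 < n}) :=
  {w | ∃ i j : {k : ℕ // k + 1 < n},
    ((i : ℕ) + 1 = j ∧
      w = FreeGroup.of i * FreeGroup.of j * FreeGroup.of i *
        (FreeGroup.of j * FreeGroup.of i * FreeGroup.of j)⁻¹) ∨
    ((i : ℕ) + 2 ≤ j ∧
      w = FreeGroup.of i * FreeGroup.of j * (FreeGroup.of j * FreeGroup.of i)⁻¹)}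

/-- The braid group on `n` strands, by Artin's presentation. -/
abbrev BraidGroup (n : ℕ) : Type := PresentedGroup (braidRels n)

namespace BraidGroup

/-- The generator `σ k`, which crosses the strands in positions `k` and `k + 1`, counted from `0`.
The value outside the range `k + 1 < n` is a dummy. -/
def σ (n k : ℕ) : BraidGroup n :=
  if h : k + 1 < n then PresentedGroup.of ⟨k, h⟩ else 1

theorem σ_braid {n k : ℕ} (h : k + 2 < n) :
    σ n k * σ n (k + 1) * σ n k = σ n (k + 1) * σ n k * σ n (k + 1) := by
  have h1 : k + 1 < n := by omega
  have h2 : k + 1 + 1 < n := by omega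
  simp only [σ, dif_pos h1, dif_pos h2]
  rw [← mul_inv_eq_one]
  exact PresentedGroup.one_of_mem ⟨⟨k, h1⟩, ⟨k + 1, h2⟩, Or.inl ⟨rfl, rfl⟩⟩

theorem σ_comm {n i j : ℕ} (h : i + 2 ≤ j) : σ n i * σ n j = σ n j * σ n i := by
  by_cases hj : j + 1 < n
  · have hi : i + 1 < n := by omega
    simp only [σ, dif_pos hi, dif_pos hj]
    rw [← mul_inv_eq_one]
    exact PresentedGroup.one_of_mem ⟨⟨i, hi⟩, ⟨j, hj⟩, Or.inr ⟨h, rfl⟩⟩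
  · simp [σ, dif_neg hj]

/-- The universal property of the braid group. -/
def lift {n : ℕ} {G : Type*} [Group G] (s : ℕ → G)
    (h₁ : ∀ k, k + 2 < n → s k * s (k + 1) * s k = s (k + 1) * s k * s (k + 1))
    (h₂ : ∀ i j, i + 2 ≤ j → j + 1 < n → s i * s j = s j * s i) : BraidGroup n →* G :=
  PresentedGroup.toGroup (rels := braidRels n) (f := fun k : {k : ℕ // k + 1 < n} => s k) (by
    rintro _ ⟨i, j, ⟨hij, rfl⟩ | ⟨hij, rfl⟩⟩
    · have := h₁ i (by have := j.2; omega)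
      simp only [map_mul, map_inv, FreeGroup.lift_apply_of, ← hij]
      rw [mul_inv_eq_one, this]
    · have := h₂ i j hij j.2
      simp only [map_mul, map_inv, FreeGroup.lift_apply_of]
      rw [mul_inv_eq_one, this])

theorem lift_σ {n : ℕ} {G : Type*} [Group G] (s : ℕ → G) (h₁) (h₂) {k : ℕ} (h : k + 1 < n) :
    lift (n := n) s h₁ h₂ (σ n k) = s k := by
  simp [lift, σ, dif_pos h]

/-- The transposition of the positions `k` and `k + 1`. -/
def natSwap (k i : ℕ) : ℕ := if i = k then k + 1 else if i = k + 1 then k else i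

theorem natSwap_lt {k i : ℕ} (h : i < k) : natSwap k i = i := by
  rw [natSwap, if_neg (by omega), if_neg (by omega)]

theorem natSwap_gt {k i : ℕ} (h : k + 1 < i) : natSwap k i = i := by
  rw [natSwap, if_neg (by omega), if_neg (by omega)]

theorem natSwap_self (k : ℕ) : natSwap k k = k + 1 := if_pos rfl

theorem natSwap_succ (k : ℕ) : natSwap k (k + 1) = k := by
  rw [natSwap, if_neg (by omega), if_pos rfl]

/-- The transposition of the positions `k` and `k + 1` in `Fin n`. -/
def adjSwap (n k : ℕ) : Equiv.Perm (Fin n) :=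
  if h : k + 1 < n then Equiv.swap ⟨k, by omega⟩ ⟨k + 1, h⟩ else 1

theorem adjSwap_val {n k : ℕ} (h : k + 1 < n) (i : Fin n) :
    ((adjSwap n k i : Fin n) : ℕ) = natSwap k i := by
  rw [adjSwap, dif_pos h, Equiv.swap_apply_def, natSwap]
  simp only [Fin.ext_iff]
  split_ifs <;> rfl

theorem natSwap_braid (k i : ℕ) : natSwap k (natSwap (k + 1) (natSwap k i)) =
    natSwap (k + 1) (natSwap k (natSwap (k + 1) i)) := by
  rcases (show i < k ∨ i = k ∨ i = k + 1 ∨ i = k + 1 + 1 ∨ k + 1 + 1 < i by omega) with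
    h | rfl | rfl | rfl | h
  · simp only [natSwap_lt h, natSwap_lt (show i < k + 1 by omega)]
  · simp only [natSwap_self, natSwap_lt (show i < i + 1 by omega),
      natSwap_gt (show i + 1 < i + 1 + 1 by omega)]
  · simp only [natSwap_self, natSwap_succ, natSwap_lt (show k < k + 1 by omega),
      natSwap_gt (show k + 1 < k + 1 + 1 by omega)]
  · simp only [natSwap_succ, natSwap_lt (show k < k + 1 by omega),
      natSwap_gt (show k + 1 < k + 1 + 1 by omega)]
  · simp only [natSwap_gt h, natSwap_gt (show k + 1 < i by omega)]

theorem natSwap_comm {a b : ℕ} (h : a + 2 ≤ b) (i : ℕ) :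
    natSwap a (natSwap b i) = natSwap b (natSwap a i) := by
  grind [natSwap]

/-- The canonical map from the braid group to the symmetric group. -/
def perm {n : ℕ} : BraidGroup n →* Equiv.Perm (Fin n) :=
  lift (adjSwap n)
    (fun k h => by
      ext i
      simp only [Equiv.Perm.mul_apply, adjSwap_val (show k + 1 < n by omega),
        adjSwap_val (show k + 1 + 1 < n by omega)]
      exact natSwap_braid k i)
    (fun i j h hj => by
      ext a
      simp only [Equiv.Perm.mul_apply, adjSwap_val (show i + 1 < n by omega), adjSwap_val hj]
      exact natSwap_comm h a)

theorem perm_σ {n k : ℕ} (h : k + 1 < n) : perm (σ n k) = adjSwap n k := lift_σ _ _ _ h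

/-- The subgroup of braids that leave the first strand alone, i.e. that only braid the
strands in positions `1, …, n - 1` among themselves. -/
def fixFirst (n : ℕ) : Subgroup (BraidGroup n) :=
  Subgroup.closure {r | ∃ k, 1 ≤ k ∧ k + 1 < n ∧ r = σ n k}

/-- Add trivial strands: `k` of them before and `p - k - m` after the given `m` strands. -/
def pad {m p : ℕ} (k : ℕ) (h : k + m ≤ p) : BraidGroup m →* BraidGroup p :=
  lift (fun i => σ p (k + i))
    (fun i hi => σ_braid (by omega))
    (fun i j hij _ => σ_comm (by omega))

theorem pad_σ {m p : ℕ} (k : ℕ) (h : k + m ≤ p) {i : ℕ} (hi : i + 1 < m) :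
    pad k h (σ m i) = σ p (k + i) := lift_σ _ _ _ hi

/-- `σ k * σ (k + 1) * ⋯ * σ (k + m - 1)` -/
def blockR (p k : ℕ) : ℕ → BraidGroup p
  | 0 => 1
  | m + 1 => blockR p k m * σ p (k + m)

/-- `σ (k + m - 1) * ⋯ * σ (k + 1) * σ k` -/
def blockL (p k : ℕ) : ℕ → BraidGroup p
  | 0 => 1
  | m + 1 => σ p (k + m) * blockL p k m

theorem blockR_comm {p k m j : ℕ} (h : j + 2 ≤ k ∨ k + m + 1 ≤ j) :
    blockR p k m * σ p j = σ p j * blockR p k m := by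
  induction m with
  | zero => simp [blockR]
  | succ m ih =>
    have e : σ p (k + m) * σ p j = σ p j * σ p (k + m) := by
      rcases h with h | h
      · exact (σ_comm (by omega)).symm
      · exact σ_comm (by omega)
    rw [blockR, mul_assoc, e, ← mul_assoc, ih (by omega), mul_assoc]

theorem blockL_comm {p k m j : ℕ} (h : j + 2 ≤ k ∨ k + m + 1 ≤ j) :
    blockL p k m * σ p j = σ p j * blockL p k m := by
  induction m with
  | zero => simp [blockL]
  | succ m ih =>
    have e : σ p (k + m) * σ p j = σ p j * σ p (k + m) := by
      rcases h with h | h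
      · exact (σ_comm (by omega)).symm
      · exact σ_comm (by omega)
    rw [blockL, mul_assoc, ih (by omega), ← mul_assoc, e, mul_assoc]

theorem blockR_braid {p k m : ℕ} (h : k + m + 1 < p) :
    σ p k * blockR p (k + 1) m * blockR p k m = blockR p (k + 1) m * blockR p k m * σ p (k + m) := by
  induction m with
  | zero => simp [blockR]
  | succ m ih =>
    have ih := ih (by omega)
    have c : σ p (k + 1 + m) * blockR p k m = blockR p k m * σ p (k + 1 + m) :=
      (blockR_comm (by omega)).symm
    have b := σ_braid (n := p) (k := k + m) (by omega)
    rw [show k + m + 1 = k + 1 + m by omega] at b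
    simp only [blockR]
    rw [show k + (m + 1) = k + 1 + m by omega]
    calc σ p k * (blockR p (k + 1) m * σ p (k + 1 + m)) * (blockR p k m * σ p (k + m))
        = σ p k * blockR p (k + 1) m * (σ p (k + 1 + m) * blockR p k m) * σ p (k + m) := by group
      _ = (σ p k * blockR p (k + 1) m * blockR p k m) * σ p (k + 1 + m) * σ p (k + m) := by
          rw [c]; group
      _ = blockR p (k + 1) m * blockR p k m * (σ p (k + m) * σ p (k + 1 + m) * σ p (k + m)) := by
          rw [ih]; group
      _ = blockR p (k + 1) m * (blockR p k m * σ p (k + 1 + m)) * σ p (k + m) * σ p (k + 1 + m) := by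
          rw [b]; group
      _ = _ := by rw [← c]; group

theorem blockL_braid {p k m : ℕ} (h : k + m + 1 < p) :
    blockL p k m * blockL p (k + 1) m * σ p k = σ p (k + m) * blockL p k m * blockL p (k + 1) m := by
  induction m with
  | zero => simp [blockL]
  | succ m ih =>
    have ih := ih (by omega)
    have c : blockL p k m * σ p (k + 1 + m) = σ p (k + 1 + m) * blockL p k m :=
      blockL_comm (by omega)
    have b := σ_braid (n := p) (k := k + m) (by omega)
    rw [show k + m + 1 = k + 1 + m by omega] at b
    simp only [blockL]
    rw [show k + (m + 1) = k + 1 + m by omega]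
    calc σ p (k + m) * blockL p k m * (σ p (k + 1 + m) * blockL p (k + 1) m) * σ p k
        = σ p (k + m) * (blockL p k m * σ p (k + 1 + m)) * blockL p (k + 1) m * σ p k := by group
      _ = σ p (k + m) * σ p (k + 1 + m) * (blockL p k m * blockL p (k + 1) m * σ p k) := by
          rw [c]; group
      _ = (σ p (k + m) * σ p (k + 1 + m) * σ p (k + m)) * blockL p k m * blockL p (k + 1) m := by
          rw [ih]; group
      _ = σ p (k + 1 + m) * σ p (k + m) * (σ p (k + 1 + m) * blockL p k m) * blockL p (k + 1) m := by
          rw [b]; group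
      _ = _ := by rw [← c]; group

theorem blockRL {p k m : ℕ} (h : k + m + 1 < p) :
    blockR p k m * σ p (k + m) * blockL p k m =
      blockL p (k + 1) m * σ p k * blockR p (k + 1) m := by
  induction m with
  | zero => simp [blockR, blockL]
  | succ m ih =>
    have ih := ih (by omega)
    have c : blockL p k m * σ p (k + 1 + m) = σ p (k + 1 + m) * blockL p k m :=
      blockL_comm (by omega)
    have c' : blockR p k m * σ p (k + 1 + m) = σ p (k + 1 + m) * blockR p k m :=
      blockR_comm (by omega)
    have b := σ_braid (n := p) (k := k + m) (by omega)
    rw [show k + m + 1 = k + 1 + m by omega] at b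
    simp only [blockL, blockR]
    rw [show k + (m + 1) = k + 1 + m by omega]
    calc blockR p k m * σ p (k + m) * σ p (k + 1 + m) * (σ p (k + m) * blockL p k m)
        = blockR p k m * (σ p (k + m) * σ p (k + 1 + m) * σ p (k + m)) * blockL p k m := by group
      _ = (blockR p k m * σ p (k + 1 + m)) * σ p (k + m) * (σ p (k + 1 + m) * blockL p k m) := by
          rw [b]; group
      _ = σ p (k + 1 + m) * (blockR p k m * σ p (k + m) * blockL p k m) * σ p (k + 1 + m) := by
          rw [c', ← c]; group
      _ = _ := by rw [ih]; group

/-- The braid obtained from the crossing `σ k` by replacing the strand that ends in position `i`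
by `m` parallel strands. -/
def cableGen (p m k i : ℕ) : BraidGroup p :=
  if i < k then σ p (k + m - 1)
  else if i = k then blockR p k m
  else if i = k + 1 then blockL p k m
  else σ p k

theorem cableGen_lt {p m k i : ℕ} (h : i < k) : cableGen p m k i = σ p (k + m - 1) := if_pos h

theorem cableGen_self {p m k : ℕ} : cableGen p m k k = blockR p k m := by
  rw [cableGen, if_neg (by omega), if_pos rfl]

theorem cableGen_succ {p m k : ℕ} : cableGen p m k (k + 1) = blockL p k m := by
  rw [cableGen, if_neg (by omega), if_neg (by omega), if_pos rfl]

theorem cableGen_gt {p m k i : ℕ} (h : k + 1 < i) : cableGen p m k i = σ p k := by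
  rw [cableGen, if_neg (by omega), if_neg (by omega), if_neg (by omega)]

theorem cableGen_braid {n m p k i : ℕ} (h : p + 1 = n + m) (hk : k + 2 < n) (hi : i < n) :
    cableGen p m k (natSwap (k + 1) (natSwap k i)) * cableGen p m (k + 1) (natSwap k i) *
        cableGen p m k i =
      cableGen p m (k + 1) (natSwap k (natSwap (k + 1) i)) * cableGen p m k (natSwap (k + 1) i) *
        cableGen p m (k + 1) i := by
  rcases (show i < k ∨ i = k ∨ i = k + 1 ∨ i = k + 1 + 1 ∨ k + 1 + 1 < i by omega) with
    h1 | rfl | rfl | rfl | h1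
  · have b := σ_braid (n := p) (k := k + m - 1) (by omega)
    rw [show k + m - 1 + 1 = k + 1 + m - 1 by omega] at b
    simpa only [natSwap_lt h1, natSwap_lt (show i < k + 1 by omega), cableGen_lt h1,
      cableGen_lt (show i < k + 1 by omega)] using b
  · simp only [natSwap_self, natSwap_lt (show i < i + 1 by omega), cableGen_self,
      cableGen_gt (show i + 1 < i + 1 + 1 by omega), cableGen_lt (show i < i + 1 by omega)]
    rw [blockR_braid (by omega), show i + 1 + m - 1 = i + m by omega]
  · simp only [natSwap_self, natSwap_succ, natSwap_lt (show k < k + 1 by omega),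
      natSwap_gt (show k + 1 < k + 1 + 1 by omega), cableGen_self, cableGen_succ,
      cableGen_gt (show k + 1 < k + 1 + 1 by omega), cableGen_lt (show k < k + 1 by omega)]
    rw [show k + 1 + m - 1 = k + m by omega]
    exact blockRL (by omega)
  · simp only [natSwap_succ, natSwap_gt (show k + 1 < k + 1 + 1 by omega), cableGen_succ,
      cableGen_gt (show k + 1 < k + 1 + 1 by omega), cableGen_lt (show k < k + 1 by omega)]
    rw [show k + 1 + m - 1 = k + m by omega]
    exact blockL_braid (by omega)
  · simp only [natSwap_gt h1, natSwap_gt (show k + 1 < i by omega), cableGen_gt h1,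
      cableGen_gt (show k + 1 < i by omega)]
    exact σ_braid (by omega)

theorem cableGen_comm {p m a b i : ℕ} (h : a + 2 ≤ b) :
    cableGen p m a (natSwap b i) * cableGen p m b i =
      cableGen p m b (natSwap a i) * cableGen p m a i := by
  rcases (show i < a ∨ i = a ∨ i = a + 1 ∨ (a + 1 < i ∧ i < b) ∨ i = b ∨ i = b + 1 ∨ b + 1 < i
    by omega) with h1 | rfl | rfl | h1 | rfl | rfl | h1
  · rw [natSwap_lt h1, natSwap_lt (show i < b by omega), cableGen_lt h1,
      cableGen_lt (show i < b by omega)]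
    exact σ_comm (by omega)
  · rw [natSwap_self, natSwap_lt (show i < b by omega), cableGen_self,
      cableGen_lt (show i < b by omega), cableGen_lt (show i + 1 < b by omega)]
    exact blockR_comm (by omega)
  · rw [natSwap_succ, natSwap_lt (show a + 1 < b by omega), cableGen_succ,
      cableGen_lt (show a < b by omega), cableGen_lt (show a + 1 < b by omega)]
    exact blockL_comm (by omega)
  · rw [natSwap_lt h1.2, natSwap_gt h1.1, cableGen_gt h1.1, cableGen_lt h1.2]
    exact σ_comm (by omega)
  · rw [natSwap_self, natSwap_gt (show a + 1 < i by omega), cableGen_self,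
      cableGen_gt (show a + 1 < i by omega), cableGen_gt (show a + 1 < i + 1 by omega)]
    exact (blockR_comm (by omega)).symm
  · rw [natSwap_succ, natSwap_gt (show a + 1 < b + 1 by omega), cableGen_succ,
      cableGen_gt (show a + 1 < b by omega), cableGen_gt (show a + 1 < b + 1 by omega)]
    exact (blockL_comm (by omega)).symm
  · rw [natSwap_gt h1, natSwap_gt (show a + 1 < i by omega), cableGen_gt h1,
      cableGen_gt (show a + 1 < i by omega)]
    exact σ_comm (by omega)

/-- The action of `BraidGroup n` on `Fin n × BraidGroup p`, where `p = n + m - 1`, that encodes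
the cocycle `cable` below: `r • (i, x) = (perm r i, cable i r * x)`. -/
def cableHom {n m p : ℕ} (h : p + 1 = n + m) : BraidGroup n →* Equiv.Perm (Fin n × BraidGroup p) :=
  lift (fun k => Equiv.prodShear (adjSwap n k) (fun i => Equiv.mulLeft (cableGen p m k i)))
    (fun k hk => by
      have h1 : k + 1 < n := by omega
      have h2 : k + 1 + 1 < n := by omega
      refine Equiv.ext fun ⟨i, x⟩ => Prod.ext (Fin.ext ?_) ?_
      · simp only [Equiv.Perm.mul_apply, Equiv.prodShear_apply, adjSwap_val h1, adjSwap_val h2]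
        exact natSwap_braid k i
      · simp only [Equiv.Perm.mul_apply, Equiv.prodShear_apply, Equiv.coe_mulLeft, ← mul_assoc,
          adjSwap_val h1, adjSwap_val h2]
        rw [cableGen_braid h hk i.2])
    (fun a b hab hb => by
      have ha : a + 1 < n := by omega
      refine Equiv.ext fun ⟨i, x⟩ => Prod.ext (Fin.ext ?_) ?_
      · simp only [Equiv.Perm.mul_apply, Equiv.prodShear_apply, adjSwap_val ha, adjSwap_val hb]
        exact natSwap_comm hab i
      · simp only [Equiv.Perm.mul_apply, Equiv.prodShear_apply, Equiv.coe_mulLeft, ← mul_assoc,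
          adjSwap_val ha, adjSwap_val hb]
        rw [cableGen_comm hab])

/-- Cabling: the braid on `p = n + m - 1` strands obtained from the braid `r` on `n` strands by
replacing one strand by `m` parallel strands, namely the strand from position `i` to position
`perm r i`. -/
def cable {n m p : ℕ} (h : p + 1 = n + m) (i : Fin n) (r : BraidGroup n) : BraidGroup p :=
  (cableHom h r (i, 1)).2

theorem cableHom_apply {n m p : ℕ} (h : p + 1 = n + m) (r : BraidGroup n) :
    ∀ (i : Fin n) (x : BraidGroup p), cableHom h r (i, x) = (perm r i, cable h i r * x) := by
  have key : ∀ r : BraidGroup n, ∃ c : Fin n → BraidGroup p, ∀ i x,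
      cableHom h r (i, x) = (perm r i, c i * x) := by
    intro r
    induction r using PresentedGroup.induction_on with
    | _ w =>
      induction w using FreeGroup.induction_on with
      | C1 => exact ⟨fun _ => 1, fun i x => by simp⟩
      | of k =>
        refine ⟨fun i => cableGen p m k i, fun i x => ?_⟩
        have e : PresentedGroup.mk (braidRels n) (FreeGroup.of k) = σ n k := by
          rw [σ, dif_pos k.2]; rfl
        rw [e, cableHom, lift_σ _ _ _ k.2, perm_σ k.2]
        rfl
      | inv_of k ih =>
        obtain ⟨c, hc⟩ := ih
        refine ⟨fun i => (c ((perm (PresentedGroup.mk (braidRels n) (FreeGroup.of k)))⁻¹ i))⁻¹,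
          fun i x => ?_⟩
        rw [map_inv, map_inv, Equiv.Perm.inv_eq_iff_eq, hc, map_inv]
        simp
      | mul a b iha ihb =>
        obtain ⟨c, hc⟩ := iha
        obtain ⟨d, hd⟩ := ihb
        refine ⟨fun i => c (perm (PresentedGroup.mk (braidRels n) b) i) * d i, fun i x => ?_⟩
        rw [map_mul, map_mul, map_mul, Equiv.Perm.mul_apply, hd, hc, mul_assoc]
        rfl
  intro i x
  obtain ⟨c, hc⟩ := key r
  simp [cable, hc]

theorem cable_one {n m p : ℕ} (h : p + 1 = n + m) (i : Fin n) : cable h i 1 = 1 := by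
  simp [cable]

theorem cable_mul {n m p : ℕ} (h : p + 1 = n + m) (i : Fin n) (r s : BraidGroup n) :
    cable h i (r * s) = cable h (perm s i) r * cable h i s := by
  rw [cable, map_mul, Equiv.Perm.mul_apply, cableHom_apply, cableHom_apply, mul_one]

theorem cable_σ {n m p : ℕ} (h : p + 1 = n + m) (i : Fin n) {k : ℕ} (hk : k + 1 < n) :
    cable h i (σ n k) = cableGen p m k i := by
  rw [cable, cableHom, lift_σ _ _ _ hk]
  simp [Equiv.prodShear]

end BraidGroup
/-! ## Skew multicategories -/

/-- The two types of multimaps. -/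
inductive Tightness
  | tight
  | loose

open Tightness

/-- The type of `g ∘ f` when `g` has type `x`, `f` has type `y`, and `f` is substituted in
position `i` (counted from `0`): a loose map in the first position makes a tight map loose. -/
def Tightness.subst : Tightness → ℕ → Tightness → Tightness
  | tight, 0, y => y
  | tight, _ + 1, _ => tight
  | loose, _, _ => loose

theorem Tightness.subst_tight : ∀ (x : Tightness) (i : ℕ), x = x.subst i tight
  | tight, 0 => rfl
  | tight, _ + 1 => rfl
  | loose, 0 => rfl
  | loose, _ + 1 => rfl

/-- A skew multicategory with set of objects `Obj`. If `g` has domain `L = Γ, b, Δ` and `f` has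
domain `A` and codomain `b`, then `subst Γ b Δ _ _ _ g f`, with domain `M = Γ, A, Δ`, is the
substitution `g ∘ᵢ f` in position `i = Γ.length` (counted from `0`). The lists `L`, `M` and the
type `w` of the result are variables subject to equations, so that the axioms need no transport. -/
structure SkewMulticategory (Obj : Type u) where
  /-- The tight and the loose multimaps with a given domain and codomain. -/
  Multi : Tightness → List Obj → Obj → Type v
  /-- Tight multimaps have positive arity. -/
  isEmpty_tight_nil : ∀ b, IsEmpty (Multi tight [] b)
  /-- Tight multimaps can be viewed as loose. -/
  j : ∀ {L : List Obj} {c : Obj}, Multi tight L c → Multi loose L c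
  id : ∀ a : Obj, Multi tight [a] a
  subst : ∀ {x y w : Tightness} {L A M : List Obj} {c : Obj} (Γ : List Obj) (b : Obj)
    (Δ : List Obj), L = Γ ++ b :: Δ → M = Γ ++ A ++ Δ → w = x.subst Γ.length y →
    Multi x L c → Multi y A b → Multi w M c
  id_subst : ∀ {x : Tightness} {L : List Obj} {c : Obj} (hM : L = [] ++ L ++ [])
    (f : Multi x L c), subst [] c [] rfl hM rfl (id c) f = f
  subst_id : ∀ {x : Tightness} {L : List Obj} {c : Obj} (Γ : List Obj) (b : Obj) (Δ : List Obj)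
    (hL : L = Γ ++ b :: Δ) (hM : L = Γ ++ [b] ++ Δ) (hw : x = x.subst Γ.length tight)
    (f : Multi x L c), subst Γ b Δ hL hM hw f (id b) = f
  /-- `h ∘ (g ∘ f) = (h ∘ g) ∘ f` -/
  subst_assoc : ∀ {x y z s t w : Tightness} {L A B M A' N : List Obj} {c : Obj}
    (Γ : List Obj) (b : Obj) (Δ : List Obj) (Γ' : List Obj) (a : Obj) (Δ' : List Obj)
    (hL : L = Γ ++ b :: Δ) (hA : A = Γ' ++ a :: Δ')
    (hA' : A' = Γ' ++ B ++ Δ') (hs : s = y.subst Γ'.length z)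
    (hN : N = Γ ++ A' ++ Δ) (hw : w = x.subst Γ.length s)
    (hM : M = Γ ++ A ++ Δ) (ht : t = x.subst Γ.length y)
    (hM' : M = (Γ ++ Γ') ++ a :: (Δ' ++ Δ)) (hN' : N = (Γ ++ Γ') ++ B ++ (Δ' ++ Δ))
    (hw' : w = t.subst (Γ ++ Γ').length z)
    (h : Multi x L c) (g : Multi y A b) (f : Multi z B a),
    subst Γ b Δ hL hN hw h (subst Γ' a Δ' hA hA' hs g f) =
      subst (Γ ++ Γ') a (Δ' ++ Δ) hM' hN' hw' (subst Γ b Δ hL hM ht h g) f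
  /-- Substitutions in two different positions commute. -/
  subst_comm : ∀ {x y z s t w : Tightness} {L A B M M' N : List Obj} {c : Obj}
    (Γ : List Obj) (b : Obj) (Δ : List Obj) (b' : Obj) (Θ : List Obj)
    (hL : L = Γ ++ b :: (Δ ++ b' :: Θ)) (hM : M = Γ ++ A ++ (Δ ++ b' :: Θ))
    (hs : s = x.subst Γ.length y)
    (hM' : M = (Γ ++ A ++ Δ) ++ b' :: Θ) (hN : N = (Γ ++ A ++ Δ) ++ B ++ Θ)
    (hw : w = s.subst (Γ ++ A ++ Δ).length z)
    (hL' : L = (Γ ++ b :: Δ) ++ b' :: Θ) (hP : M' = (Γ ++ b :: Δ) ++ B ++ Θ)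
    (ht : t = x.subst (Γ ++ b :: Δ).length z)
    (hP' : M' = Γ ++ b :: (Δ ++ B ++ Θ)) (hN' : N = Γ ++ A ++ (Δ ++ B ++ Θ))
    (hw' : w = t.subst Γ.length y)
    (h : Multi x L c) (g : Multi y A b) (f : Multi z B b'),
    subst (Γ ++ A ++ Δ) b' Θ hM' hN hw (subst Γ b (Δ ++ b' :: Θ) hL hM hs h g) f =
      subst Γ b (Δ ++ B ++ Θ) hP' hN' hw' (subst (Γ ++ b :: Δ) b' Θ hL' hP ht h f) g
  /- Substitution commutes with viewing tight multimaps as loose, on the left and on the right;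
  `j` is applied to the result if this turns from tight to loose. -/
  j_subst : ∀ {y : Tightness} {L A M : List Obj} {c : Obj} (Γ : List Obj) (b : Obj)
    (Δ : List Obj) (hL : L = Γ ++ b :: Δ) (hM : M = Γ ++ A ++ Δ)
    (hw : loose = loose.subst Γ.length y) (hw' : tight = tight.subst Γ.length y)
    (g : Multi tight L c) (f : Multi y A b),
    subst Γ b Δ hL hM hw (j g) f = j (subst Γ b Δ hL hM hw' g f)
  j_subst' : ∀ {y : Tightness} {L A M : List Obj} {c : Obj} (Γ : List Obj) (b : Obj)
    (Δ : List Obj) (hL : L = Γ ++ b :: Δ) (hM : M = Γ ++ A ++ Δ)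
    (hw : loose = loose.subst Γ.length y) (hw' : loose = tight.subst Γ.length y)
    (g : Multi tight L c) (f : Multi y A b),
    subst Γ b Δ hL hM hw (j g) f = subst Γ b Δ hL hM hw' g f
  subst_j : ∀ {x : Tightness} {L A M : List Obj} {c : Obj} (Γ : List Obj) (b : Obj)
    (Δ : List Obj) (hL : L = Γ ++ b :: Δ) (hM : M = Γ ++ A ++ Δ)
    (hw : loose = x.subst Γ.length loose) (hw' : tight = x.subst Γ.length tight)
    (g : Multi x L c) (f : Multi tight A b),
    subst Γ b Δ hL hM hw g (j f) = j (subst Γ b Δ hL hM hw' g f)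
  subst_j' : ∀ {x w : Tightness} {L A M : List Obj} {c : Obj} (Γ : List Obj) (b : Obj)
    (Δ : List Obj) (hL : L = Γ ++ b :: Δ) (hM : M = Γ ++ A ++ Δ)
    (hw : w = x.subst Γ.length loose) (hw' : w = x.subst Γ.length tight)
    (g : Multi x L c) (f : Multi tight A b),
    subst Γ b Δ hL hM hw g (j f) = subst Γ b Δ hL hM hw' g f

namespace SkewMulticategory

variable {Obj : Type u} (C : SkewMulticategory.{u, v} Obj)

/-- `θ` is a classifier of multimaps of type `x` with domain `A`. -/
def IsClassifier {x : Tightness} {A : List Obj} {m : Obj} (θ : C.Multi x A m) : Prop :=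
  ∀ (b : Obj) (hM : A = [] ++ A ++ []),
    Function.Bijective
      (fun g : C.Multi tight [m] b => (C.subst [] m [] rfl hM rfl g θ : C.Multi x A b))

/-- `θ` is left universal. -/
def IsLeftUniversal {x : Tightness} {A : List Obj} {m : Obj} (θ : C.Multi x A m) : Prop :=
  ∀ (X : List Obj) (b : Obj),
    Function.Bijective
      (fun g : C.Multi tight (m :: X) b =>
        (C.subst [] m X rfl rfl rfl g θ : C.Multi x (A ++ X) b))

/-- All classifiers exist, except for tight nullary multimaps, of which there are none. -/
def WeaklyRepresentable : Prop :=
  ∀ (x : Tightness) (A : List Obj), (x = loose ∨ A ≠ []) →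
    ∃ (m : Obj) (θ : C.Multi x A m), C.IsClassifier θ

/-- All classifiers exist and are left universal. -/
def LeftRepresentable : Prop :=
  C.WeaklyRepresentable ∧
    ∀ (x : Tightness) (A : List Obj) (m : Obj) (θ : C.Multi x A m),
      C.IsClassifier θ → C.IsLeftUniversal θ

end SkewMulticategory

/-! ## Braidings on skew multicategories -/

/-- The braids that act on the `n`-ary multimaps of a given type: all of them on loose multimaps,
those that leave the first strand alone on tight multimaps. -/
def braids (n : ℕ) : Tightness → Subgroup (BraidGroup n)
  | tight => BraidGroup.fixFirst n
  | loose => ⊤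

/-- `L = a₀, …, aₙ₋₁` has length `n` and `M = a_{π 0}, …, a_{π (n - 1)}`. -/
def Rearranges {Obj : Type u} {n : ℕ} (π : Equiv.Perm (Fin n)) (L M : List Obj) : Prop :=
  L.length = n ∧ M.length = n ∧ ∀ i : Fin n, M[(i : ℕ)]? = L[((π i : Fin n) : ℕ)]?

namespace SkewMulticategory

variable {Obj : Type u}

open BraidGroup in
/-- A braiding on a skew multicategory: actions `r^*` of the braid groups on multimaps,
compatible with `j` and with substitution. -/
structure Braiding (C : SkewMulticategory.{u, v} Obj) where
  /-- The action `r^*`. -/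
  act : ∀ {x : Tightness} {n : ℕ} {L M : List Obj} {c : Obj} (r : BraidGroup n),
    r ∈ braids n x → Rearranges (perm r) L M → C.Multi x L c → C.Multi x M c
  act_one : ∀ {x : Tightness} {n : ℕ} {L : List Obj} {c : Obj} (h : 1 ∈ braids n x)
    (hL : Rearranges (perm (1 : BraidGroup n)) L L) (f : C.Multi x L c), act 1 h hL f = f
  act_mul : ∀ {x : Tightness} {n : ℕ} {L M N : List Obj} {c : Obj} (r s : BraidGroup n)
    (hr : r ∈ braids n x) (hs : s ∈ braids n x) (hrs : r * s ∈ braids n x)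
    (hM : Rearranges (perm r) L M) (hN : Rearranges (perm s) M N)
    (hN' : Rearranges (perm (r * s)) L N)
    (f : C.Multi x L c), act (r * s) hrs hN' f = act s hs hN (act r hr hM f)
  act_j : ∀ {n : ℕ} {L M : List Obj} {c : Obj} (r : BraidGroup n)
    (hr : r ∈ braids n tight) (hr' : r ∈ braids n loose)
    (hM : Rearranges (perm r) L M) (f : C.Multi tight L c),
    act r hr' hM (C.j f) = C.j (act r hr hM f)
  /-- `g ∘ r^* f = (1 ⊗ r ⊗ 1)^* (g ∘ f)` -/
  subst_act : ∀ {x y w : Tightness} {m p : ℕ} {L A A' M M' : List Obj} {c : Obj}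
    (Γ : List Obj) (b : Obj) (Δ : List Obj) (hL : L = Γ ++ b :: Δ)
    (hM : M = Γ ++ A ++ Δ) (hM' : M' = Γ ++ A' ++ Δ) (hw : w = x.subst Γ.length y)
    (r : BraidGroup m) (hr : r ∈ braids m y) (hA : Rearranges (perm r) A A')
    (h : Γ.length + m ≤ p) (hr' : pad Γ.length h r ∈ braids p w)
    (hA' : Rearranges (perm (pad Γ.length h r)) M M')
    (g : C.Multi x L c) (f : C.Multi y A b),
    C.subst Γ b Δ hL hM' hw g (act r hr hA f) =
      act (pad Γ.length h r) hr' hA' (C.subst Γ b Δ hL hM hw g f)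
  /-- `r^* g ∘ᵢ f = r'^* (g ∘_{r i} f)`, where `r'` is obtained from `r` by replacing the strand
  from `i` to `r i` by as many parallel strands as `f` has inputs. -/
  act_subst : ∀ {x y w : Tightness} {n m p : ℕ} {L L' A M M' : List Obj} {c : Obj}
    (Γ Γ' : List Obj) (b : Obj) (Δ Δ' : List Obj)
    (hL : L = Γ ++ b :: Δ) (hM : M = Γ ++ A ++ Δ) (hw : w = x.subst Γ.length y)
    (hL' : L' = Γ' ++ b :: Δ') (hM' : M' = Γ' ++ A ++ Δ') (hw' : w = x.subst Γ'.length y)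
    (r : BraidGroup n) (hr : r ∈ braids n x) (hLL' : Rearranges (perm r) L L')
    (i : Fin n) (_ : (i : ℕ) = Γ'.length) (_ : ((perm r i : Fin n) : ℕ) = Γ.length)
    (_ : A.length = m) (h : p + 1 = n + m) (hr' : cable h i r ∈ braids p w)
    (hMM' : Rearranges (perm (cable h i r)) M M')
    (g : C.Multi x L c) (f : C.Multi y A b),
    C.subst Γ' b Δ' hL' hM' hw' (act r hr hLL' g) f =
      act (cable h i r) hr' hMM' (C.subst Γ b Δ hL hM hw g f)

/-- The braiding is a symmetry: `r^* = s^*` if `r` and `s` have the same permutation. -/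
def Braiding.IsSymmetry {C : SkewMulticategory.{u, v} Obj} (B : C.Braiding) : Prop :=
  ∀ {x : Tightness} {n : ℕ} {L M : List Obj} {c : Obj} (r s : BraidGroup n)
    (hr : r ∈ braids n x) (hs : s ∈ braids n x) (hL : Rearranges (BraidGroup.perm r) L M)
    (hL' : Rearranges (BraidGroup.perm s) L M)
    (f : C.Multi x L c), BraidGroup.perm r = BraidGroup.perm s → B.act r hr hL f = B.act s hs hL' f

end SkewMulticategory

/-! ## Short skew multicategories -/

/-- Lists of arrows `H a₁ b₁, …, H aₙ bₙ`. -/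
inductive HomList {Obj : Type u} (H : Obj → Obj → Type v) : List Obj → List Obj → Type (max u v)
  | nil : HomList H [] []
  | cons {a b : Obj} {L M : List Obj} (p : H a b) (P : HomList H L M) : HomList H (a :: L) (b :: M)

def HomList.append {Obj : Type u} {H : Obj → Obj → Type v} :
    ∀ {L M L' M' : List Obj}, HomList H L M → HomList H L' M' → HomList H (L ++ L') (M ++ M')
  | _, _, _, _, nil, Q => Q
  | _, _, _, _, cons p P, Q => cons p (append P Q)

/-- Lists of morphisms of a category `C`, i.e. morphisms of `Cⁿ`. -/
abbrev Homs {Obj : Type u} [Category.{v} Obj] (L M : List Obj) : Type (max u v) :=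
  HomList (fun a b : Obj => a ⟶ b) L M

namespace Homs

variable {Obj : Type u} [Category.{v} Obj]

def id : ∀ L : List Obj, Homs L L
  | [] => .nil
  | a :: L => .cons (𝟙 a) (id L)

def comp : ∀ {L M N : List Obj}, Homs L M → Homs M N → Homs L N
  | _, _, _, .nil, .nil => .nil
  | _, _, _, .cons p P, .cons q Q => .cons (p ≫ q) (comp P Q)

end Homs

/-- The arities in a short skew multicategory: tight multimaps have arity `1, …, 4` and loose
ones have arity `0, 1, 2`. -/
def ShortArity : Tightness → ℕ → Prop
  | tight, n => 1 ≤ n ∧ n ≤ 4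
  | loose, n => n ≤ 2

/-- The substitutions of an `m`-ary multimap of type `y` into an `n`-ary multimap of type `x` in a
short skew multicategory. The cases `post` and `pre` are the actions of morphisms on multimaps. -/
inductive ShortSubst : (x : Tightness) → (n : ℕ) → (y : Tightness) → (m : ℕ) → Prop
  | post {y : Tightness} {m : ℕ} : ShortArity y m → ShortSubst tight 1 y m
  | pre {x : Tightness} {n : ℕ} : ShortArity x n → ShortSubst x n tight 1
  | two_two : ShortSubst tight 2 tight 2
  | three_two : ShortSubst tight 3 tight 2
  | two_three : ShortSubst tight 2 tight 3
  | two_zero : ShortSubst tight 2 loose 0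
  | three_zero : ShortSubst tight 3 loose 0
  | loose_zero : ShortSubst loose 1 loose 0
  | two_loose : ShortSubst tight 2 loose 1
  | loose_two : ShortSubst loose 1 tight 2

/-- The multimaps that occur in the associativity axioms of a short skew multicategory: tight
binary ones and nullary ones. -/
def BinaryOrNullary (x : Tightness) (n : ℕ) : Prop :=
  (x = tight ∧ n = 2) ∨ (x = loose ∧ n = 0)

/-- A short skew multicategory with set of objects `Obj`. -/
structure ShortSkewMulticategory (Obj : Type u) extends Category.{v} Obj where
  /-- The tight and the loose multimaps, in the arities that occur. -/
  Multi : (x : Tightness) → (L : List Obj) → ShortArity x L.length → Obj → Type v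
  /-- The action of the functors `Multi x - -` on morphisms. -/
  map : ∀ {x : Tightness} {L L' : List Obj} {h : ShortArity x L.length}
    {h' : ShortArity x L'.length} {c c' : Obj},
    Homs L' L → (c ⟶ c') → Multi x L h c → Multi x L' h' c'
  map_id : ∀ {x : Tightness} {L : List Obj} {h : ShortArity x L.length} {c : Obj}
    (f : Multi x L h c), map (h' := h) (Homs.id L) (𝟙 c) f = f
  map_comp : ∀ {x : Tightness} {L L' L'' : List Obj} {h : ShortArity x L.length}
    {h' : ShortArity x L'.length} {h'' : ShortArity x L''.length} {c c' c'' : Obj}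
    (P : Homs L'' L') (Q : Homs L' L) (p : c ⟶ c') (q : c' ⟶ c'') (f : Multi x L h c),
    map (h' := h'') (P.comp Q) (p ≫ q) f = map P q (map (h' := h') Q p f)
  /-- Tight unary multimaps are morphisms. -/
  unary : ∀ {a b : Obj} {h : ShortArity tight [a].length}, (a ⟶ b) ≃ Multi tight [a] h b
  map_unary : ∀ {a a' b b' : Obj} {h : ShortArity tight [a].length}
    {h' : ShortArity tight [a'].length} (p : a' ⟶ a) (f : a ⟶ b) (q : b ⟶ b'),
    map (h' := h') (.cons p .nil) q (unary (h := h) f) = unary (p ≫ f ≫ q)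
  /-- Tight unary and binary multimaps can be viewed as loose. -/
  j : ∀ {L : List Obj} {h : ShortArity tight L.length} {h' : ShortArity loose L.length} {c : Obj},
    Multi tight L h c → Multi loose L h' c
  map_j : ∀ {L L' : List Obj} {h : ShortArity tight L.length} {h₁ : ShortArity loose L.length}
    {h' : ShortArity tight L'.length} {h₁' : ShortArity loose L'.length} {c c' : Obj}
    (P : Homs L' L) (q : c ⟶ c') (f : Multi tight L h c),
    map (h' := h₁') P q (j (h' := h₁) f) = j (map (h' := h') P q f)
  /-- Substitution, as in a skew multicategory. -/
  subst : ∀ {x y w : Tightness} {L A M : List Obj} {hx : ShortArity x L.length}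
    {hy : ShortArity y A.length} {hz : ShortArity w M.length} {c : Obj}
    (Γ : List Obj) (b : Obj) (Δ : List Obj),
    ShortSubst x L.length y A.length →
    L = Γ ++ b :: Δ → M = Γ ++ A ++ Δ → w = x.subst Γ.length y →
    Multi x L hx c → Multi y A hy b → Multi w M hz c
  /-- Substitution into a morphism is the action of this morphism. -/
  unary_subst : ∀ {y : Tightness} {A : List Obj} {hx : ShortArity tight 1}
    {hy : ShortArity y A.length} {b c : Obj} (hs : ShortSubst tight 1 y A.length)
    (hM : A = [] ++ A ++ []) (q : b ⟶ c) (f : Multi y A hy b),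
    subst (hx := hx) (hz := hy) [] b [] hs rfl hM rfl (unary q) f = map (Homs.id A) q f
  /-- Substitution of a morphism is the action of this morphism. -/
  subst_unary : ∀ {x : Tightness} {hy : ShortArity tight 1} {a c : Obj}
    (Γ : List Obj) (b : Obj) (Δ : List Obj) {hx : ShortArity x (Γ ++ b :: Δ).length}
    {hz : ShortArity x (Γ ++ a :: Δ).length} (hs : ShortSubst x (Γ ++ b :: Δ).length tight 1)
    (hM : Γ ++ a :: Δ = Γ ++ [a] ++ Δ) (hw : x = x.subst Γ.length tight)
    (g : Multi x (Γ ++ b :: Δ) hx c) (p : a ⟶ b),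
    subst (hy := hy) (hz := hz) Γ b Δ hs rfl hM hw g (unary p) =
      map ((Homs.id Γ).append (.cons p (Homs.id Δ))) (𝟙 c) g
  /-- Naturality of substitution. -/
  subst_natural : ∀ {x y w : Tightness} {Γ Γ' A A' Δ Δ' : List Obj} {b c c' : Obj}
    {hx : ShortArity x (Γ ++ b :: Δ).length} {hy : ShortArity y A.length}
    {hz : ShortArity w (Γ ++ A ++ Δ).length}
    {hx' : ShortArity x (Γ' ++ b :: Δ').length} {hy' : ShortArity y A'.length}
    {hz' : ShortArity w (Γ' ++ A' ++ Δ').length}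
    (hs : ShortSubst x (Γ ++ b :: Δ).length y A.length)
    (hs' : ShortSubst x (Γ' ++ b :: Δ').length y A'.length)
    (hw : w = x.subst Γ.length y) (hw' : w = x.subst Γ'.length y)
    (P : Homs Γ' Γ) (Q : Homs A' A) (R : Homs Δ' Δ) (q : c ⟶ c')
    (g : Multi x (Γ ++ b :: Δ) hx c) (f : Multi y A hy b),
    map (h' := hz') ((P.append Q).append R) q (subst (hz := hz) Γ b Δ hs rfl rfl hw g f) =
      subst Γ' b Δ' hs' rfl rfl hw' (map (h' := hx') (P.append (.cons (𝟙 b) R)) q g)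
        (map (h' := hy') Q (𝟙 b) f)
  /-- Dinaturality of substitution. -/
  subst_dinatural : ∀ {x y w : Tightness} {Γ A Δ : List Obj} {b b' c : Obj}
    {hx : ShortArity x (Γ ++ b :: Δ).length} {hx' : ShortArity x (Γ ++ b' :: Δ).length}
    {hy : ShortArity y A.length} {hz : ShortArity w (Γ ++ A ++ Δ).length}
    (hs : ShortSubst x (Γ ++ b :: Δ).length y A.length)
    (hs' : ShortSubst x (Γ ++ b' :: Δ).length y A.length) (hw : w = x.subst Γ.length y)
    (p : b ⟶ b') (g : Multi x (Γ ++ b' :: Δ) hx' c) (f : Multi y A hy b),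
    subst (hz := hz) Γ b Δ hs rfl rfl hw
        (map (h' := hx) ((Homs.id Γ).append (.cons p (Homs.id Δ))) (𝟙 c) g) f =
      subst Γ b' Δ hs' rfl rfl hw g (map (h' := hy) (Homs.id A) p f)
  /-- `h ∘ (g ∘ f) = (h ∘ g) ∘ f` for `h`, `g` tight binary and `f` tight binary or nullary. -/
  subst_assoc : ∀ {z s t w : Tightness} {L A B M A' N : List Obj} {c : Obj}
    {kL : ShortArity tight L.length} {kA : ShortArity tight A.length}
    {kB : ShortArity z B.length} {kM : ShortArity t M.length} {kA' : ShortArity s A'.length}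
    {kN : ShortArity w N.length}
    (Γ : List Obj) (b : Obj) (Δ : List Obj) (Γ' : List Obj) (a : Obj) (Δ' : List Obj)
    (_ : L.length = 2) (_ : A.length = 2) (_ : BinaryOrNullary z B.length)
    (e₁ : ShortSubst tight A.length z B.length) (e₂ : ShortSubst tight L.length s A'.length)
    (e₃ : ShortSubst tight L.length tight A.length) (e₄ : ShortSubst t M.length z B.length)
    (hL : L = Γ ++ b :: Δ) (hA : A = Γ' ++ a :: Δ')
    (hA' : A' = Γ' ++ B ++ Δ') (hs : s = tight.subst Γ'.length z)
    (hN : N = Γ ++ A' ++ Δ) (hw : w = tight.subst Γ.length s)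
    (hM : M = Γ ++ A ++ Δ) (ht : t = tight.subst Γ.length tight)
    (hM' : M = (Γ ++ Γ') ++ a :: (Δ' ++ Δ)) (hN' : N = (Γ ++ Γ') ++ B ++ (Δ' ++ Δ))
    (hw' : w = t.subst (Γ ++ Γ').length z)
    (h : Multi tight L kL c) (g : Multi tight A kA b) (f : Multi z B kB a),
    subst (hz := kN) Γ b Δ e₂ hL hN hw h (subst (hz := kA') Γ' a Δ' e₁ hA hA' hs g f) =
      subst (Γ ++ Γ') a (Δ' ++ Δ) e₄ hM' hN' hw' (subst (hz := kM) Γ b Δ e₃ hL hM ht h g) f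
  /-- The substitutions of two tight binary or nullary multimaps into a tight binary one
  commute. -/
  subst_comm : ∀ {y z s t w : Tightness} {A B M M' N : List Obj} {b b' c : Obj}
    {kL : ShortArity tight [b, b'].length} {kA : ShortArity y A.length}
    {kB : ShortArity z B.length} {kM : ShortArity s M.length} {kM' : ShortArity t M'.length}
    {kN : ShortArity w N.length}
    (_ : BinaryOrNullary y A.length) (_ : BinaryOrNullary z B.length)
    (e₁ : ShortSubst tight [b, b'].length y A.length) (e₂ : ShortSubst s M.length z B.length)
    (e₃ : ShortSubst tight [b, b'].length z B.length) (e₄ : ShortSubst t M'.length y A.length)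
    (hM : M = [] ++ A ++ [b']) (hs : s = tight.subst 0 y)
    (hM₁ : M = A ++ b' :: []) (hN : N = A ++ B ++ []) (hw : w = s.subst A.length z)
    (hM' : M' = [b] ++ B ++ []) (ht : t = tight.subst 1 z)
    (hM₁' : M' = [] ++ b :: B) (hN' : N = [] ++ A ++ B) (hw' : w = t.subst 0 y)
    (h : Multi tight [b, b'] kL c) (g : Multi y A kA b) (f : Multi z B kB b'),
    subst (hz := kN) A b' [] e₂ hM₁ hN hw (subst (hz := kM) [] b [b'] e₁ rfl hM hs h g) f =
      subst [] b B e₄ hM₁' hN' hw' (subst (hz := kM') [b] b' [] e₃ rfl hM' ht h f) g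
  /- Substitutions that involve a morphism viewed as a loose unary multimap. -/
  subst_j_unary_fst : ∀ {a b b' c : Obj} {h₂ : ShortArity tight 2} {h₂' : ShortArity tight 2}
    {k₁ : ShortArity tight 1} {k₂ : ShortArity loose 2} {k₁' : ShortArity loose 1}
    (g : Multi tight [b, b'] h₂ c) (p : a ⟶ b),
    (subst [] b [b'] .two_loose rfl rfl rfl g
        (j (unary (h := k₁) p) : Multi loose [a] k₁' b) : Multi loose [a, b'] k₂ c) =
      j (map (h' := h₂') (.cons p (.cons (𝟙 b') .nil)) (𝟙 c) g)
  subst_j_unary_snd : ∀ {a b b' c : Obj} {h₂ : ShortArity tight 2} {h₂' : ShortArity tight 2}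
    {k₁ : ShortArity tight 1} {k₁' : ShortArity loose 1}
    (g : Multi tight [b, b'] h₂ c) (p : a ⟶ b'),
    (subst [b] b' [] .two_loose rfl rfl rfl g
        (j (unary (h := k₁) p) : Multi loose [a] k₁' b') : Multi tight [b, a] h₂' c) =
      map (.cons (𝟙 b) (.cons p .nil)) (𝟙 c) g
  j_unary_subst_binary : ∀ {a a' b c : Obj} {h₂ : ShortArity tight 2} {h₂' : ShortArity tight 2}
    {k₁ : ShortArity tight 1} {k₂ : ShortArity loose 2} {k₁' : ShortArity loose 1}
    (p : b ⟶ c) (g : Multi tight [a, a'] h₂ b),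
    (subst [] b [] .loose_two rfl rfl rfl
        (j (unary (h := k₁) p) : Multi loose [b] k₁' c) g : Multi loose [a, a'] k₂ c) =
      j (map (h' := h₂') (Homs.id [a, a']) p g)
  j_unary_subst_nullary : ∀ {b c : Obj} {h₀ : ShortArity loose 0} {h₀' : ShortArity loose 0}
    {k₁ : ShortArity tight 1} {k₁' : ShortArity loose 1}
    (p : b ⟶ c) (v : Multi loose [] h₀ b),
    (subst [] b [] .loose_zero rfl rfl rfl
        (j (unary (h := k₁) p) : Multi loose [b] k₁' c) v : Multi loose [] h₀' c) =
      map .nil p v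

/-! ## Short braidings -/

theorem shortArity_three : ShortArity tight 3 := by simp [ShortArity]

theorem shortArity_four : ShortArity tight 4 := by simp [ShortArity]

theorem shortArity_two : ShortArity tight 2 := by simp [ShortArity]

namespace ShortSkewMulticategory

variable {Obj : Type u} (S : ShortSkewMulticategory.{u, v} Obj)

/-- Tight binary multimaps. -/
abbrev T₂ (a₁ a₂ b : Obj) : Type v := S.Multi tight [a₁, a₂] shortArity_two b

/-- Tight ternary multimaps. -/
abbrev T₃ (a₁ a₂ a₃ b : Obj) : Type v := S.Multi tight [a₁, a₂, a₃] shortArity_three b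

/-- Tight 4-ary multimaps. -/
abbrev T₄ (a₁ a₂ a₃ a₄ b : Obj) : Type v := S.Multi tight [a₁, a₂, a₃, a₄] shortArity_four b

/-- A short braiding on a short skew multicategory. Here `β₃₂`, `β₄₂`, `β₄₃` are the natural
isomorphisms that exchange the second and third inputs of ternary multimaps, the second and third
inputs of 4-ary multimaps, and the third and fourth inputs of 4-ary multimaps. -/
structure ShortBraiding where
  β₃₂ : ∀ {a₁ a₂ a₃ b : Obj}, S.T₃ a₁ a₂ a₃ b ≃ S.T₃ a₁ a₃ a₂ b
  β₄₂ : ∀ {a₁ a₂ a₃ a₄ b : Obj}, S.T₄ a₁ a₂ a₃ a₄ b ≃ S.T₄ a₁ a₃ a₂ a₄ b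
  β₄₃ : ∀ {a₁ a₂ a₃ a₄ b : Obj}, S.T₄ a₁ a₂ a₃ a₄ b ≃ S.T₄ a₁ a₂ a₄ a₃ b
  β₃₂_natural : letI := S.toCategory
    ∀ {a₁ a₂ a₃ b a₁' a₂' a₃' b' : Obj} (p₁ : a₁' ⟶ a₁) (p₂ : a₂' ⟶ a₂)
      (p₃ : a₃' ⟶ a₃) (q : b ⟶ b') (f : S.T₃ a₁ a₂ a₃ b),
    β₃₂ (S.map (h' := shortArity_three) (.cons p₁ (.cons p₂ (.cons p₃ .nil))) q f) =
      S.map (.cons p₁ (.cons p₃ (.cons p₂ .nil))) q (β₃₂ f)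
  β₄₂_natural : letI := S.toCategory
    ∀ {a₁ a₂ a₃ a₄ b a₁' a₂' a₃' a₄' b' : Obj} (p₁ : a₁' ⟶ a₁) (p₂ : a₂' ⟶ a₂)
      (p₃ : a₃' ⟶ a₃) (p₄ : a₄' ⟶ a₄) (q : b ⟶ b') (f : S.T₄ a₁ a₂ a₃ a₄ b),
    β₄₂ (S.map (h' := shortArity_four) (.cons p₁ (.cons p₂ (.cons p₃ (.cons p₄ .nil)))) q f) =
      S.map (.cons p₁ (.cons p₃ (.cons p₂ (.cons p₄ .nil)))) q (β₄₂ f)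
  β₄₃_natural : letI := S.toCategory
    ∀ {a₁ a₂ a₃ a₄ b a₁' a₂' a₃' a₄' b' : Obj} (p₁ : a₁' ⟶ a₁) (p₂ : a₂' ⟶ a₂)
      (p₃ : a₃' ⟶ a₃) (p₄ : a₄' ⟶ a₄) (q : b ⟶ b') (f : S.T₄ a₁ a₂ a₃ a₄ b),
    β₄₃ (S.map (h' := shortArity_four) (.cons p₁ (.cons p₂ (.cons p₃ (.cons p₄ .nil)))) q f) =
      S.map (.cons p₁ (.cons p₂ (.cons p₄ (.cons p₃ .nil)))) q (β₄₃ f)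
  braid : ∀ {a₁ a₂ a₃ a₄ b : Obj} (h : S.T₄ a₁ a₂ a₃ a₄ b),
    β₄₂ (β₄₃ (β₄₂ h)) = β₄₃ (β₄₂ (β₄₃ h))
  three_in_two_fst : ∀ {b₁ b₂ c a₁ a₂ a₃ : Obj} (g : S.T₂ b₁ b₂ c) (f : S.T₃ a₁ a₂ a₃ b₁),
    S.subst [] b₁ [b₂] .two_three rfl rfl rfl g (β₃₂ f) =
      β₄₂ (S.subst [] b₁ [b₂] .two_three rfl rfl rfl g f)
  three_in_two_snd : ∀ {b₁ b₂ c a₁ a₂ a₃ : Obj} (g : S.T₂ b₁ b₂ c) (f : S.T₃ a₁ a₂ a₃ b₂),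
    S.subst [b₁] b₂ [] .two_three rfl rfl rfl g (β₃₂ f) =
      β₄₃ (S.subst [b₁] b₂ [] .two_three rfl rfl rfl g f)
  two_in_three_fst : ∀ {b₁ b₂ b₃ c a₁ a₂ : Obj} (g : S.T₃ b₁ b₂ b₃ c) (f : S.T₂ a₁ a₂ b₁),
    β₄₃ (S.subst [] b₁ [b₂, b₃] .three_two rfl rfl rfl g f) =
      S.subst [] b₁ [b₃, b₂] .three_two rfl rfl rfl (β₃₂ g) f
  two_in_three_snd : ∀ {b₁ b₂ b₃ c a₁ a₂ : Obj} (g : S.T₃ b₁ b₂ b₃ c) (f : S.T₂ a₁ a₂ b₂),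
    β₄₂ (β₄₃ (S.subst [b₁] b₂ [b₃] .three_two rfl rfl rfl g f)) =
      S.subst [b₁, b₃] b₂ [] .three_two rfl rfl rfl (β₃₂ g) f
  two_in_three_trd : ∀ {b₁ b₂ b₃ c a₁ a₂ : Obj} (g : S.T₃ b₁ b₂ b₃ c) (f : S.T₂ a₁ a₂ b₃),
    β₄₃ (β₄₂ (S.subst [b₁, b₂] b₃ [] .three_two rfl rfl rfl g f)) =
      S.subst [b₁] b₃ [b₂] .three_two rfl rfl rfl (β₃₂ g) f

/-- The short braiding is a short symmetry. -/
def ShortBraiding.IsSymmetry {S : ShortSkewMulticategory.{u, v} Obj} (β : S.ShortBraiding) : Prop :=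
  ∀ {a₁ a₂ a₃ b : Obj} (f : S.T₃ a₁ a₂ a₃ b), β.β₃₂ (β.β₃₂ f) = f

end ShortSkewMulticategory

/-! ## The underlying short skew multicategory -/

namespace SkewMulticategory

variable {Obj : Type u} (C : SkewMulticategory.{u, v} Obj)

/-- The underlying category: its morphisms are the tight unary multimaps. -/
abbrev category : Category.{v} Obj where
  Hom a b := C.Multi tight [a] b
  id := C.id
  comp {_ b _} f g := C.subst [] b [] rfl rfl rfl g f
  id_comp {a _} f := C.subst_id (x := tight) [] a [] rfl rfl rfl f
  comp_id f := C.id_subst (x := tight) rfl f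
  assoc {_ b c _} f g h :=
    C.subst_assoc [] c [] [] b [] rfl rfl rfl rfl rfl rfl rfl rfl rfl rfl rfl h g f

/-- Precomposition with morphisms in the positions between `Γ` and `Δ`, one after the other. -/
def precomp {x : Tightness} {c : Obj} : ∀ (Γ Δ : List Obj) {L L' M N : List Obj},
    HomList (fun a b => C.Multi tight [a] b) L L' → M = Γ ++ L' ++ Δ → N = Γ ++ L ++ Δ → C.Multi x M c → C.Multi x N c
  | _, _, _, _, _, _, .nil, hM, hN, f => (hM.trans hN.symm) ▸ f
  | Γ, Δ, _, _, _, _, @HomList.cons _ _ a b L L' p P, hM, hN, f =>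
      precomp (M := Γ ++ a :: (L' ++ Δ)) (Γ ++ [a]) Δ P (by simp) (by simp [hN])
        (C.subst (y := tight) (A := [a]) Γ b (L' ++ Δ) (by simp [hM]) (by simp)
          (x.subst_tight _) f p)

variable {C}

theorem precomp_nil {x : Tightness} {c : Obj} (Γ Δ : List Obj) {M : List Obj}
    (hM : M = Γ ++ [] ++ Δ) (hN : M = Γ ++ [] ++ Δ) (f : C.Multi x M c) :
    C.precomp Γ Δ .nil hM hN f = f := rfl

theorem precomp_cons {x : Tightness} {c a b : Obj} {L L' : List Obj}
    (p : C.Multi tight [a] b) (P : HomList (fun a b => C.Multi tight [a] b) L L')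
    {Γ Δ M N Γ₁ Δ₁ M₁ : List Obj} (hM : M = Γ ++ b :: L' ++ Δ) (hN : N = Γ ++ a :: L ++ Δ)
    (hΓ : Γ₁ = Γ ++ [a]) (hΔ : Δ₁ = L' ++ Δ) (h₁ : M₁ = Γ₁ ++ L' ++ Δ) (h₂ : N = Γ₁ ++ L ++ Δ)
    (h₃ : M = Γ ++ b :: Δ₁) (h₄ : M₁ = Γ ++ [a] ++ Δ₁) (h₅ : x = x.subst Γ.length tight)
    (f : C.Multi x M c) :
    C.precomp Γ Δ (.cons p P) hM hN f = C.precomp Γ₁ Δ P h₁ h₂ (C.subst Γ b Δ₁ h₃ h₄ h₅ f p) := by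
  subst hΓ hΔ
  obtain rfl : M₁ = Γ ++ a :: (L' ++ Δ) := by simp [h₁]
  rfl

theorem precomp_congr {x : Tightness} {c : Obj} {L L' : List Obj}
    (P : HomList (fun a b => C.Multi tight [a] b) L L') {Γ Δ M N Γ₁ Δ₁ : List Obj}
    (hΓ : Γ = Γ₁) (hΔ : Δ = Δ₁) (h₁ : M = Γ ++ L' ++ Δ) (h₂ : N = Γ ++ L ++ Δ)
    (f : C.Multi x M c) :
    C.precomp Γ Δ P h₁ h₂ f = C.precomp Γ₁ Δ₁ P (by simp [h₁, hΓ, hΔ]) (by simp [h₂, hΓ, hΔ]) f := by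
  subst hΓ hΔ
  rfl

theorem subst_congr {x y w : Tightness} {L A M : List Obj} {b c : Obj} {Γ Δ Γ₁ Δ₁ : List Obj}
    (hΓ : Γ = Γ₁) (hΔ : Δ = Δ₁) (hL : L = Γ ++ b :: Δ) (hM : M = Γ ++ A ++ Δ)
    (hw : w = x.subst Γ.length y) (g : C.Multi x L c) (f : C.Multi y A b) :
    C.subst Γ b Δ hL hM hw g f =
      C.subst Γ₁ b Δ₁ (by simp [hL, hΓ, hΔ]) (by simp [hM, hΓ, hΔ]) (by simp [hw, hΓ]) g f := by
  subst hΓ hΔ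
  rfl

theorem precomp_id {x : Tightness} {c : Obj} (L : List Obj) : ∀ (Γ Δ : List Obj) {M : List Obj}
    (hM : M = Γ ++ L ++ Δ) (hN : M = Γ ++ L ++ Δ) (f : C.Multi x M c),
    C.precomp Γ Δ (@Homs.id _ C.category L) hM hN f = f := by
  induction L with
  | nil => intros; rfl
  | cons a L ih =>
    intro Γ Δ M hM hN f
    have hM' : M = Γ ++ a :: (L ++ Δ) := by simp [hM]
    refine (precomp_cons (C.id a) _ hM hN rfl rfl (M₁ := M) (by simp [hM']) (by simp [hM'])
      hM' (by simp [hM']) (x.subst_tight _) f).trans ?_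
    rw [ih, C.subst_id]

/-- Postcomposition commutes with precomposition. -/
theorem subst_precomp_post {x : Tightness} {c c' : Obj} (q : C.Multi tight [c] c') :
    ∀ {L L' : List Obj} (P : HomList (fun a b => C.Multi tight [a] b) L L') (Γ Δ : List Obj)
      {M N : List Obj} (hM : M = Γ ++ L' ++ Δ) (hN : N = Γ ++ L ++ Δ) (h₀) (hw) (h₁) (h₂)
      (f : C.Multi x M c),
    (C.subst [] c [] h₀ h₁ hw q (C.precomp Γ Δ P hM hN f) : C.Multi x N c') =
      C.precomp Γ Δ P hM hN (C.subst [] c [] h₀ h₂ hw q f)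
  | _, _, .nil, Γ, Δ, M, N, hM, hN, h₀, hw, h₁, h₂, f => by
      obtain rfl : M = N := hM.trans hN.symm
      rfl
  | _, _, @HomList.cons _ _ a b L L' p P, Γ, Δ, M, N, hM, hN, h₀, hw, h₁, h₂, f => by
      rw [precomp_cons p P hM hN rfl rfl (M₁ := Γ ++ a :: (L' ++ Δ)) (by simp) (by simp [hN])
          (by simp [hM]) (by simp) (x.subst_tight _),
        precomp_cons p P hM hN rfl (Δ₁ := L' ++ Δ ++ []) (by simp) (M₁ := Γ ++ a :: (L' ++ Δ))
          (by simp) (by simp [hN]) (by simp [hM]) (by simp) (x.subst_tight _),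
        subst_precomp_post q P _ _ _ _ _ _ _ (by simp)]
      congr 1
      exact C.subst_assoc [] c [] Γ b (L' ++ Δ) rfl (by simp [hM]) (by simp) _ _ _
        (by simp) hw (by simp [hM]) (by simp) (x.subst_tight _) q f p

theorem precomp_append {x : Tightness} {c : Obj} {K K' : List Obj}
    (Q : HomList (fun a b => C.Multi tight [a] b) K K') :
    ∀ {L L' : List Obj} (P : HomList (fun a b => C.Multi tight [a] b) L L') (Γ Δ : List Obj)
      {M M' N : List Obj}
      (hM : M = Γ ++ (L' ++ K') ++ Δ) (hN : N = Γ ++ (L ++ K) ++ Δ)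
      (h₁ : M = Γ ++ L' ++ (K' ++ Δ)) (h₂ : M' = Γ ++ L ++ (K' ++ Δ))
      (h₃ : M' = Γ ++ L ++ K' ++ Δ) (h₄ : N = Γ ++ L ++ K ++ Δ) (f : C.Multi x M c),
    C.precomp Γ Δ (P.append Q) hM hN f =
      C.precomp (Γ ++ L) Δ Q h₃ h₄ (C.precomp Γ (K' ++ Δ) P h₁ h₂ f)
  | _, _, .nil, Γ, Δ, M, M', N, hM, hN, h₁, h₂, h₃, h₄, f => by
      obtain rfl : M = M' := h₁.trans h₂.symm
      exact precomp_congr Q (by simp) rfl _ _ f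
  | _, _, @HomList.cons _ _ a b L L' p P, Γ, Δ, M, M', N, hM, hN, h₁, h₂, h₃, h₄, f => by
      refine (precomp_cons p (P.append Q) hM hN rfl (Δ₁ := L' ++ (K' ++ Δ)) (by simp)
        (M₁ := Γ ++ a :: (L' ++ (K' ++ Δ))) (by simp) (by simp [hN]) (by simp [hM]) (by simp)
        (x.subst_tight _) f).trans ?_
      rw [precomp_cons p P h₁ h₂ rfl (Δ₁ := L' ++ (K' ++ Δ)) rfl
          (M₁ := Γ ++ a :: (L' ++ (K' ++ Δ))) (by simp) (by simp [h₂]) (by simp [hM]) (by simp)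
          (x.subst_tight _),
        precomp_append Q P (Γ ++ [a]) Δ (M' := M') _ _ (by simp) (by simp [h₂]) (by simp [h₃])
          (by simp [h₄])]
      exact precomp_congr Q (by simp) rfl _ _ _

/-- Substitution in a position before `Ψ` commutes with precomposition. -/
theorem precomp_subst_right {x y w : Tightness} {c b : Obj} {A : List Obj} (f : C.Multi y A b)
    (Γ : List Obj) (hw : w = x.subst Γ.length y) :
    ∀ {L L' : List Obj} (P : HomList (fun a b => C.Multi tight [a] b) L L') (Ψ Δ : List Obj)
      {Θ Θ' M M' N N' : List Obj} (hΘ : Θ = Ψ ++ L' ++ Δ) (hΘ' : Θ' = Ψ ++ L ++ Δ)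
      (hM : M = Γ ++ b :: Θ) (hM' : M' = Γ ++ A ++ Θ)
      (hN : N = Γ ++ b :: Θ') (hN' : N' = Γ ++ A ++ Θ')
      (h₁ : M = (Γ ++ b :: Ψ) ++ L' ++ Δ) (h₂ : N = (Γ ++ b :: Ψ) ++ L ++ Δ)
      (h₃ : M' = (Γ ++ A ++ Ψ) ++ L' ++ Δ) (h₄ : N' = (Γ ++ A ++ Ψ) ++ L ++ Δ)
      (g : C.Multi x M c),
    C.precomp (Γ ++ A ++ Ψ) Δ P h₃ h₄ (C.subst Γ b Θ hM hM' hw g f) =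
      C.subst Γ b Θ' hN hN' hw (C.precomp (Γ ++ b :: Ψ) Δ P h₁ h₂ g) f
  | _, _, .nil, Ψ, Δ, Θ, Θ', M, M', N, N', hΘ, hΘ', hM, hM', hN, hN', h₁, h₂, h₃, h₄, g => by
      obtain rfl : Θ = Θ' := hΘ.trans hΘ'.symm
      obtain rfl : M = N := hM.trans hN.symm
      obtain rfl : M' = N' := hM'.trans hN'.symm
      rfl
  | _, _, @HomList.cons _ _ a a' L L' p P, Ψ, Δ, Θ, Θ', M, M', N, N', hΘ, hΘ', hM, hM', hN, hN',
      h₁, h₂, h₃, h₄, g => by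
      rw [precomp_cons p P h₁ h₂ (Γ₁ := Γ ++ b :: (Ψ ++ [a])) (by simp) rfl
          (M₁ := Γ ++ b :: (Ψ ++ [a] ++ (L' ++ Δ))) (by simp) (by simp [h₂]) (by simp [h₁])
          (by simp) (x.subst_tight _),
        precomp_cons p P h₃ h₄ (Γ₁ := Γ ++ A ++ (Ψ ++ [a])) (by simp) rfl
          (M₁ := Γ ++ A ++ (Ψ ++ [a] ++ (L' ++ Δ))) (by simp) (by simp [h₄]) (by simp [h₃])
          (by simp) (w.subst_tight _),
        ← precomp_subst_right f Γ hw P (Ψ ++ [a]) Δ (Θ := Ψ ++ [a] ++ (L' ++ Δ))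
          (M' := Γ ++ A ++ (Ψ ++ [a] ++ (L' ++ Δ))) (by simp) (by simp [hΘ']) _ rfl _ _ _ _ (by simp) (by simp [hN', hΘ'])]
      congr 1
      rw [subst_congr rfl (show Θ = Ψ ++ a' :: (L' ++ Δ) by simp [hΘ]) hM hM' hw g f]
      exact C.subst_comm Γ b Ψ a' (L' ++ Δ) (by simp [hM, hΘ]) (by simp [hM', hΘ]) hw _ _ _
        (by simp [hM, hΘ]) (by simp) (x.subst_tight _) (by simp) (by simp) hw g f p

/-- Substitution in a position after `Ψ` commutes with precomposition. -/
theorem precomp_subst_left {x y w : Tightness} {c b : Obj} {A : List Obj} (f : C.Multi y A b)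
    (Θ : List Obj) :
    ∀ {L L' : List Obj} (P : HomList (fun a b => C.Multi tight [a] b) L L') (Γ Δ : List Obj)
      {Ψ Ψ' Δ₁ Δ₂ M M' N N' : List Obj} (hΨ : Ψ = Γ ++ L' ++ Δ) (hΨ' : Ψ' = Γ ++ L ++ Δ)
      (hM : M = Ψ ++ b :: Θ) (hM' : M' = Ψ ++ A ++ Θ)
      (hN : N = Ψ' ++ b :: Θ) (hN' : N' = Ψ' ++ A ++ Θ)
      (hΔ₁ : Δ₁ = Δ ++ b :: Θ) (hΔ₂ : Δ₂ = Δ ++ A ++ Θ)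
      (h₁ : M = Γ ++ L' ++ Δ₁) (h₂ : N = Γ ++ L ++ Δ₁)
      (h₃ : M' = Γ ++ L' ++ Δ₂) (h₄ : N' = Γ ++ L ++ Δ₂)
      (hw : w = x.subst Ψ.length y) (hw' : w = x.subst Ψ'.length y) (g : C.Multi x M c),
    C.precomp Γ Δ₂ P h₃ h₄ (C.subst Ψ b Θ hM hM' hw g f) =
      C.subst Ψ' b Θ hN hN' hw' (C.precomp Γ Δ₁ P h₁ h₂ g) f
  | _, _, .nil, Γ, Δ, Ψ, Ψ', Δ₁, Δ₂, M, M', N, N', hΨ, hΨ', hM, hM', hN, hN', hΔ₁, hΔ₂,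
      h₁, h₂, h₃, h₄, hw, hw', g => by
      obtain rfl : Ψ = Ψ' := hΨ.trans hΨ'.symm
      obtain rfl : M = N := hM.trans hN.symm
      obtain rfl : M' = N' := hM'.trans hN'.symm
      rfl
  | _, _, @HomList.cons _ _ a a' L L' p P, Γ, Δ, Ψ, Ψ', Δ₁, Δ₂, M, M', N, N', hΨ, hΨ', hM, hM',
      hN, hN', hΔ₁, hΔ₂, h₁, h₂, h₃, h₄, hw, hw', g => by
      have hwΨ : w = x.subst (Γ ++ [a] ++ (L' ++ Δ)).length y := by
        rw [hw, hΨ]; congr 1; simp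
      rw [precomp_cons p P h₁ h₂ rfl (Δ₁ := (L' ++ Δ) ++ b :: Θ) (by simp [hΔ₁])
          (M₁ := (Γ ++ [a] ++ (L' ++ Δ)) ++ b :: Θ) (by simp [hΔ₁]) (by simp [h₂])
          (by simp [h₁, hΔ₁]) (by simp) (x.subst_tight _),
        precomp_cons p P h₃ h₄ rfl (Δ₁ := (L' ++ Δ) ++ A ++ Θ) (by simp [hΔ₂])
          (M₁ := (Γ ++ [a] ++ (L' ++ Δ)) ++ A ++ Θ) (by simp [hΔ₂]) (by simp [h₄])
          (by simp [h₃, hΔ₂]) (by simp) (w.subst_tight _),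
        ← precomp_subst_left f Θ P (Γ ++ [a]) Δ (Ψ := Γ ++ [a] ++ (L' ++ Δ)) (Ψ' := Ψ')
          (M' := (Γ ++ [a] ++ (L' ++ Δ)) ++ A ++ Θ) (by simp) (by simp [hΨ']) rfl rfl hN hN'
          hΔ₁ hΔ₂ _ _ (by simp [hΔ₂]) (by simp [hN', hΨ', hΔ₂]) hwΨ]
      congr 1
      rw [subst_congr (show Ψ = Γ ++ a' :: (L' ++ Δ) by simp [hΨ]) rfl hM hM' hw g f]
      exact (C.subst_comm Γ a' (L' ++ Δ) b Θ (by simp [hM, hΨ]) (by simp) (x.subst_tight _)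
        (by simp) (by simp) hwΨ (by simp [hM, hΨ]) (by simp [hM', hΨ])
        (by rw [hw, hΨ]; simp) (by simp [hM', hΨ]) (by simp) (w.subst_tight _) g p f).symm

/-- Precomposition of a substitution in the inputs of the inner multimap. -/
theorem precomp_subst_mid {x y w : Tightness} {c b : Obj} (Γ Δ : List Obj)
    (hw : w = x.subst Γ.length y) {K : List Obj} (hK : K = Γ ++ b :: Δ) (g : C.Multi x K c) :
    ∀ {L L' : List Obj} (P : HomList (fun a b => C.Multi tight [a] b) L L') (Ξ Ψ : List Obj)
      {A A' M N Γ₁ Δ₁ : List Obj} (hA : A = Ξ ++ L' ++ Ψ) (hA' : A' = Ξ ++ L ++ Ψ)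
      (hM : M = Γ ++ A ++ Δ) (hN : N = Γ ++ A' ++ Δ)
      (hΓ₁ : Γ₁ = Γ ++ Ξ) (hΔ₁ : Δ₁ = Ψ ++ Δ)
      (h₁ : M = Γ₁ ++ L' ++ Δ₁) (h₂ : N = Γ₁ ++ L ++ Δ₁) (f : C.Multi y A b),
    C.precomp Γ₁ Δ₁ P h₁ h₂ (C.subst Γ b Δ hK hM hw g f) =
      C.subst Γ b Δ hK hN hw g (C.precomp Ξ Ψ P hA hA' f)
  | _, _, .nil, Ξ, Ψ, A, A', M, N, Γ₁, Δ₁, hA, hA', hM, hN, hΓ₁, hΔ₁, h₁, h₂, f => by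
      obtain rfl : A = A' := hA.trans hA'.symm
      obtain rfl : M = N := hM.trans hN.symm
      rfl
  | _, _, @HomList.cons _ _ a a' L L' p P, Ξ, Ψ, A, A', M, N, Γ₁, Δ₁, hA, hA', hM, hN,
      hΓ₁, hΔ₁, h₁, h₂, f => by
      rw [precomp_cons p P hA hA' rfl rfl
          (M₁ := Ξ ++ [a] ++ (L' ++ Ψ)) (by simp) (by simp [hA']) (by simp [hA])
          (by simp) (y.subst_tight _),
        precomp_cons p P h₁ h₂ (Γ₁ := Γ ++ (Ξ ++ [a])) (by simp [hΓ₁]) (Δ₁ := (L' ++ Ψ) ++ Δ)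
          (by simp [hΔ₁])
          (M₁ := Γ ++ (Ξ ++ [a] ++ (L' ++ Ψ)) ++ Δ) (by simp [hΔ₁]) (by simp [h₂, hΓ₁])
          (by simp [h₁, hΓ₁, hΔ₁]) (by simp [hΓ₁]) (w.subst_tight _),
        ← precomp_subst_mid Γ Δ hw hK g P (Ξ ++ [a]) Ψ (M := Γ ++ (Ξ ++ [a] ++ (L' ++ Ψ)) ++ Δ)
          _ _ rfl hN rfl hΔ₁ (by simp [hΔ₁]) (by simp [hN, hA', hΔ₁])]
      congr 1
      subst hΓ₁
      exact (C.subst_assoc Γ b Δ Ξ a' (L' ++ Ψ) hK (by simp [hA]) rfl (y.subst_tight _) rfl hw hM hw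
        (by simp [hM, hA]) (by simp) (w.subst_tight _) g f p).symm

/-- Precomposition is functorial. -/
theorem precomp_comp {x : Tightness} {c : Obj} :
    ∀ {L L' L'' : List Obj} (P : HomList (fun a b => C.Multi tight [a] b) L L')
      (Q : HomList (fun a b => C.Multi tight [a] b) L' L'') (Γ Δ : List Obj) {M M' N : List Obj}
      (hM : M = Γ ++ L'' ++ Δ) (hM' : M' = Γ ++ L' ++ Δ) (hN : N = Γ ++ L ++ Δ)
      (f : C.Multi x M c),
    C.precomp Γ Δ (@Homs.comp _ C.category _ _ _ P Q) hM hN f =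
      C.precomp Γ Δ P hM' hN (C.precomp Γ Δ Q hM hM' f)
  | _, _, _, .nil, .nil, Γ, Δ, M, M', N, hM, hM', hN, f => by
      obtain rfl : M = M' := hM.trans hM'.symm
      obtain rfl : M = N := hM.trans hN.symm
      rfl
  | _, _, _, @HomList.cons _ _ a₁ a₂ L₁ L₂ p P, @HomList.cons _ _ _ a₃ _ L₃ q Q, Γ, Δ, M, M', N,
      hM, hM', hN, f => by
      refine (precomp_cons (C.subst [] a₂ [] rfl rfl rfl q p) (@Homs.comp _ C.category _ _ _ P Q)
        hM hN rfl rfl (M₁ := Γ ++ [a₁] ++ (L₃ ++ Δ)) (by simp) (by simp [hN]) (by simp [hM])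
        (by simp) (x.subst_tight _) f).trans ?_
      rw [precomp_cons q Q hM hM' rfl rfl (M₁ := Γ ++ [a₂] ++ (L₃ ++ Δ)) (by simp) (by simp [hM'])
          (by simp [hM]) (by simp) (x.subst_tight _),
        precomp_cons p P hM' hN rfl rfl (M₁ := Γ ++ [a₁] ++ (L₂ ++ Δ)) (by simp) (by simp [hN])
          (by simp [hM']) (by simp) (x.subst_tight _),
        precomp_comp P Q (Γ ++ [a₁]) Δ (M' := Γ ++ [a₁] ++ (L₂ ++ Δ)) _ (by simp) _]
      congr 1
      refine (congrArg (C.precomp (Γ ++ [a₁]) Δ Q _ _)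
        ((C.subst_assoc Γ a₃ (L₃ ++ Δ) [] a₂ [] (by simp [hM]) rfl rfl rfl rfl (x.subst_tight _)
          (M := Γ ++ [a₂] ++ (L₃ ++ Δ)) rfl (x.subst_tight _) (by simp) (by simp)
          (x.subst_tight _) f q p).trans
          (subst_congr (show Γ ++ [] = Γ by simp) rfl _ _ _ _ _))).trans ?_
      have := precomp_subst_right (w := x) p Γ (x.subst_tight _) Q [] Δ (Θ := L₃ ++ Δ) (Θ' := L₂ ++ Δ)
        (M := Γ ++ [a₂] ++ (L₃ ++ Δ)) (M' := Γ ++ [a₁] ++ (L₃ ++ Δ)) (N := M')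
        (N' := Γ ++ [a₁] ++ (L₂ ++ Δ))
        (by simp) (by simp) (by simp) (by simp) (by simp [hM']) (by simp) (by simp)
        (by simp [hM']) (by simp) (by simp) (C.subst Γ a₃ (L₃ ++ Δ) (by simp [hM]) rfl (x.subst_tight _) f q)
      rw [precomp_congr Q (show Γ ++ [a₁] ++ [] = Γ ++ [a₁] by simp) rfl] at this
      exact this

theorem precomp_j {c : Obj} :
    ∀ {L L' : List Obj} (P : HomList (fun a b => C.Multi tight [a] b) L L') (Γ Δ : List Obj)
      {M N : List Obj} (hM : M = Γ ++ L' ++ Δ) (hN : N = Γ ++ L ++ Δ) (f : C.Multi tight M c),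
    C.precomp Γ Δ P hM hN (C.j f) = C.j (C.precomp Γ Δ P hM hN f)
  | _, _, .nil, Γ, Δ, M, N, hM, hN, f => by
      obtain rfl : M = N := hM.trans hN.symm
      rfl
  | _, _, @HomList.cons _ _ a b L L' p P, Γ, Δ, M, N, hM, hN, f => by
      rw [precomp_cons p P hM hN rfl rfl (M₁ := Γ ++ a :: (L' ++ Δ)) (by simp) (by simp [hN])
          (by simp [hM]) (by simp) (Tightness.subst_tight _ _),
        precomp_cons p P hM hN rfl rfl (M₁ := Γ ++ a :: (L' ++ Δ)) (by simp) (by simp [hN])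
          (by simp [hM]) (by simp) (Tightness.subst_tight _ _), C.j_subst, precomp_j P]

/-- Precomposition with a single morphism is substitution. -/
theorem precomp_single {x : Tightness} {a b c : Obj} (Γ Δ : List Obj) (p : C.Multi tight [a] b)
    {M N : List Obj} (h₁ : M = [] ++ (Γ ++ b :: Δ) ++ []) (h₂ : N = [] ++ (Γ ++ a :: Δ) ++ [])
    (h₃ : M = Γ ++ b :: Δ) (h₄ : N = Γ ++ [a] ++ Δ) (h₅ : x = x.subst Γ.length tight)
    (f : C.Multi x M c) :
    C.precomp [] [] (HomList.append (@Homs.id _ C.category Γ)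
        (.cons p (@Homs.id _ C.category Δ))) h₁ h₂ f =
      C.subst Γ b Δ h₃ h₄ h₅ f p := by
  refine (precomp_append (.cons p (@Homs.id _ C.category Δ)) (@Homs.id _ C.category Γ) [] []
    (M' := M) h₁ h₂ (by simp [h₁]) (by simp [h₁]) (by simp [h₁]) (by simp [h₂]) f).trans ?_
  rw [precomp_id]
  refine (precomp_cons p (@Homs.id _ C.category Δ) _ _ rfl rfl (M₁ := N) (by simp [h₂])
    (by simp [h₂]) (by simp [h₁]) (by simp [h₂]) (Tightness.subst_tight _ _) f).trans ?_
  rw [precomp_id]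
  exact subst_congr (by simp) (by simp) _ _ _ _ _

variable (C)

/-- The action of morphisms on multimaps. -/
def map {x : Tightness} {L L' : List Obj} {c c' : Obj} (P : @Homs _ C.category L' L)
    (q : C.Multi tight [c] c') (f : C.Multi x L c) : C.Multi x L' c' :=
  C.subst (M := L') [] c [] rfl (by simp) rfl q
    (C.precomp (M := L) (N := L') [] [] P (by simp) (by simp) f)

variable {C}

theorem map_id_right {x : Tightness} {L L' : List Obj} {c : Obj} (P : @Homs _ C.category L' L)
    (f : C.Multi x L c) : C.map P (C.id c) f = C.precomp [] [] P (by simp) (by simp) f :=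
  C.id_subst _ _

theorem map_id_left {x : Tightness} {L : List Obj} {c c' : Obj} (q : C.Multi tight [c] c')
    (f : C.Multi x L c) : C.map (@Homs.id _ C.category L) q f =
      C.subst [] c [] rfl (by simp) rfl q f :=
  congrArg (C.subst [] c [] rfl (by simp) rfl q) (precomp_id L [] [] (by simp) (by simp) f)

theorem map_single {x : Tightness} {a b c : Obj} (Γ Δ : List Obj) (p : C.Multi tight [a] b)
    (h₄ : Γ ++ a :: Δ = Γ ++ [a] ++ Δ) (h₅ : x = x.subst Γ.length tight)
    (f : C.Multi x (Γ ++ b :: Δ) c) :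
    C.map (HomList.append (@Homs.id _ C.category Γ) (.cons p (@Homs.id _ C.category Δ)))
        (C.id c) f = C.subst Γ b Δ rfl h₄ h₅ f p :=
  (map_id_right _ _).trans (precomp_single Γ Δ p _ _ rfl h₄ h₅ f)

theorem map_comp {x : Tightness} {L L' L'' : List Obj} {c c' c'' : Obj}
    (P : @Homs _ C.category L'' L') (Q : @Homs _ C.category L' L)
    (p : C.Multi tight [c] c') (q : C.Multi tight [c'] c'') (f : C.Multi x L c) :
    C.map (@Homs.comp _ C.category _ _ _ P Q) (C.subst [] c' [] rfl rfl rfl q p) f =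
      C.map P q (C.map Q p f) := by
  unfold map
  rw [precomp_comp P Q [] [] (M' := L') _ (by simp),
    ← subst_precomp_post p P [] [] (M := L') (by simp) (by simp) rfl rfl (by simp) (by simp)]
  exact (C.subst_assoc (x := tight) (y := tight) (z := x) [] c' [] [] c [] rfl rfl (by simp) rfl
    (by simp) rfl rfl rfl rfl (by simp) rfl q p _).symm

theorem map_subst {x y w : Tightness} {Γ Γ' A A' Δ Δ' : List Obj} {b c c' : Obj}
    (hw : w = x.subst Γ.length y) (hw' : w = x.subst Γ'.length y)
    (P : @Homs _ C.category Γ' Γ) (Q : @Homs _ C.category A' A) (R : @Homs _ C.category Δ' Δ)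
    (q : C.Multi tight [c] c') (g : C.Multi x (Γ ++ b :: Δ) c) (f : C.Multi y A b) :
    C.map ((P.append Q).append R) q (C.subst Γ b Δ rfl rfl hw g f) =
      C.subst Γ' b Δ' rfl rfl hw' (C.map (P.append (.cons (C.id b) R)) q g)
        (C.map Q (C.id b) f) := by
  rw [map_id_right]
  unfold map
  have e₁ := precomp_append (C := C) R (P.append Q) [] [] (M := Γ ++ A ++ Δ)
    (M' := Γ' ++ A' ++ Δ) (N := Γ' ++ A' ++ Δ') (by simp) (by simp) (by simp) (by simp) (by simp)
    (by simp) (C.subst Γ b Δ rfl rfl hw g f)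
  have e₂ := precomp_append (C := C) Q P [] (Δ ++ []) (M := Γ ++ A ++ Δ)
    (M' := Γ' ++ A ++ Δ) (N := Γ' ++ A' ++ Δ) (by simp) (by simp) (by simp) (by simp) (by simp)
    (by simp) (C.subst Γ b Δ rfl rfl hw g f)
  have e₃ := precomp_append (C := C) (.cons (C.id b) R) P [] [] (M := Γ ++ b :: Δ)
    (M' := Γ' ++ b :: Δ) (N := Γ' ++ b :: Δ') (by simp) (by simp) (by simp) (by simp) (by simp)
    (by simp) g
  have e₄ := precomp_cons (C := C) (C.id b) R (Γ := [] ++ Γ') (Δ := []) (M := Γ' ++ b :: Δ)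
    (N := Γ' ++ b :: Δ') (by simp) (by simp) rfl rfl (M₁ := Γ' ++ b :: Δ) (by simp) (by simp)
    (by simp) (by simp) (x.subst_tight _)
    (C.precomp [] (b :: Δ ++ []) P (by simp) (by simp) g)
  rw [C.subst_id] at e₄
  have e₅ := precomp_subst_left f Δ P [] [] (Ψ := Γ) (Ψ' := Γ') (Δ₁ := b :: Δ ++ [])
    (Δ₂ := A ++ (Δ ++ [])) (by simp) (by simp) rfl rfl (N := Γ' ++ b :: Δ) rfl
    (N' := Γ' ++ A ++ Δ) rfl (by simp) (by simp) (by simp) (by simp) (by simp) (by simp) hw hw' g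
  have e₆ := precomp_subst_mid (C := C) Γ' Δ hw' rfl
    (C.precomp [] (b :: Δ ++ []) P (by simp) (by simp) g) Q [] [] (A' := A') (by simp) (by simp)
    rfl rfl (Γ₁ := [] ++ Γ') (Δ₁ := Δ ++ []) (by simp) (by simp) (by simp) (by simp) f
  have e₇ := precomp_subst_right (C := C) (C.precomp [] [] Q (by simp) (by simp) f) Γ' hw' R [] []
    (Θ := Δ) (Θ' := Δ') (by simp) (by simp) rfl rfl (N := Γ' ++ b :: Δ') rfl
    (N' := Γ' ++ A' ++ Δ') rfl (by simp) (by simp) (by simp) (by simp)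
    (C.precomp [] (b :: Δ ++ []) P (by simp) (by simp) g)
  have e₈ := C.subst_assoc (x := tight) (y := x) (z := y) (s := w) (t := x) (w := w) (L := [c])
    (A := Γ' ++ b :: Δ') (B := A') (M := Γ' ++ b :: Δ') (A' := Γ' ++ A' ++ Δ')
    (N := Γ' ++ A' ++ Δ') [] c [] Γ' b Δ' rfl rfl rfl hw' (by simp) rfl (by simp) rfl
    (by simp) (by simp) hw' q
    (C.precomp [] [] (P.append (.cons (C.id b) R)) (by simp) (by simp) g)
    (C.precomp [] [] Q (by simp) (by simp) f)
  rw [e₁, e₂, e₅, e₆, precomp_congr R (show [] ++ (Γ' ++ A') = Γ' ++ A' ++ [] by simp) rfl, e₇]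
  refine Eq.trans ?_ (e₈.trans (subst_congr rfl (by simp) _ _ _ _ _))
  rw [e₃, e₄]
  congr 2

variable (C)

/-- The underlying short skew multicategory: it has the same multimaps in low arities, and the
same operations. -/
def toShort : ShortSkewMulticategory.{u, v} Obj where
  toCategory := C.category
  Multi x L _ c := C.Multi x L c
  map P q f := C.map P q f
  map_id f := (map_id_left _ _).trans (C.id_subst _ _)
  map_comp P Q p q f := map_comp P Q p q f
  unary := Equiv.refl _
  map_unary p f q := by
    exact C.subst_assoc [] _ [] [] _ [] rfl rfl rfl rfl rfl rfl rfl rfl rfl rfl rfl q f p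
  j f := C.j f
  map_j P q f := by
    unfold map
    rw [precomp_j]
    exact C.subst_j (x := tight) [] _ [] rfl _ rfl rfl q _
  subst Γ b Δ _ hL hM hw g f := C.subst Γ b Δ hL hM hw g f
  unary_subst hs hM q f := (map_id_left _ _).symm
  subst_unary Γ b Δ hx hz hs hM hw g p := (map_single Γ Δ p hM hw g).symm
  subst_natural hs hs' hw hw' P Q R q g f := map_subst hw hw' P Q R q g f
  subst_dinatural := by
    intro x y w Γ A Δ b b' c hx hx' hy hz hs hs' hw p g f
    refine (congrArg (fun k => C.subst Γ b Δ rfl rfl hw k f)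
      (map_single Γ Δ p (by simp) (x.subst_tight _) g)).trans ?_
    refine Eq.trans ?_ (congrArg (fun k => C.subst Γ b' Δ rfl rfl hw g k) (map_id_left p f).symm)
    refine Eq.trans ?_ (C.subst_assoc (M := Γ ++ b :: Δ) Γ b' Δ [] b [] rfl rfl (by simp) rfl rfl hw (by simp)
      (x.subst_tight _) (by simp) (by simp) (by simpa using hw) g p f).symm
    exact subst_congr (by simp) (by simp) _ _ _ _ _
  subst_assoc := by
    intros
    apply C.subst_assoc
  subst_comm := by
    intro y z s t w A B M M' N b b' c kL kA kB kM kM' kN hA hB e₁ e₂ e₃ e₄ hM hs hM₁ hN hw hM'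
      ht hM₁' hN' hw' h g f
    have := C.subst_comm (x := tight) (M := M) (M' := M') (N := N) [] b [] b' [] rfl hM hs (by simp [hM]) (by simp [hN]) (by simpa using hw) rfl
      hM' ht (by simp [hM']) (by simp [hN]) hw' h g f
    refine (subst_congr (by simp) rfl _ _ _ _ _).trans (this.trans (subst_congr rfl (by simp) _ _ _ _ _))
  subst_j_unary_fst := by
    intro a b b' c h₂ h₂' k₁ k₂ k₁' g p
    refine (C.subst_j (x := tight) [] b [b'] rfl rfl rfl rfl g p).trans (congrArg C.j ?_)
    exact (map_single [] [b'] p rfl rfl g).symm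
  subst_j_unary_snd := by
    intro a b b' c h₂ h₂' k₁ k₁' g p
    refine (C.subst_j' (x := tight) [b] b' [] rfl rfl rfl rfl g p).trans ?_
    exact (map_single [b] [] p rfl rfl g).symm
  j_unary_subst_binary := by
    intro a a' b c h₂ h₂' k₁ k₂ k₁' p g
    refine (C.j_subst [] b [] rfl rfl rfl rfl p g).trans (congrArg C.j ?_)
    exact (map_id_left p g).symm
  j_unary_subst_nullary := by
    intro b c h₀ h₀' k₁ k₁' p v
    refine (C.j_subst' [] b [] rfl rfl rfl rfl p v).trans ?_
    exact (map_id_left (L := []) p v).symm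
end SkewMulticategory

/-! ## The short braiding underlying a braiding -/

theorem BraidGroup.σ_mem_braids {n k : ℕ} (h₀ : 1 ≤ k) (h : k + 1 < n) (x : Tightness) :
    BraidGroup.σ n k ∈ braids n x := by
  cases x
  · exact Subgroup.subset_closure ⟨k, h₀, h, rfl⟩
  · exact Subgroup.mem_top _

theorem Rearranges.symm {Obj : Type u} {n : ℕ} {π : Equiv.Perm (Fin n)} {L M : List Obj}
    (h : Rearranges π L M) : Rearranges π⁻¹ M L :=
  ⟨h.2.1, h.1, fun i => by rw [h.2.2]; simp⟩

theorem Rearranges.trans {Obj : Type u} {n : ℕ} {π ρ : Equiv.Perm (Fin n)} {L M N : List Obj}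
    (h : Rearranges π L M) (h' : Rearranges ρ M N) : Rearranges (π * ρ) L N :=
  ⟨h.1, h'.2.1, fun i => by rw [h'.2.2, h.2.2]; rfl⟩

theorem rearranges_adjSwap {Obj : Type u} {n k : ℕ} (Γ : List Obj) (a b : Obj) (Δ : List Obj)
    (hk : Γ.length = k) (hn : Γ.length + 2 + Δ.length = n) :
    Rearranges (BraidGroup.adjSwap n k) (Γ ++ a :: b :: Δ) (Γ ++ b :: a :: Δ) := by
  refine ⟨by simp; omega, by simp; omega, fun i => ?_⟩
  rw [BraidGroup.adjSwap_val (by omega)]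
  rcases (show (i : ℕ) < k ∨ (i : ℕ) = k ∨ (i : ℕ) = k + 1 ∨ k + 1 < (i : ℕ) by omega) with
    h | h | h | h
  · rw [BraidGroup.natSwap_lt h, List.getElem?_append_left (by omega),
      List.getElem?_append_left (by omega)]
  · rw [h, BraidGroup.natSwap_self, ← hk]; simp
  · rw [h, BraidGroup.natSwap_succ, ← hk]; simp
  · rw [BraidGroup.natSwap_gt h, List.getElem?_append_right (by omega),
      List.getElem?_append_right (by omega)]
    obtain ⟨d, hd⟩ : ∃ d, (i : ℕ) - Γ.length = d + 2 := ⟨i - Γ.length - 2, by omega⟩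
    simp [hd]

theorem rearranges_σ {Obj : Type u} {n k : ℕ} (Γ : List Obj) (a b : Obj) (Δ : List Obj)
    (hk : Γ.length = k) (hn : Γ.length + 2 + Δ.length = n) :
    Rearranges (BraidGroup.perm (BraidGroup.σ n k)) (Γ ++ a :: b :: Δ) (Γ ++ b :: a :: Δ) := by
  rw [BraidGroup.perm_σ (by omega)]
  exact rearranges_adjSwap Γ a b Δ hk hn

namespace SkewMulticategory

namespace Braiding

open BraidGroup

variable {Obj : Type u} {C : SkewMulticategory.{u, v} Obj} (B : C.Braiding)

theorem act_congr {x : Tightness} {n : ℕ} {L M : List Obj} {c : Obj} {r s : BraidGroup n}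
    (hr : r ∈ braids n x) (hs : s ∈ braids n x) (hM : Rearranges (perm r) L M)
    (hM' : Rearranges (perm s) L M) (h : r = s) (f : C.Multi x L c) :
    B.act r hr hM f = B.act s hs hM' f := by
  subst h
  rfl

/-- The action of the crossing of the strands in positions `k = Γ.length` and `k + 1` on tight
multimaps, where `1 ≤ k`. -/
def swap {c : Obj} (n k : ℕ) (hk : 1 ≤ k) (Γ : List Obj) (a b : Obj) (Δ : List Obj)
    (hΓ : Γ.length = k) (hn : Γ.length + 2 + Δ.length = n) :
    C.Multi tight (Γ ++ a :: b :: Δ) c ≃ C.Multi tight (Γ ++ b :: a :: Δ) c where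
  toFun f := B.act (σ n k) (σ_mem_braids hk (by omega) _) (rearranges_σ Γ a b Δ hΓ hn) f
  invFun f := B.act (σ n k)⁻¹ (inv_mem (σ_mem_braids hk (by omega) _))
    (by rw [map_inv]; exact (rearranges_σ Γ a b Δ hΓ hn).symm) f
  left_inv f := by
    have h : Rearranges (perm (σ n k * (σ n k)⁻¹)) (Γ ++ a :: b :: Δ) (Γ ++ a :: b :: Δ) := by
      rw [map_mul, map_inv]
      exact (rearranges_σ Γ a b Δ hΓ hn).trans (rearranges_σ Γ a b Δ hΓ hn).symm
    beta_reduce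
    rw [← B.act_mul (σ n k) (σ n k)⁻¹ _ _ (by rw [mul_inv_cancel]; exact one_mem _) _ _ h,
      B.act_congr _ (one_mem _) _ (by rw [mul_inv_cancel] at h; exact h) (mul_inv_cancel _), B.act_one]
  right_inv f := by
    have h : Rearranges (perm ((σ n k)⁻¹ * σ n k)) (Γ ++ b :: a :: Δ) (Γ ++ b :: a :: Δ) := by
      rw [map_mul, map_inv]
      exact (rearranges_σ Γ a b Δ hΓ hn).symm.trans (rearranges_σ Γ a b Δ hΓ hn)
    beta_reduce
    rw [← B.act_mul (σ n k)⁻¹ (σ n k) _ _ (by rw [inv_mul_cancel]; exact one_mem _) _ _ h,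
      B.act_congr _ (one_mem _) _ (by rw [inv_mul_cancel] at h; exact h) (inv_mul_cancel _), B.act_one]

theorem cable_unary {n k : ℕ} (h : n + 1 = n + 1) (i : Fin n) (hk : k + 1 < n) :
    cable h i (σ n k) = σ n k := by
  rw [cable_σ h i hk]
  unfold cableGen
  split_ifs <;> simp [blockR, blockL]

/-- Crossings commute with the substitution of a morphism. -/
theorem subst_unary_act {n k : ℕ} {L L' M M' : List Obj} {a b c : Obj}
    (hk : 1 ≤ k) (hn : k + 1 < n) (Γ Γ' Δ Δ' : List Obj)
    (hL : L = Γ ++ b :: Δ) (hM : M = Γ ++ [a] ++ Δ) (hw : tight = tight.subst Γ.length tight)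
    (hL' : L' = Γ' ++ b :: Δ') (hM' : M' = Γ' ++ [a] ++ Δ')
    (hw' : tight = tight.subst Γ'.length tight)
    (hr : σ n k ∈ braids n tight) (hLL' : Rearranges (perm (σ n k)) L L')
    (hMM' : Rearranges (perm (σ n k)) M M')
    (hi : Γ'.length < n) (hΓ : natSwap k Γ'.length = Γ.length)
    (g : C.Multi tight L c) (p : C.Multi tight [a] b) :
    C.subst Γ' b Δ' hL' hM' hw' (B.act (σ n k) hr hLL' g) p =
      B.act (σ n k) hr hMM' (C.subst Γ b Δ hL hM hw g p) := by
  have e := cable_unary (k := k) rfl (⟨Γ'.length, hi⟩ : Fin n) hn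
  refine (B.act_subst Γ Γ' b Δ Δ' hL hM hw hL' hM' hw' (σ n k) hr hLL' ⟨Γ'.length, hi⟩ rfl ?_ rfl
    rfl (by rw [e]; exact hr) (by rw [e]; exact hMM') g p).trans ?_
  · rw [perm_σ hn, adjSwap_val hn]
    exact hΓ
  · exact B.act_congr _ _ _ _ e _

/-- Crossings commute with the action of a morphism on the codomain. -/
theorem act_post {n k : ℕ} {L L' : List Obj} {b c : Obj} (hk : 1 ≤ k) (hn : k + 1 < n)
    (hM : L = [] ++ L ++ []) (hM' : L' = [] ++ L' ++ [])
    (hr : σ n k ∈ braids n tight) (hLL' : Rearranges (perm (σ n k)) L L')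
    (q : C.Multi tight [b] c) (f : C.Multi tight L b) :
    C.subst [] b [] rfl hM' rfl q (B.act (σ n k) hr hLL' f) =
      B.act (σ n k) hr hLL' (C.subst [] b [] rfl hM rfl q f) := by
  have e : pad (m := n) (p := n) ([] : List Obj).length (by simp) (σ n k) = σ n k := by
    rw [pad_σ _ _ hn]
    simp
  refine (B.subst_act (p := n) [] b [] rfl hM hM' rfl (σ n k) hr hLL' (by simp) (by rw [e]; exact hr)
    (by rw [e]; exact hLL') q f).trans ?_
  exact B.act_congr _ _ _ _ e _

theorem subst_act_σ {m k p l : ℕ} {L A A' M M' : List Obj} {b c : Obj} (Γ Δ : List Obj)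
    (hL : L = Γ ++ b :: Δ) (hM : M = Γ ++ A ++ Δ) (hM' : M' = Γ ++ A' ++ Δ)
    (hw : tight = tight.subst Γ.length tight) (hk : k + 1 < m)
    (hr : σ m k ∈ braids m tight) (hA : Rearranges (perm (σ m k)) A A')
    (hp : Γ.length + m ≤ p) (hl : l = Γ.length + k) (hr' : σ p l ∈ braids p tight)
    (hA' : Rearranges (perm (σ p l)) M M')
    (g : C.Multi tight L c) (f : C.Multi tight A b) :
    C.subst Γ b Δ hL hM' hw g (B.act (σ m k) hr hA f) =
      B.act (σ p l) hr' hA' (C.subst Γ b Δ hL hM hw g f) := by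
  have e : pad Γ.length hp (σ m k) = σ p l := by rw [pad_σ _ _ hk, hl]
  refine (B.subst_act Γ b Δ hL hM hM' hw (σ m k) hr hA hp (by rw [e]; exact hr')
    (by rw [e]; exact hA') g f).trans ?_
  exact B.act_congr _ _ _ _ e _

theorem act_σ_subst {n m p k i : ℕ} {L L' A M M' : List Obj} {b c : Obj} (s : BraidGroup p)
    (Γ Γ' Δ Δ' : List Obj)
    (hL : L = Γ ++ b :: Δ) (hM : M = Γ ++ A ++ Δ) (hw : tight = tight.subst Γ.length tight)
    (hL' : L' = Γ' ++ b :: Δ') (hM' : M' = Γ' ++ A ++ Δ')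
    (hw' : tight = tight.subst Γ'.length tight) (hk : k + 1 < n)
    (hr : σ n k ∈ braids n tight) (hLL' : Rearranges (perm (σ n k)) L L')
    (hi : i < n) (hΓ' : i = Γ'.length) (hΓ : natSwap k i = Γ.length) (hA : A.length = m)
    (h : p + 1 = n + m) (hs : s = cableGen p m k i) (hr' : s ∈ braids p tight)
    (hMM' : Rearranges (perm s) M M')
    (g : C.Multi tight L c) (f : C.Multi tight A b) :
    C.subst Γ' b Δ' hL' hM' hw' (B.act (σ n k) hr hLL' g) f =
      B.act s hr' hMM' (C.subst Γ b Δ hL hM hw g f) := by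
  have e : cable h ⟨i, hi⟩ (σ n k) = s := by rw [cable_σ h _ hk, hs]
  refine (B.act_subst Γ Γ' b Δ Δ' hL hM hw hL' hM' hw' (σ n k) hr hLL' ⟨i, hi⟩ hΓ' ?_ hA h
    (by rw [e]; exact hr') (by rw [e]; exact hMM') g f).trans ?_
  · rw [perm_σ hk, adjSwap_val hk]
    exact hΓ
  · exact B.act_congr _ _ _ _ e _

/-- The short braiding underlying a braiding: `β₃₂`, `β₄₂` and `β₄₃` are the actions of the
crossings of the strands in positions `1, 2` and `2, 3` (counted from `0`). -/
def toShort : C.toShort.ShortBraiding where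
  β₃₂ {a₁ a₂ a₃ _} := B.swap 3 1 le_rfl [a₁] a₂ a₃ [] rfl rfl
  β₄₂ {a₁ a₂ a₃ a₄ _} := B.swap 4 1 le_rfl [a₁] a₂ a₃ [a₄] rfl rfl
  β₄₃ {a₁ a₂ a₃ a₄ _} := B.swap 4 2 (by decide) [a₁, a₂] a₃ a₄ [] rfl rfl
  β₃₂_natural := by
    intro a₁ a₂ a₃ b a₁' a₂' a₃' b' p₁ p₂ p₃ q f
    have m := σ_mem_braids (n := 3) (k := 1) (by decide) (by decide) tight
    refine (B.act_post (n := 3) (k := 1) (by decide) (by decide) rfl rfl m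
      (rearranges_σ [a₁'] _ _ [] rfl rfl) q _).symm.trans ?_
    refine congrArg (C.subst [] b [] rfl rfl rfl q) (Eq.symm ?_)
    refine (congrArg (fun k : C.Multi tight [a₁', a₃, a₂] b =>
      (C.subst [a₁', a₃'] a₂ [] rfl rfl rfl
        (C.subst [a₁'] a₃ [a₂] rfl rfl rfl k p₃ : C.Multi tight [a₁', a₃', a₂] b) p₂ :
        C.Multi tight [a₁', a₃', a₂'] b))
      (B.subst_unary_act (n := 3) (k := 1) (by decide) (by decide) [] [] [a₂, a₃] [a₃, a₂]
        rfl rfl rfl rfl rfl rfl m _ (rearranges_σ [a₁'] _ _ [] rfl rfl) (by simp) rfl f p₁)).trans ?_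
    refine (congrArg (fun k : C.Multi tight [a₁', a₃', a₂] b =>
      (C.subst [a₁', a₃'] a₂ [] rfl rfl rfl k p₂ : C.Multi tight [a₁', a₃', a₂'] b))
      (B.subst_unary_act (n := 3) (k := 1) (by decide) (by decide) [a₁', a₂] [a₁'] [] [a₂]
        rfl rfl rfl rfl rfl rfl m _ (rearranges_σ [a₁'] _ _ [] rfl rfl) (by simp) rfl _ p₃)).trans ?_
    refine (B.subst_unary_act (n := 3) (k := 1) (by decide) (by decide) [a₁'] [a₁', a₃'] [a₃'] []
        rfl rfl rfl rfl rfl rfl m _ (rearranges_σ [a₁'] _ _ [] rfl rfl) (by simp) rfl _ p₂).trans ?_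
    refine congrArg (B.act (σ 3 1) m (rearranges_σ [a₁'] _ _ [] rfl rfl)) ?_
    exact (C.subst_comm (x := tight) (y := tight) (z := tight) (A := [a₂']) (B := [a₃']) [a₁'] a₂ [] a₃ [] rfl rfl rfl rfl rfl rfl rfl rfl rfl rfl rfl
      rfl _ p₂ p₃).symm
  β₄₂_natural := by
    intro a₁ a₂ a₃ a₄ b a₁' a₂' a₃' a₄' b' p₁ p₂ p₃ p₄ q f
    have m := σ_mem_braids (n := 4) (k := 1) (by decide) (by decide) tight
    refine (B.act_post (n := 4) (k := 1) (by decide) (by decide) rfl rfl m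
      (rearranges_σ [a₁'] _ _ [a₄'] rfl rfl) q _).symm.trans ?_
    refine congrArg (C.subst [] b [] rfl rfl rfl q) (Eq.symm ?_)
    refine (congrArg (fun k : C.Multi tight [a₁', a₃, a₂, a₄] b =>
      (C.subst [a₁', a₃', a₂'] a₄ [] rfl rfl rfl
        (C.subst [a₁', a₃'] a₂ [a₄] rfl rfl rfl
        (C.subst [a₁'] a₃ [a₂, a₄] rfl rfl rfl k p₃ : C.Multi tight [a₁', a₃', a₂, a₄] b) p₂ :
        C.Multi tight [a₁', a₃', a₂', a₄] b) p₄ : C.Multi tight [a₁', a₃', a₂', a₄'] b))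
      (B.subst_unary_act (n := 4) (k := 1) (by decide) (by decide) [] [] [a₂, a₃, a₄] [a₃, a₂, a₄]
        rfl rfl rfl rfl rfl rfl m _ (rearranges_σ [a₁'] _ _ [a₄] rfl rfl) (by simp) rfl f p₁)).trans ?_
    refine (congrArg (fun k : C.Multi tight [a₁', a₃', a₂, a₄] b =>
      (C.subst [a₁', a₃', a₂'] a₄ [] rfl rfl rfl
        (C.subst [a₁', a₃'] a₂ [a₄] rfl rfl rfl k p₂ :
        C.Multi tight [a₁', a₃', a₂', a₄] b) p₄ : C.Multi tight [a₁', a₃', a₂', a₄'] b))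
      (B.subst_unary_act (n := 4) (k := 1) (by decide) (by decide) [a₁', a₂] [a₁'] [a₄] [a₂, a₄]
        rfl rfl rfl rfl rfl rfl m _ (rearranges_σ [a₁'] _ _ [a₄] rfl rfl) (by simp) rfl _ p₃)).trans ?_
    refine (congrArg (fun k : C.Multi tight [a₁', a₃', a₂', a₄] b =>
      (C.subst [a₁', a₃', a₂'] a₄ [] rfl rfl rfl k p₄ : C.Multi tight [a₁', a₃', a₂', a₄'] b))
      (B.subst_unary_act (n := 4) (k := 1) (by decide) (by decide) [a₁'] [a₁', a₃'] [a₃', a₄] [a₄]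
        rfl rfl rfl rfl rfl rfl m _ (rearranges_σ [a₁'] _ _ [a₄] rfl rfl) (by simp) rfl _ p₂)).trans ?_
    refine (B.subst_unary_act (n := 4) (k := 1) (by decide) (by decide) [a₁', a₂', a₃']
      [a₁', a₃', a₂'] [] []
        rfl rfl rfl rfl rfl rfl m _ (rearranges_σ [a₁'] _ _ [a₄'] rfl rfl) (by simp) rfl _ p₄).trans ?_
    refine congrArg (B.act (σ 4 1) m (rearranges_σ [a₁'] _ _ [a₄'] rfl rfl)) ?_
    refine congrArg (fun k : C.Multi tight [a₁', a₂', a₃', a₄] b =>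
      (C.subst [a₁', a₂', a₃'] a₄ [] rfl rfl rfl k p₄ : C.Multi tight [a₁', a₂', a₃', a₄'] b)) ?_
    exact (C.subst_comm (x := tight) (y := tight) (z := tight) (A := [a₂']) (B := [a₃']) [a₁'] a₂ [] a₃ [a₄] rfl rfl rfl rfl rfl rfl rfl rfl rfl rfl rfl
      rfl _ p₂ p₃).symm
  β₄₃_natural := by
    intro a₁ a₂ a₃ a₄ b a₁' a₂' a₃' a₄' b' p₁ p₂ p₃ p₄ q f
    have m := σ_mem_braids (n := 4) (k := 2) (by decide) (by decide) tight
    refine (B.act_post (n := 4) (k := 2) (by decide) (by decide) rfl rfl m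
      (rearranges_σ [a₁', a₂'] _ _ [] rfl rfl) q _).symm.trans ?_
    refine congrArg (C.subst [] b [] rfl rfl rfl q) (Eq.symm ?_)
    refine (congrArg (fun k : C.Multi tight [a₁', a₂, a₄, a₃] b =>
      (C.subst [a₁', a₂', a₄'] a₃ [] rfl rfl rfl
        (C.subst [a₁', a₂'] a₄ [a₃] rfl rfl rfl
        (C.subst [a₁'] a₂ [a₄, a₃] rfl rfl rfl k p₂ : C.Multi tight [a₁', a₂', a₄, a₃] b) p₄ :
        C.Multi tight [a₁', a₂', a₄', a₃] b) p₃ : C.Multi tight [a₁', a₂', a₄', a₃'] b))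
      (B.subst_unary_act (n := 4) (k := 2) (by decide) (by decide) [] [] [a₂, a₃, a₄] [a₂, a₄, a₃]
        rfl rfl rfl rfl rfl rfl m _ (rearranges_σ [a₁', a₂] _ _ [] rfl rfl) (by simp) rfl f p₁)).trans ?_
    refine (congrArg (fun k : C.Multi tight [a₁', a₂', a₄, a₃] b =>
      (C.subst [a₁', a₂', a₄'] a₃ [] rfl rfl rfl
        (C.subst [a₁', a₂'] a₄ [a₃] rfl rfl rfl k p₄ :
        C.Multi tight [a₁', a₂', a₄', a₃] b) p₃ : C.Multi tight [a₁', a₂', a₄', a₃'] b))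
      (B.subst_unary_act (n := 4) (k := 2) (by decide) (by decide) [a₁'] [a₁'] [a₃, a₄] [a₄, a₃]
        rfl rfl rfl rfl rfl rfl m _ (rearranges_σ [a₁', a₂'] _ _ [] rfl rfl) (by simp) rfl _ p₂)).trans ?_
    refine (congrArg (fun k : C.Multi tight [a₁', a₂', a₄', a₃] b =>
      (C.subst [a₁', a₂', a₄'] a₃ [] rfl rfl rfl k p₃ : C.Multi tight [a₁', a₂', a₄', a₃'] b))
      (B.subst_unary_act (n := 4) (k := 2) (by decide) (by decide) [a₁', a₂', a₃] [a₁', a₂'] [] [a₃]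
        rfl rfl rfl rfl rfl rfl m _ (rearranges_σ [a₁', a₂'] _ _ [] rfl rfl) (by simp) rfl _ p₄)).trans ?_
    refine (B.subst_unary_act (n := 4) (k := 2) (by decide) (by decide) [a₁', a₂']
      [a₁', a₂', a₄'] [a₄'] []
        rfl rfl rfl rfl rfl rfl m _ (rearranges_σ [a₁', a₂'] _ _ [] rfl rfl) (by simp) rfl _ p₃).trans ?_
    refine congrArg (B.act (σ 4 2) m (rearranges_σ [a₁', a₂'] _ _ [] rfl rfl)) ?_
    exact (C.subst_comm (x := tight) (y := tight) (z := tight) (A := [a₃']) (B := [a₄']) [a₁', a₂'] a₃ [] a₄ [] rfl rfl rfl rfl rfl rfl rfl rfl rfl rfl rfl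
      rfl _ p₃ p₄).symm
  braid := by
    intro a₁ a₂ a₃ a₄ b h
    have r₁ := rearranges_σ (n := 4) (k := 1) [a₁] a₂ a₃ [a₄] rfl rfl
    have r₂ := rearranges_σ (n := 4) (k := 2) [a₁, a₃] a₂ a₄ [] rfl rfl
    have r₃ := rearranges_σ (n := 4) (k := 1) [a₁] a₃ a₄ [a₂] rfl rfl
    have s₁ := rearranges_σ (n := 4) (k := 2) [a₁, a₂] a₃ a₄ [] rfl rfl
    have s₂ := rearranges_σ (n := 4) (k := 1) [a₁] a₂ a₄ [a₃] rfl rfl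
    have s₃ := rearranges_σ (n := 4) (k := 2) [a₁, a₄] a₂ a₃ [] rfl rfl
    have m₁ := σ_mem_braids (n := 4) (k := 1) (by decide) (by decide) tight
    have m₂ := σ_mem_braids (n := 4) (k := 2) (by decide) (by decide) tight
    have e := σ_braid (n := 4) (k := 1) (by decide)
    have m₁₂ := mul_mem m₁ m₂
    have m₂₁ := mul_mem m₂ m₁
    have r₁₂ := r₁.trans r₂
    rw [← map_mul] at r₁₂
    have r := r₁₂.trans r₃
    rw [← map_mul] at r
    have s₁₂ := s₁.trans s₂
    rw [← map_mul] at s₁₂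
    have s := s₁₂.trans s₃
    rw [← map_mul] at s
    refine (congrArg (B.act _ m₁ r₃) (B.act_mul _ _ m₁ m₂ m₁₂ r₁ r₂ r₁₂ h).symm).trans ?_
    refine (B.act_mul _ _ m₁₂ m₁ (mul_mem m₁₂ m₁) r₁₂ r₃ r h).symm.trans ?_
    refine Eq.trans ?_ (congrArg (B.act _ m₂ s₃) (B.act_mul _ _ m₂ m₁ m₂₁ s₁ s₂ s₁₂ h))
    refine Eq.trans ?_ (B.act_mul _ _ m₂₁ m₂ (mul_mem m₂₁ m₂) s₁₂ s₃ s h)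
    exact B.act_congr _ _ _ _ e _
  three_in_two_fst := by
    intro b₁ b₂ c a₁ a₂ a₃ g f
    exact B.subst_act_σ (p := 4) [] [b₂] rfl rfl rfl rfl (by decide) _ _ (by simp) rfl _ _ g f
  three_in_two_snd := by
    intro b₁ b₂ c a₁ a₂ a₃ g f
    exact B.subst_act_σ (p := 4) [b₁] [] rfl rfl rfl rfl (by decide) _ _ (by simp) rfl _ _ g f
  two_in_three_fst := by
    intro b₁ b₂ b₃ c a₁ a₂ g f
    have m := σ_mem_braids (n := 3) (k := 1) (by decide) (by decide) tight
    exact (B.act_σ_subst (n := 3) (k := 1) (i := 0) (m := 2) (p := 4) (σ 4 2) [] []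
      [b₂, b₃] [b₃, b₂] rfl rfl rfl rfl rfl rfl
      (by decide) m (rearranges_σ [b₁] b₂ b₃ [] rfl rfl) (by decide) rfl rfl rfl rfl rfl _ _ g f).symm
  two_in_three_snd := by
    intro b₁ b₂ b₃ c a₁ a₂ g f
    have m := σ_mem_braids (n := 3) (k := 1) (by decide) (by decide) tight
    have m₁ := σ_mem_braids (n := 4) (k := 1) (by decide) (by decide) tight
    have m₂ := σ_mem_braids (n := 4) (k := 2) (by decide) (by decide) tight
    have r₁ := rearranges_σ (n := 4) (k := 2) [b₁, a₁] a₂ b₃ [] rfl rfl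
    have r₂ := rearranges_σ (n := 4) (k := 1) [b₁] a₁ b₃ [a₂] rfl rfl
    have r := r₁.trans r₂
    rw [← map_mul] at r
    refine (B.act_mul _ _ m₂ m₁ (mul_mem m₂ m₁) r₁ r₂ r _).symm.trans (Eq.symm ?_)
    exact B.act_σ_subst (n := 3) (k := 1) (i := 2) (m := 2) (p := 4) (σ 4 2 * σ 4 1) [b₁]
      [b₁, b₃] [b₃] [] rfl rfl rfl rfl rfl rfl
      (by decide) m (rearranges_σ [b₁] b₂ b₃ [] rfl rfl) (by decide) rfl rfl rfl rfl
      (by simp [cableGen, blockL]) _ r g f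
  two_in_three_trd := by
    intro b₁ b₂ b₃ c a₁ a₂ g f
    have m := σ_mem_braids (n := 3) (k := 1) (by decide) (by decide) tight
    have m₁ := σ_mem_braids (n := 4) (k := 1) (by decide) (by decide) tight
    have m₂ := σ_mem_braids (n := 4) (k := 2) (by decide) (by decide) tight
    have r₁ := rearranges_σ (n := 4) (k := 1) [b₁] b₂ a₁ [a₂] rfl rfl
    have r₂ := rearranges_σ (n := 4) (k := 2) [b₁, a₁] b₂ a₂ [] rfl rfl
    have r := r₁.trans r₂
    rw [← map_mul] at r
    refine (B.act_mul _ _ m₁ m₂ (mul_mem m₁ m₂) r₁ r₂ r _).symm.trans (Eq.symm ?_)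
    exact B.act_σ_subst (n := 3) (k := 1) (i := 1) (m := 2) (p := 4) (σ 4 1 * σ 4 2) [b₁, b₂]
      [b₁] [] [b₂] rfl rfl rfl rfl rfl rfl
      (by decide) m (rearranges_σ [b₁] b₂ b₃ [] rfl rfl) (by decide) rfl rfl rfl rfl
      (by simp [cableGen, blockR]) _ r g f

end Braiding

end SkewMulticategory

end SkewMulti

namespace SkewMulti

open Tightness

/-! Let `C` be left representable and let `f` be a multimap of type `x` with inputs `Γ, a, b, Δ`,
where `Γ` is nonempty if `x` is tight. Classifying first `Γ, a, b` and then `Γ` gives a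
factorization `f = g ∘₁ (t ∘₁ e)` with `e : Γ → m` of type `x`, `t : m, a, b → n` tight ternary and
`g : n, Δ → c` tight (`exists_comp₀_comp₀`). In any braiding, compatibility with substitution forces
the crossing of `a` and `b` to send `f` to `g ∘₁ (β₃₂ t ∘₁ e)` (`Braiding.act_σ_eq_swap`). Crossings
generate the acting groups, so a braiding is determined by its underlying short braiding.

Conversely, this formula defines the crossing of two adjacent inputs from a short braiding. It does
not depend on the factorization, because any factorization is compared with the one through
classifiers by unary maps `m₀ → m` and `n₀ → n`, and `β₃₂` is natural (`exists_swap`). Two of the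
axioms say that `β₄₂` and `β₄₃` are crossings in this sense. Factoring through tight `4`-ary
multimaps then turns the short braid axiom into the general braid relation (`swap_braid`), while
crossings of disjoint pairs commute automatically (`swap_swap_comm`). Hence the braid groups act
(`exists_actionHom`). For tight multimaps the acting subgroup is sent to the braid group on one
strand fewer by deleting the first strand, so that Artin's presentation can be used there too.

Compatibility with substitution is checked on generators. Substituting a crossed multimap into
another reduces to a binary outer multimap (`subst_swap`). Substituting into one of two crossing
inputs is an induction on the arity, with the binary axioms as the step (`braidFun_blockR`,
`braidFun_blockL`). The nullary case is not an axiom: it follows from a binary map on the classifier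
of nullary multimaps that acts as a unit on either side (`exists_unit`).

For symmetries, the kernel of the map from the braid group to the symmetric group is the normal
subgroup generated by the squares of the generators (`mem_squares`), and these squares act trivially
once `β₃₂` is an involution. -/

/-- The number of initial strands that are left alone by the braids acting on multimaps of a given
type. -/
def Tightness.off : Tightness → ℕ
  | tight => 1
  | loose => 0

theorem Tightness.subst_cons {Obj : Type*} (y : Tightness) (m : Obj) (Γ : List Obj) :
    tight = tight.subst (m :: Γ).length y := rfl

theorem off_le_cons {Obj : Type*} (x : Tightness) (m : Obj) (Γ : List Obj) :
    x.off ≤ (m :: Γ).length := by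
  cases x <;> simp [off]

/-! ### Substitution and factorization through classifiers. -/

namespace SkewMulticategory

variable {Obj : Type u} {C : SkewMulticategory.{u, v} Obj}

/-- Tight multimaps have at least one input. -/
theorem off_le_length {x : Tightness} {L : List Obj} {c : Obj} (f : C.Multi x L c) :
    x.off ≤ L.length := by
  cases x
  · cases L
    · exact ((C.isEmpty_tight_nil c).false f).elim
    · simp [off]
  · simp [off]

/-! ### Substitution in general form -/

theorem subst_subst {x y z s t w : Tightness} {L A B M A' N Γ₂ Δ₂ : List Obj} {c : Obj}
    (Γ : List Obj) (b : Obj) (Δ : List Obj) (Γ' : List Obj) (a : Obj) (Δ' : List Obj)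
    (hΓ₂ : Γ₂ = Γ ++ Γ') (hΔ₂ : Δ₂ = Δ' ++ Δ)
    (hL : L = Γ ++ b :: Δ) (hA : A = Γ' ++ a :: Δ')
    (hA' : A' = Γ' ++ B ++ Δ') (hs : s = y.subst Γ'.length z)
    (hN : N = Γ ++ A' ++ Δ) (hw : w = x.subst Γ.length s)
    (hM : M = Γ ++ A ++ Δ) (ht : t = x.subst Γ.length y)
    (hM' : M = Γ₂ ++ a :: Δ₂) (hN' : N = Γ₂ ++ B ++ Δ₂)
    (hw' : w = t.subst Γ₂.length z)
    (h : C.Multi x L c) (g : C.Multi y A b) (f : C.Multi z B a) :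
    C.subst Γ b Δ hL hN hw h (C.subst Γ' a Δ' hA hA' hs g f) =
      C.subst Γ₂ a Δ₂ hM' hN' hw' (C.subst Γ b Δ hL hM ht h g) f := by
  subst hΓ₂ hΔ₂
  exact C.subst_assoc ..

theorem subst_subst_comm {x y z s t w : Tightness} {L A B M M' N Γ₁ Γ₂ Δ₁ Δ₂ : List Obj} {c : Obj}
    (Γ : List Obj) (b : Obj) (Δ : List Obj) (b' : Obj) (Θ : List Obj)
    (hΓ₁ : Γ₁ = Γ ++ A ++ Δ) (hΓ₂ : Γ₂ = Γ ++ b :: Δ)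
    (hΔ₁ : Δ₁ = Δ ++ b' :: Θ) (hΔ₂ : Δ₂ = Δ ++ B ++ Θ)
    (hL : L = Γ ++ b :: Δ₁) (hM : M = Γ ++ A ++ Δ₁)
    (hs : s = x.subst Γ.length y)
    (hM' : M = Γ₁ ++ b' :: Θ) (hN : N = Γ₁ ++ B ++ Θ)
    (hw : w = s.subst Γ₁.length z)
    (hL' : L = Γ₂ ++ b' :: Θ) (hP : M' = Γ₂ ++ B ++ Θ)
    (ht : t = x.subst Γ₂.length z)
    (hP' : M' = Γ ++ b :: Δ₂) (hN' : N = Γ ++ A ++ Δ₂)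
    (hw' : w = t.subst Γ.length y)
    (h : C.Multi x L c) (g : C.Multi y A b) (f : C.Multi z B b') :
    C.subst Γ₁ b' Θ hM' hN hw (C.subst Γ b Δ₁ hL hM hs h g) f =
      C.subst Γ b Δ₂ hP' hN' hw' (C.subst Γ₂ b' Θ hL' hP ht h f) g := by
  subst hΓ₁ hΓ₂ hΔ₁ hΔ₂
  exact C.subst_comm ..

/-! ### Substitution into the first input of a tight multimap -/

/-- Substitution in the first input of a tight multimap. -/
def comp₀ {x : Tightness} {A Δ M : List Obj} {m c : Obj} (hM : M = A ++ Δ)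
    (u : C.Multi tight (m :: Δ) c) (f : C.Multi x A m) : C.Multi x M c :=
  C.subst [] m Δ rfl hM rfl u f

theorem comp₀_comp₀ {x : Tightness} {A Δ Δ' Δ₂ M N : List Obj} {m n c : Obj}
    (hN : N = M ++ Δ) (hM : M = A ++ Δ') (hN' : N = A ++ Δ₂) (h₂ : m :: Δ₂ = m :: Δ' ++ Δ)
    (u : C.Multi tight (n :: Δ) c) (v : C.Multi tight (m :: Δ') n) (f : C.Multi x A m) :
    comp₀ hN u (comp₀ hM v f) = comp₀ hN' (comp₀ h₂ u v) f := by
  obtain rfl : Δ₂ = Δ' ++ Δ := by simpa using h₂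
  exact subst_subst (x := tight) [] n Δ [] m Δ' rfl rfl rfl rfl hM rfl hN rfl rfl rfl rfl hN' rfl u v f

theorem comp₀_id {x : Tightness} {A : List Obj} {c : Obj} (hM : A = A ++ [])
    (f : C.Multi x A c) : comp₀ hM (C.id c) f = f := C.id_subst _ _

theorem comp₀_id_right {Δ : List Obj} {m c : Obj} (hM : m :: Δ = [m] ++ Δ)
    (u : C.Multi tight (m :: Δ) c) : comp₀ hM u (C.id m) = u := C.subst_id ..

theorem comp₀_j {A Δ M : List Obj} {m c : Obj} (hM : M = A ++ Δ)
    (u : C.Multi tight (m :: Δ) c) (f : C.Multi tight A m) :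
    comp₀ hM u (C.j f) = C.j (comp₀ hM u f) :=
  C.subst_j (x := tight) [] m Δ rfl hM rfl rfl u f

/-- Substitution into an input of `f` in `u ∘ f`. -/
theorem subst_comp₀_left {x y w : Tightness} {A A' B Δ Δ₁ M N Γ Γ' : List Obj} {m b c : Obj}
    (hM : M = A ++ Δ) (hΔ₁ : Δ₁ = Γ' ++ Δ) (hA : A = Γ ++ b :: Γ') (hA' : A' = Γ ++ B ++ Γ')
    (hM' : M = Γ ++ b :: Δ₁) (hN : N = Γ ++ B ++ Δ₁) (hN' : N = A' ++ Δ)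
    (hw : w = x.subst Γ.length y)
    (u : C.Multi tight (m :: Δ) c) (f : C.Multi x A m) (h : C.Multi y B b) :
    C.subst Γ b Δ₁ hM' hN hw (comp₀ hM u f) h =
      comp₀ hN' u (C.subst Γ b Γ' hA hA' hw f h) :=
  (subst_subst (x := tight) [] m Δ Γ b Γ' rfl hΔ₁ rfl hA hA' hw hN' rfl hM rfl hM' hN hw u f h).symm

/-- Substitution into a further input of `u` in `u ∘ f`. -/
theorem subst_comp₀_right {x y : Tightness} {A B Δ Δ' M N Γ Γ₁ Θ : List Obj} {m b c : Obj}
    (hM : M = A ++ Δ) (hΓ₁ : Γ₁ = A ++ Γ) (hM' : M = Γ₁ ++ b :: Θ) (hN : N = Γ₁ ++ B ++ Θ)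
    (hw : x = x.subst Γ₁.length y)
    (hΔ : m :: Δ = m :: Γ ++ b :: Θ) (hΔ' : m :: Δ' = m :: Γ ++ B ++ Θ) (hN' : N = A ++ Δ')
    (u : C.Multi tight (m :: Δ) c) (f : C.Multi x A m) (h : C.Multi y B b) :
    C.subst Γ₁ b Θ hM' hN hw (comp₀ hM u f) h =
      comp₀ hN' (C.subst (m :: Γ) b Θ hΔ hΔ' (y.subst_cons m Γ) u h) f := by
  obtain rfl : Δ = Γ ++ b :: Θ := by simpa using hΔ
  obtain rfl : Δ' = Γ ++ B ++ Θ := by simpa using hΔ'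
  exact subst_subst_comm (x := tight) [] m Γ b Θ hΓ₁ rfl rfl rfl rfl hM rfl hM' hN hw rfl rfl rfl rfl hN' rfl
    u f h

/-! ### Classifiers -/

variable (hC : C.LeftRepresentable)
include hC

/-- The condition `x.off ≤ A.length` says that `A` is nonempty if `x` is tight, which is exactly
when a classifier is provided. Left universality then covers all further inputs `Δ` at once. -/
theorem exists_classifier {x : Tightness} {A : List Obj} (hA : x.off ≤ A.length) :
    ∃ (m : Obj) (θ : C.Multi x A m), ∀ (Δ M : List Obj) (hM : M = A ++ Δ) (c : Obj),
      Function.Bijective (fun u : C.Multi tight (m :: Δ) c => comp₀ hM u θ) := by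
  obtain ⟨m, θ, h⟩ := hC.1 x A (by
    cases x
    · right; rintro rfl; simp [off] at hA
    · exact Or.inl rfl)
  refine ⟨m, θ, fun Δ M hM c => ?_⟩
  subst hM
  exact hC.2 x A m θ h Δ c

theorem exists_comp₀ {x : Tightness} {A Δ L : List Obj} {c : Obj} (hA : x.off ≤ A.length)
    (hL : L = A ++ Δ) (f : C.Multi x L c) :
    ∃ (m : Obj) (e : C.Multi x A m) (u : C.Multi tight (m :: Δ) c), f = comp₀ hL u e := by
  obtain ⟨m, θ, h⟩ := exists_classifier hC hA
  obtain ⟨u, hu⟩ := (h Δ L hL c).2 f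
  exact ⟨m, θ, u, hu.symm⟩

/-- This normal form isolates the inputs `a`, `b` in a tight ternary multimap, the only place where
a short braiding acts directly. Both `M` and `Γ` are long enough for their classifiers to exist. -/
theorem exists_comp₀_comp₀ {x : Tightness} {Γ Δ L M : List Obj} {a b c : Obj}
    (hΓ : x.off ≤ Γ.length) (hM : M = Γ ++ [a, b]) (hL : L = M ++ Δ) (f : C.Multi x L c) :
    ∃ (m n : Obj) (e : C.Multi x Γ m) (t : C.Multi tight [m, a, b] n)
      (g : C.Multi tight (n :: Δ) c), f = comp₀ hL g (comp₀ hM t e) := by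
  obtain ⟨n, k, g, rfl⟩ := exists_comp₀ hC (by simp [hM]; omega) hL f
  obtain ⟨m, e, t, rfl⟩ := exists_comp₀ hC hΓ hM k
  exact ⟨m, n, e, t, g, rfl⟩

end SkewMulticategory

/-! ### Exchanging two adjacent inputs of a multimap. -/

namespace SkewMulticategory

variable {Obj : Type u} {C : SkewMulticategory.{u, v} Obj}

/-- An operation that exchanges the last two inputs of tight ternary multimaps and that is natural
in the first input and in the output. -/
structure Crossing (C : SkewMulticategory.{u, v} Obj) where
  app : ∀ {a₁ a₂ a₃ b : Obj}, C.Multi tight [a₁, a₂, a₃] b → C.Multi tight [a₁, a₃, a₂] b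
  app_post : ∀ {a₁ a₂ a₃ b c : Obj} (q : C.Multi tight [b] c) (t : C.Multi tight [a₁, a₂, a₃] b),
    app (comp₀ rfl q t) = comp₀ rfl q (app t)
  app_pre : ∀ {a a₁ a₂ a₃ b : Obj} (t : C.Multi tight [a₁, a₂, a₃] b) (p : C.Multi tight [a] a₁),
    app (comp₀ rfl t p) = comp₀ rfl (app t) p

/-- The formula for the exchange is well defined: it can be evaluated on every factorization of the
given multimap, not only on a chosen one. The factorization through the classifiers `θ` of `Γ` and
`τ` of `m₀, a, b` is universal, and the passage from it to any other one involves only a unary map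
in the first input and one in the output. These are the two naturalities demanded of a `Crossing`.
-/
theorem exists_swap (hC : C.LeftRepresentable) (β : Crossing C) {x : Tightness}
    {Γ Δ L M : List Obj} {a b c : Obj} (hΓ : x.off ≤ Γ.length) (hL : L = Γ ++ a :: b :: Δ)
    (hM : M = Γ ++ b :: a :: Δ) :
    ∃ s : C.Multi x L c → C.Multi x M c, ∀ (K K' : List Obj) (m n : Obj) (e : C.Multi x Γ m)
      (t : C.Multi tight [m, a, b] n) (g : C.Multi tight (n :: Δ) c) (hK : K = Γ ++ [a, b])
      (hK' : K' = Γ ++ [b, a]) (hL' : L = K ++ Δ) (hM' : M = K' ++ Δ),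
      s (comp₀ hL' g (comp₀ hK t e)) = comp₀ hM' g (comp₀ hK' (β.app t) e) := by
  obtain ⟨m₀, θ, hθ⟩ := exists_classifier hC hΓ
  obtain ⟨n₀, τ, hτ⟩ := exists_classifier hC (x := tight) (A := [m₀, a, b]) (by simp [off])
  have hL₀ : L = (Γ ++ [a, b]) ++ Δ := by simp [hL]
  have hM₀ : M = (Γ ++ [b, a]) ++ Δ := by simp [hM]
  -- `τ ∘ θ` has the universal property of a classifier of `Γ, a, b`, by composing the bijections of
  -- `τ` and `θ`.
  have key : Function.Bijective
      (fun g : C.Multi tight (n₀ :: Δ) c => comp₀ hL₀ g (comp₀ rfl τ θ)) := by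
    have := (hθ (a :: b :: Δ) L (by simp [hL]) c).comp (hτ Δ (m₀ :: a :: b :: Δ) rfl c)
    convert this using 2 with g
    exact comp₀_comp₀ ..
  refine ⟨fun f => comp₀ hM₀ (key.2 f).choose (comp₀ rfl (β.app τ) θ), ?_⟩
  rintro _ _ m n e t g rfl rfl hL' hM'
  -- Comparison with the universal factorization: `e = p ∘ θ` and then `t ∘ p = q ∘ τ`.
  obtain ⟨p, rfl⟩ := (hθ [] Γ (by simp) m).2 e
  obtain ⟨q, hq⟩ := (hτ [] [m₀, a, b] rfl n).2 (comp₀ rfl t p)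
  dsimp only at hq ⊢
  have e₁ : comp₀ hL' g (comp₀ rfl t (comp₀ (by simp) p θ)) =
      comp₀ hL₀ (comp₀ rfl g q) (comp₀ rfl τ θ) := by
    refine (congrArg (comp₀ hL' g) ((comp₀_comp₀ _ _ rfl rfl t p θ).trans ?_)).trans
      (comp₀_comp₀ hL' (by simp) hL₀ rfl g q (comp₀ rfl τ θ))
    rw [← hq]
    exact (comp₀_comp₀ (by simp) rfl _ rfl q τ θ).symm
  have e₂ : (key.2 (comp₀ hL' g (comp₀ rfl t (comp₀ (by simp) p θ)))).choose = comp₀ rfl g q :=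
    key.1 ((key.2 _).choose_spec.trans e₁)
  rw [e₂]
  refine ((congrArg (comp₀ hM' g) ((comp₀_comp₀ _ _ rfl rfl (β.app t) p θ).trans ?_)).trans
      (comp₀_comp₀ hM' (by simp) hM₀ rfl g q (comp₀ rfl (β.app τ) θ))).symm
  -- The equation `t ∘ p = q ∘ τ` is carried to the crossed maps by naturality in the first input
  -- and in the output.
  rw [← β.app_pre, ← hq, β.app_post]
  exact (comp₀_comp₀ (by simp) rfl _ rfl q (β.app τ) θ).symm

/-- The operation that exchanges two adjacent inputs of a multimap. -/
noncomputable def swap (hC : C.LeftRepresentable) (β : Crossing C) {x : Tightness} {L M : List Obj} {c : Obj}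
    (Γ : List Obj) (a b : Obj) (Δ : List Obj) (hΓ : x.off ≤ Γ.length) (hL : L = Γ ++ a :: b :: Δ)
    (hM : M = Γ ++ b :: a :: Δ) : C.Multi x L c → C.Multi x M c :=
  (exists_swap hC β hΓ hL hM).choose

section

variable {hC : C.LeftRepresentable} {β : Crossing C}

theorem swap_comp₀_comp₀ {x : Tightness}
    {Γ Δ L M K K' : List Obj} {a b c m n : Obj} (hΓ : x.off ≤ Γ.length) (hL : L = Γ ++ a :: b :: Δ)
    (hM : M = Γ ++ b :: a :: Δ) (hK : K = Γ ++ [a, b]) (hL' : L = K ++ Δ) (hK' : K' = Γ ++ [b, a])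
    (hM' : M = K' ++ Δ) (g : C.Multi tight (n :: Δ) c) (t : C.Multi tight [m, a, b] n)
    (e : C.Multi x Γ m) :
    swap hC β Γ a b Δ hΓ hL hM (comp₀ hL' g (comp₀ hK t e)) =
      comp₀ hM' g (comp₀ hK' (β.app t) e) :=
  (exists_swap hC β hΓ hL hM).choose_spec K K' m n e t g hK hK' hL' hM'

theorem swap_ternary {a₁ a₂ a₃ b : Obj} (t : C.Multi tight [a₁, a₂, a₃] b) :
    swap hC β [a₁] a₂ a₃ [] (off_le_cons _ _ _) rfl rfl t = β.app t := by
  have := swap_comp₀_comp₀ (hC := hC) (β := β) (Γ := [a₁]) (x := tight) (off_le_cons _ _ _) rfl rfl rfl rfl rfl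
    rfl (C.id _) t (C.id _)
  rwa [comp₀_id_right rfl t, comp₀_id_right rfl (β.app t), comp₀_id rfl t,
    comp₀_id rfl (β.app t)] at this

/-- Exchanging two inputs of `f` in `u ∘ f`. -/
theorem swap_comp₀_left {x : Tightness} {Γ Δ Δ' Δ₂ L L' M M' : List Obj} {a b c m : Obj}
    (hΓ : x.off ≤ Γ.length) (hL : L = Γ ++ a :: b :: Δ) (hL' : L' = Γ ++ b :: a :: Δ)
    (hM₀ : M = L ++ Δ') (hM₀' : M' = L' ++ Δ') (hΔ₂ : Δ₂ = Δ ++ Δ') (hM : M = Γ ++ a :: b :: Δ₂)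
    (hM' : M' = Γ ++ b :: a :: Δ₂) (u : C.Multi tight (m :: Δ') c) (f : C.Multi x L m) :
    swap hC β Γ a b Δ₂ hΓ hM hM' (comp₀ hM₀ u f) =
      comp₀ hM₀' u (swap hC β Γ a b Δ hΓ hL hL' f) := by
  subst hΔ₂
  -- A factorization of `f` yields one of `u ∘ f` with the same `t` and `e`: only the outer factor
  -- is composed with `u`.
  obtain ⟨k, n, e, t, g, rfl⟩ := exists_comp₀_comp₀ hC hΓ rfl
    (hL.trans (by simp : _ = (Γ ++ [a, b]) ++ Δ)) f
  rw [swap_comp₀_comp₀ hΓ hL hL' rfl _ rfl (by simp [hL']),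
    comp₀_comp₀ hM₀ _ (by simp [hM]) rfl, comp₀_comp₀ hM₀' _ (by simp [hM']) rfl,
    swap_comp₀_comp₀]

/-- Exchanging two inputs of `u` in `u ∘ f`. -/
theorem swap_comp₀_right {x : Tightness} {A Γ Γ₂ Δ Δ₁ Δ₁' M M' : List Obj} {a b c m : Obj}
    (hΔ₁ : m :: Δ₁ = m :: Γ ++ a :: b :: Δ) (hΔ₁' : m :: Δ₁' = m :: Γ ++ b :: a :: Δ)
    (hΓ₂ : Γ₂ = A ++ Γ) (h : x.off ≤ Γ₂.length)
    (hM₀ : M = A ++ Δ₁) (hM₀' : M' = A ++ Δ₁') (hM : M = Γ₂ ++ a :: b :: Δ)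
    (hM' : M' = Γ₂ ++ b :: a :: Δ) (u : C.Multi tight (m :: Δ₁) c) (f : C.Multi x A m) :
    swap hC β Γ₂ a b Δ h hM hM' (comp₀ hM₀ u f) =
      comp₀ hM₀' (swap hC β (m :: Γ) a b Δ (off_le_cons _ _ _) hΔ₁ hΔ₁' u) f := by
  subst hΓ₂
  -- Here a factorization of `u` yields one of `u ∘ f` with the same `t` and `g`: only the inner
  -- factor is composed with `f`.
  obtain ⟨k, n, e, t, g, rfl⟩ := exists_comp₀_comp₀ hC (Γ := m :: Γ) (Δ := Δ) (x := tight) (a := a)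
    (b := b) (off_le_cons _ _ _) rfl (by simp [hΔ₁]) u
  rw [swap_comp₀_comp₀ _ hΔ₁ hΔ₁' rfl _ rfl (by simp [hΔ₁']),
    ← comp₀_comp₀ (M := A ++ (Γ ++ [a, b])) (by simp [hM]) rfl,
    ← comp₀_comp₀ (M := A ++ (Γ ++ [b, a])) (by simp [hM']) rfl,
    ← comp₀_comp₀ (M := A ++ Γ) (N := A ++ (Γ ++ [a, b])) (by simp) rfl rfl rfl t e f,
    ← comp₀_comp₀ (M := A ++ Γ) (N := A ++ (Γ ++ [b, a])) (by simp) rfl rfl rfl (β.app t) e f,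
    swap_comp₀_comp₀]

/-- Since `j` commutes with substitution in the first input, a factorization of `f` becomes one of
`C.j f` when `e` is replaced by `C.j e`; the ternary factor is unchanged. -/
theorem swap_j {L M Γ Δ : List Obj} {a b c : Obj} (hΓ : tight.off ≤ Γ.length)
    (hΓ' : loose.off ≤ Γ.length)
    (hL : L = Γ ++ a :: b :: Δ) (hM : M = Γ ++ b :: a :: Δ) (f : C.Multi tight L c) :
    swap hC β Γ a b Δ hΓ' hL hM (C.j f) = C.j (swap hC β Γ a b Δ hΓ hL hM f) := by
  obtain ⟨k, n, e, t, g, rfl⟩ := exists_comp₀_comp₀ hC (x := tight) hΓ rfl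
    (hL.trans (by simp : _ = (Γ ++ [a, b]) ++ Δ)) f
  rw [swap_comp₀_comp₀ (x := tight) hΓ hL hM rfl _ rfl (by simp [hM]), ← comp₀_j, ← comp₀_j, ← comp₀_j,
    ← comp₀_j, swap_comp₀_comp₀]

/-- Substitution before a crossing. -/
theorem subst_swap_before {x y w : Tightness} {Γ Γ' Γ₁ Γ₂ Δ A L L' M M' : List Obj}
    {a b c d : Obj} (hΓ : x.off ≤ Γ.length) (hΓ' : w.off ≤ Γ'.length)
    (hL : L = Γ ++ a :: b :: Δ) (hL' : L' = Γ ++ b :: a :: Δ)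
    (hM : M = Γ' ++ a :: b :: Δ) (hM' : M' = Γ' ++ b :: a :: Δ)
    (h₁ : Γ = Γ₁ ++ d :: Γ₂) (h₂ : Γ' = Γ₁ ++ A ++ Γ₂) (hw : w = x.subst Γ₁.length y)
    {Ψ Ψ' : List Obj}
    (k₁ : L = Γ₁ ++ d :: Ψ) (k₂ : M = Γ₁ ++ A ++ Ψ) (k₁' : L' = Γ₁ ++ d :: Ψ')
    (k₂' : M' = Γ₁ ++ A ++ Ψ') (g : C.Multi x L c) (f : C.Multi y A d) :
    C.subst Γ₁ d Ψ' k₁' k₂' hw (swap hC β Γ a b Δ hΓ hL hL' g) f =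
      swap hC β Γ' a b Δ hΓ' hM hM' (C.subst Γ₁ d Ψ k₁ k₂ hw g f) := by
  obtain rfl : Ψ = Γ₂ ++ a :: b :: Δ := by simpa [hL, h₁] using k₁.symm
  obtain rfl : Ψ' = Γ₂ ++ b :: a :: Δ := by simpa [hL', h₁] using k₁'.symm
  obtain ⟨k, n, e, t, v, rfl⟩ := exists_comp₀_comp₀ hC hΓ rfl
    (hL.trans (by simp : _ = (Γ ++ [a, b]) ++ Δ)) g
  rw [swap_comp₀_comp₀ hΓ hL hL' rfl _ rfl (by simp [hL']),
    subst_comp₀_left (A' := Γ' ++ [b, a]) (Γ' := Γ₂ ++ [b, a]) (hw := hw),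
    subst_comp₀_left (A' := Γ') (Γ' := Γ₂) (hw := hw),
    subst_comp₀_left (A' := Γ' ++ [a, b]) (Γ' := Γ₂ ++ [a, b]) (hw := hw),
    subst_comp₀_left (A' := Γ') (Γ' := Γ₂) (hw := hw), swap_comp₀_comp₀]
  all_goals simp [h₁, h₂, hM, hM']

/-- Substitution after a crossing. -/
theorem subst_swap_after {x y : Tightness} {Γ Θ Γ₁ Γ₁' Δ Δ' Φ A L L' M M' : List Obj}
    {a b c d : Obj} (hΓ : x.off ≤ Γ.length)
    (hL : L = Γ ++ a :: b :: Δ) (hL' : L' = Γ ++ b :: a :: Δ)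
    (hM : M = Γ ++ a :: b :: Δ') (hM' : M' = Γ ++ b :: a :: Δ')
    (h₁ : Δ = Φ ++ d :: Θ) (h₂ : Δ' = Φ ++ A ++ Θ) (hΓ₁ : Γ₁ = Γ ++ a :: b :: Φ)
    (hΓ₁' : Γ₁' = Γ ++ b :: a :: Φ)
    (hw : x = x.subst Γ₁.length y) (hw' : x = x.subst Γ₁'.length y)
    (k₁ : L = Γ₁ ++ d :: Θ) (k₂ : M = Γ₁ ++ A ++ Θ) (k₁' : L' = Γ₁' ++ d :: Θ)
    (k₂' : M' = Γ₁' ++ A ++ Θ) (g : C.Multi x L c) (f : C.Multi y A d) :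
    C.subst Γ₁' d Θ k₁' k₂' hw' (swap hC β Γ a b Δ hΓ hL hL' g) f =
      swap hC β Γ a b Δ' hΓ hM hM' (C.subst Γ₁ d Θ k₁ k₂ hw g f) := by
  obtain ⟨k, n, e, t, v, rfl⟩ := exists_comp₀_comp₀ hC hΓ rfl
    (hL.trans (by simp : _ = (Γ ++ [a, b]) ++ Δ)) g
  rw [swap_comp₀_comp₀ hΓ hL hL' rfl _ rfl (by simp [hL']),
    subst_comp₀_right (Γ := Φ) (Δ' := Δ') (hw := hw),
    subst_comp₀_right (Γ := Φ) (Δ' := Δ') (hw := hw'), swap_comp₀_comp₀]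
  all_goals simp [h₁, h₂, hM, hM', hΓ₁, hΓ₁']

/-- Crossings of disjoint pairs of inputs commute. -/
theorem swap_swap_comm {x : Tightness} {Γ Γ₁ Γ₁' Δ Δ₁ Δ₁' Θ K L M N : List Obj} {a b c d e : Obj}
    (hΓ : x.off ≤ Γ.length) (h₁ : x.off ≤ Γ₁.length) (h₁' : x.off ≤ Γ₁'.length)
    (hΓ₁ : Γ₁ = Γ ++ a :: b :: Δ) (hΓ₁' : Γ₁' = Γ ++ b :: a :: Δ)
    (hΔ₁ : Δ₁ = Δ ++ c :: d :: Θ) (hΔ₁' : Δ₁' = Δ ++ d :: c :: Θ)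
    (hK : K = Γ ++ a :: b :: Δ₁) (hL : L = Γ ++ b :: a :: Δ₁) (hL' : L = Γ₁' ++ c :: d :: Θ)
    (hN : N = Γ₁' ++ d :: c :: Θ) (hK' : K = Γ₁ ++ c :: d :: Θ) (hM : M = Γ₁ ++ d :: c :: Θ)
    (hM' : M = Γ ++ a :: b :: Δ₁') (hN' : N = Γ ++ b :: a :: Δ₁') (f : C.Multi x K e) :
    swap hC β Γ₁' c d Θ h₁' hL' hN (swap hC β Γ a b Δ₁ hΓ hK hL f) =
      swap hC β Γ a b Δ₁' hΓ hM' hN' (swap hC β Γ₁ c d Θ h₁ hK' hM f) := by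
  -- Cutting `f` after `Γ, a, b, Δ` puts the first pair into the inner factor `k` and the second
  -- pair into the outer factor `u`, where the two exchanges do not interact.
  obtain ⟨m, k, u, rfl⟩ := exists_comp₀ hC h₁ hK' f
  rw [swap_comp₀_left hΓ hΓ₁ hΓ₁' _ (by simp [hL'] : L = Γ₁' ++ c :: d :: Θ) hΔ₁,
    swap_comp₀_right (Γ := []) (Δ₁' := d :: c :: Θ) rfl rfl _ _ _ _,
    swap_comp₀_right (Γ := []) (Δ₁' := d :: c :: Θ) rfl rfl _ _ _ _,
    swap_comp₀_left hΓ hΓ₁ hΓ₁' _ _ hΔ₁']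
  all_goals simp [hN, hM]

/-- This serves twice: with the inverse crossing it makes exchanges invertible, and with `β' = β` it
shows that exchanges are involutions for a short symmetry. -/
theorem swap_swap_of_leftInverse {β' : Crossing C}
    (h : ∀ (a₁ a₂ a₃ b : Obj) (t : C.Multi tight [a₁, a₂, a₃] b), β'.app (β.app t) = t)
    {x : Tightness} {Γ Δ L M : List Obj} {a b c : Obj} (hΓ : x.off ≤ Γ.length)
    (hL : L = Γ ++ a :: b :: Δ) (hM : M = Γ ++ b :: a :: Δ) (f : C.Multi x L c) :
    swap hC β' Γ b a Δ hΓ hM hL (swap hC β Γ a b Δ hΓ hL hM f) = f := by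
  obtain ⟨k, n, e, t, v, rfl⟩ := exists_comp₀_comp₀ hC hΓ rfl
    (hL.trans (by simp : _ = (Γ ++ [a, b]) ++ Δ)) f
  rw [swap_comp₀_comp₀ hΓ hL hM rfl _ rfl (by simp [hM]), swap_comp₀_comp₀ hΓ hM hL rfl _ rfl, h]

end

end SkewMulticategory

namespace SkewMulticategory

variable {Obj : Type u} {C : SkewMulticategory.{u, v} Obj}

/-! ### The crossing of a short braiding -/

section

variable (β : C.toShort.ShortBraiding)

/-- The naturality of `β₃₂` concerns whole lists of morphisms. Putting identities everywhere but in
one place turns the action of such a list into a single substitution. The output and the first input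
are needed for a `Crossing`; the other two inputs matter when unary maps are substituted into the
crossing inputs. -/
theorem braid₃_post {a₁ a₂ a₃ b c : Obj} (q : C.Multi tight [b] c)
    (t : C.Multi tight [a₁, a₂, a₃] b) :
    (β.β₃₂ (comp₀ rfl q t : C.Multi tight [a₁, a₂, a₃] c) : C.Multi tight [a₁, a₃, a₂] c) =
      comp₀ rfl q (β.β₃₂ t : C.Multi tight [a₁, a₃, a₂] b) :=
  (congrArg β.β₃₂ (map_id_left q t)).symm.trans
    ((β.β₃₂_natural (C.id a₁) (C.id a₂) (C.id a₃) q t).trans (map_id_left q _))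

theorem braid₃_pre_fst {a₁ a₂ a₃ b a : Obj} (t : C.Multi tight [a₁, a₂, a₃] b)
    (p : C.Multi tight [a] a₁) :
    (β.β₃₂ (comp₀ rfl t p : C.Multi tight [a, a₂, a₃] b) : C.Multi tight [a, a₃, a₂] b) =
      comp₀ rfl (β.β₃₂ t : C.Multi tight [a₁, a₃, a₂] b) p :=
  (congrArg β.β₃₂ (map_single [] [a₂, a₃] p rfl rfl t)).symm.trans
    ((β.β₃₂_natural p (C.id a₂) (C.id a₃) (C.id b) t).trans (map_single [] [a₃, a₂] p rfl rfl _))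

theorem braid₃_pre_snd {a₁ a₂ a₃ b a : Obj} (t : C.Multi tight [a₁, a₂, a₃] b)
    (p : C.Multi tight [a] a₂) :
    (β.β₃₂ (C.subst [a₁] a₂ [a₃] rfl rfl rfl t p : C.Multi tight [a₁, a, a₃] b) :
      C.Multi tight [a₁, a₃, a] b) =
      C.subst [a₁, a₃] a₂ [] rfl rfl rfl (β.β₃₂ t : C.Multi tight [a₁, a₃, a₂] b) p :=
  (congrArg β.β₃₂ (map_single [a₁] [a₃] p rfl rfl t)).symm.trans
    ((β.β₃₂_natural (C.id a₁) p (C.id a₃) (C.id b) t).trans (map_single [a₁, a₃] [] p rfl rfl _))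

theorem braid₃_pre_trd {a₁ a₂ a₃ b a : Obj} (t : C.Multi tight [a₁, a₂, a₃] b)
    (p : C.Multi tight [a] a₃) :
    (β.β₃₂ (C.subst [a₁, a₂] a₃ [] rfl rfl rfl t p : C.Multi tight [a₁, a₂, a] b) :
      C.Multi tight [a₁, a, a₂] b) =
      C.subst [a₁] a₃ [a₂] rfl rfl rfl (β.β₃₂ t : C.Multi tight [a₁, a₃, a₂] b) p :=
  (congrArg β.β₃₂ (map_single [a₁, a₂] [] p rfl rfl t)).symm.trans
    ((β.β₃₂_natural (C.id a₁) (C.id a₂) p (C.id b) t).trans (map_single [a₁] [a₂] p rfl rfl _))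

/-- The crossing of a short braiding. -/
def crossing : Crossing C where
  app {a₁ a₂ a₃ b} t := (β.β₃₂ (a₁ := a₁) (a₂ := a₂) (a₃ := a₃) (b := b) t :)
  app_post := braid₃_post β
  app_pre := braid₃_pre_fst β

/-- The inverse crossing of a short braiding. -/
def crossingInv : Crossing C where
  app {a₁ a₂ a₃ b} t := (β.β₃₂ (a₁ := a₁) (a₂ := a₃) (a₃ := a₂) (b := b)).symm t
  app_post q t := by
    refine (Equiv.symm_apply_eq _).2 (Eq.trans ?_ (braid₃_post β q _).symm)
    exact congrArg (comp₀ rfl q) (Equiv.apply_symm_apply _ _).symm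
  app_pre t p := by
    refine (Equiv.symm_apply_eq _).2 (Eq.trans ?_ (braid₃_pre_fst β _ p).symm)
    exact congrArg (fun k => comp₀ rfl k p) (Equiv.apply_symm_apply _ _).symm

end

variable {hC : C.LeftRepresentable} {β : C.toShort.ShortBraiding}

theorem swap_ternary_eq {a₁ a₂ a₃ b : Obj} (t : C.Multi tight [a₁, a₂, a₃] b) :
    swap hC (crossing β) [a₁] a₂ a₃ [] (off_le_cons _ _ _) rfl rfl t = β.β₃₂ t := swap_ternary t

/-- Cut after the first three inputs: the crossing then takes place in a ternary inner factor, and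
the axiom `three_in_two_fst` moves `β₃₂` on it to `β₄₂` on the composite. -/
theorem swap_quaternary_eq_left {a₁ a₂ a₃ a₄ b : Obj} (t : C.Multi tight [a₁, a₂, a₃, a₄] b) :
    swap hC (crossing β) [a₁] a₂ a₃ [a₄] (off_le_cons _ _ _) rfl rfl t = β.β₄₂ t := by
  obtain ⟨m, e, u, rfl⟩ := exists_comp₀ hC (A := [a₁, a₂, a₃]) (Δ := [a₄]) (x := tight)
    (off_le_cons _ _ _) rfl t
  refine (swap_comp₀_left (Γ := [a₁]) (L' := [a₁, a₃, a₂]) (Δ := []) _ rfl rfl rfl rfl rfl rfl rfl u e).trans ?_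
  rw [swap_ternary]
  exact β.three_in_two_fst u e

/-- Cut after the first two inputs: the crossing takes place in the ternary outer factor, and the
axiom `two_in_three_fst` applies. So `β₃₂` determines both operations on `4`-ary multimaps. -/
theorem swap_quaternary_eq_right {a₁ a₂ a₃ a₄ b : Obj} (h : tight.off ≤ [a₁, a₂].length)
    (t : C.Multi tight [a₁, a₂, a₃, a₄] b) :
    swap hC (crossing β) [a₁, a₂] a₃ a₄ [] h rfl rfl t = β.β₄₃ t := by
  obtain ⟨m, e, u, rfl⟩ := exists_comp₀ hC (A := [a₁, a₂]) (Δ := [a₃, a₄]) (x := tight)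
    (off_le_cons _ _ _) rfl t
  refine (swap_comp₀_right (Γ := []) (Δ₁' := [a₄, a₃]) rfl rfl rfl h rfl rfl rfl rfl u e).trans ?_
  rw [swap_ternary]
  exact (β.two_in_three_fst u e).symm

/-- All six exchanges concern the same three consecutive inputs. Classifying what precedes them and
splitting off what follows them leaves a tight `4`-ary multimap, for which the relation is the axiom
`braid`. -/
theorem swap_braid {x : Tightness} {Γ Δ L₀ L₁ L₂ L₃ M₁ M₂ Γ₁ Γ₂ Γ₃ : List Obj} {a b c d : Obj}
    (hΓ : x.off ≤ Γ.length) (hΓ₁ : Γ₁ = Γ ++ [b]) (hΓ₂ : Γ₂ = Γ ++ [a]) (hΓ₃ : Γ₃ = Γ ++ [c])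
    (h₁ : x.off ≤ Γ₁.length) (h₂ : x.off ≤ Γ₂.length) (h₃ : x.off ≤ Γ₃.length)
    (hL₀ : L₀ = Γ ++ a :: b :: (c :: Δ)) (hL₁ : L₁ = Γ ++ b :: a :: (c :: Δ))
    (hL₁' : L₁ = Γ₁ ++ a :: c :: Δ) (hL₂ : L₂ = Γ₁ ++ c :: a :: Δ)
    (hL₂' : L₂ = Γ ++ b :: c :: (a :: Δ)) (hL₃ : L₃ = Γ ++ c :: b :: (a :: Δ))
    (hL₀' : L₀ = Γ₂ ++ b :: c :: Δ) (hM₁ : M₁ = Γ₂ ++ c :: b :: Δ)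
    (hM₁' : M₁ = Γ ++ a :: c :: (b :: Δ)) (hM₂ : M₂ = Γ ++ c :: a :: (b :: Δ))
    (hM₂' : M₂ = Γ₃ ++ a :: b :: Δ) (hL₃' : L₃ = Γ₃ ++ b :: a :: Δ) (f : C.Multi x L₀ d) :
    swap hC (crossing β) Γ b c (a :: Δ) hΓ hL₂' hL₃
        (swap hC (crossing β) Γ₁ a c Δ h₁ hL₁' hL₂
          (swap hC (crossing β) Γ a b (c :: Δ) hΓ hL₀ hL₁ f)) =
      swap hC (crossing β) Γ₃ a b Δ h₃ hM₂' hL₃'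
        (swap hC (crossing β) Γ a c (b :: Δ) hΓ hM₁' hM₂
          (swap hC (crossing β) Γ₂ b c Δ h₂ hL₀' hM₁ f)) := by
  obtain ⟨m, e, u, rfl⟩ := exists_comp₀ hC (Δ := a :: b :: c :: Δ) hΓ hL₀ f
  obtain ⟨n, q, v, rfl⟩ := exists_comp₀ hC (A := [m, a, b, c]) (Δ := Δ) (x := tight)
    (off_le_cons _ _ _) rfl u
  rw [swap_comp₀_right (Γ := []) (Δ₁' := b :: a :: c :: Δ) rfl rfl (by simp) hΓ hL₀ hL₁,
    swap_comp₀_right (Γ := [b]) (Δ₁' := b :: c :: a :: Δ) rfl rfl hΓ₁ h₁ hL₁ hL₂',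
    swap_comp₀_right (Γ := []) (Δ₁' := c :: b :: a :: Δ) rfl rfl (by simp) hΓ hL₂' hL₃,
    swap_comp₀_right (Γ := [a]) (Δ₁' := a :: c :: b :: Δ) rfl rfl hΓ₂ h₂ hL₀ hM₁',
    swap_comp₀_right (Γ := []) (Δ₁' := c :: a :: b :: Δ) rfl rfl (by simp) hΓ hM₁' hM₂,
    swap_comp₀_right (Γ := [c]) (Δ₁' := c :: b :: a :: Δ) rfl rfl hΓ₃ h₃ hM₂ hL₃]
  refine congrArg (fun k => comp₀ hL₃ k e) ?_
  -- Exchanges among the inputs of the inner factor pass through `v`, so all six move into the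
  -- `4`-ary factor `q`.
  have h₁ : ∀ (p r s : Obj) (k : C.Multi tight [m, p, r, s] n),
      swap hC (crossing β) [m] p r (s :: Δ) (off_le_cons _ _ _) rfl rfl
          (comp₀ (A := [m, p, r, s]) rfl v k) =
        comp₀ (A := [m, r, p, s]) rfl v
          (swap hC (crossing β) [m] p r [s] (off_le_cons _ _ _) rfl rfl k) := fun p r s k =>
    swap_comp₀_left (Γ := [m]) (Δ := [s]) (off_le_cons _ _ _) rfl rfl rfl rfl rfl rfl rfl v k
  have h₂ : ∀ (p r s : Obj) (k : C.Multi tight [m, p, r, s] n),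
      swap hC (crossing β) [m, p] r s Δ (off_le_cons _ _ _) rfl rfl
          (comp₀ (A := [m, p, r, s]) rfl v k) =
        comp₀ (A := [m, p, s, r]) rfl v
          (swap hC (crossing β) [m, p] r s [] (off_le_cons _ _ _) rfl rfl k) := fun p r s k =>
    swap_comp₀_left (Γ := [m, p]) (Δ := []) (off_le_cons _ _ _) rfl rfl rfl rfl rfl rfl rfl v k
  rw [h₁, h₂, h₁, h₂, h₁, h₂]
  refine congrArg (comp₀ rfl v) ?_
  refine ((swap_quaternary_eq_left _).trans (congrArg β.β₄₂ ((swap_quaternary_eq_right _ _).trans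
    (congrArg β.β₄₃ (swap_quaternary_eq_left q))))).trans ((β.braid q).trans (Eq.symm ?_))
  exact (swap_quaternary_eq_right _ _).trans (congrArg β.β₄₃ ((swap_quaternary_eq_left _).trans
    (congrArg β.β₄₂ (swap_quaternary_eq_right _ q))))

/-! ### Substituting a crossing -/

/-- The case of a tight binary outer multimap, with the crossed multimap in its second input.
Factoring both parts reduces it to a ternary multimap inside a binary one, which is the axiom
`three_in_two_snd`. -/
theorem subst_swap_binary {y : Tightness} {Γ Δ A A' M M' : List Obj} {a b c d m : Obj}
    (hΓ : y.off ≤ Γ.length) (hA : A = Γ ++ a :: b :: Δ) (hA' : A' = Γ ++ b :: a :: Δ)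
    (hM : M = [m] ++ A ++ []) (hM' : M' = [m] ++ A' ++ []) (hΓ₂ : tight.off ≤ (m :: Γ).length)
    (h₂ : M = (m :: Γ) ++ a :: b :: Δ) (h₂' : M' = (m :: Γ) ++ b :: a :: Δ)
    (w : C.Multi tight [m, d] c) (f : C.Multi y A d) :
    C.subst [m] d [] rfl hM' (y.subst_cons m []) w (swap hC (crossing β) Γ a b Δ hΓ hA hA' f) =
      swap hC (crossing β) (m :: Γ) a b Δ hΓ₂ h₂ h₂' (C.subst [m] d [] rfl hM (y.subst_cons m []) w f) := by
  obtain ⟨k, n, e, t, g, rfl⟩ := exists_comp₀_comp₀ hC hΓ rfl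
    (hA.trans (by simp : _ = (Γ ++ [a, b]) ++ Δ)) f
  -- Substituting `g` into `w` gives a multimap with inputs `m, n, Δ`. Cutting it after `m, n`
  -- produces a new binary map `w'`, into whose second input `t` can be substituted.
  obtain ⟨l, w', v, hv⟩ := exists_comp₀ hC (A := [m, n]) (Δ := Δ) (x := tight) (off_le_cons _ _ _)
    rfl (C.subst [m] d [] (L := [m, d]) (M := m :: n :: Δ) rfl (by simp) rfl w g)
  -- The rewriting does not use the order of the two inputs `p`, `q`, so it applies both before and
  -- after the exchange.
  have key : ∀ {K B : List Obj} (p q : Obj) (hB : B = (Γ ++ [p, q]) ++ Δ)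
      (hK : K = [m] ++ B ++ []) (hK' : K = (m :: (Γ ++ [p, q])) ++ Δ)
      (t : C.Multi tight [k, p, q] n),
      C.subst [m] d [] rfl hK (y.subst_cons m []) w (comp₀ hB g (comp₀ rfl t e)) =
        comp₀ hK' v (C.subst [m] k [p, q] (M := m :: (Γ ++ [p, q])) rfl (by simp) rfl
          (C.subst [m] n [] (M := [m, k, p, q]) rfl rfl rfl w' t) e) := by
    intro K B p q hB hK hK' t
    refine (subst_subst [m] d [] [] n Δ (M := m :: n :: Δ) (t := tight) rfl (by simp) rfl rfl hB
      rfl hK rfl (by simp) rfl rfl (by simp [hK']) rfl w g _).trans ?_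
    rw [hv]
    refine (subst_comp₀_left (Γ := [m]) (B := Γ ++ [p, q]) (Γ' := []) (A' := m :: (Γ ++ [p, q])) rfl rfl rfl (by simp) rfl
      (by simp [hK']) hK' rfl v w' _).trans (congrArg (comp₀ hK' v) ?_)
    exact subst_subst (x := tight) (y := tight) [m] n [] [] k [p, q] rfl rfl rfl rfl rfl rfl
      (by simp) rfl rfl rfl rfl (by simp) rfl w' t e
  rw [swap_comp₀_comp₀ hΓ hA hA' rfl _ rfl (by simp [hA'])]
  refine (key b a _ _ (by simp [h₂']) _).trans (Eq.trans ?_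
    (congrArg (swap hC (crossing β) _ _ _ _ hΓ₂ h₂ h₂') (key a b _ _ (by simp [h₂]) t).symm))
  refine Eq.trans ?_ (swap_comp₀_left (x := tight) (Γ := m :: Γ) (L' := m :: Γ ++ [b, a]) (Δ := [])
    hΓ₂ (by simp) rfl _ (by simp [h₂']) rfl h₂ h₂' v _).symm
  refine congrArg (comp₀ _ v) ?_
  refine Eq.trans ?_ (subst_swap_before (Γ := [m, k]) (Γ' := m :: Γ) (Γ₁ := [m])
    (Γ₂ := []) (A := Γ) (L := [m, k, a, b]) (L' := [m, k, b, a]) (M := m :: (Γ ++ [a, b]))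
    (M' := m :: (Γ ++ [b, a])) (Ψ := [a, b]) (Ψ' := [b, a])
    (off_le_cons _ _ _) _ rfl rfl (by simp) (by simp) rfl (by simp) rfl rfl (by simp) rfl (by simp)
    (C.subst [m] n [] rfl rfl rfl w' t) e)
  -- What remains is the identity for `w'` and `t` alone.
  refine congrArg (fun z => C.subst [m] k [b, a] rfl _ rfl z e) ?_
  exact (β.three_in_two_snd w' t).trans (swap_quaternary_eq_right _ _).symm

/-- If `Ξ` can be classified, `g` factors with a binary middle part whose second input is `d`, and
`subst_swap_binary` applies. Otherwise `g` is tight and the substitution is in its first input, so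
the exchange happens in the inner factor of a composite. -/
theorem subst_swap {x y w : Tightness} {Ξ Θ Γ Δ Γ₂ Δ₂ L A A' M M' : List Obj} {a b c d : Obj}
    (hΓ : y.off ≤ Γ.length) (hA : A = Γ ++ a :: b :: Δ) (hA' : A' = Γ ++ b :: a :: Δ)
    (hL : L = Ξ ++ d :: Θ)
    (hM : M = Ξ ++ A ++ Θ) (hM' : M' = Ξ ++ A' ++ Θ) (hw : w = x.subst Ξ.length y)
    (hΓ₂ : Γ₂ = Ξ ++ Γ) (hΔ₂ : Δ₂ = Δ ++ Θ) (hΓ' : w.off ≤ Γ₂.length)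
    (h₂ : M = Γ₂ ++ a :: b :: Δ₂) (h₂' : M' = Γ₂ ++ b :: a :: Δ₂)
    (g : C.Multi x L c) (f : C.Multi y A d) :
    C.subst Ξ d Θ hL hM' hw g (swap hC (crossing β) Γ a b Δ hΓ hA hA' f) =
      swap hC (crossing β) Γ₂ a b Δ₂ hΓ' h₂ h₂' (C.subst Ξ d Θ hL hM hw g f) := by
  subst hΓ₂ hΔ₂
  by_cases hx : x.off ≤ Ξ.length
  · obtain ⟨m, e, u, rfl⟩ := exists_comp₀ hC (Δ := d :: Θ) hx hL g
    obtain ⟨n, p, v, rfl⟩ := exists_comp₀ hC (A := [m, d]) (Δ := Θ) (x := tight)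
      (off_le_cons _ _ _) rfl u
    obtain rfl : w = x := by
      rw [hw]
      cases x
      · cases Ξ
        · simp [off] at hx
        · rfl
      · rfl
    have key : ∀ {K B : List Obj} (hK : K = Ξ ++ B ++ Θ) (hK' : K = Ξ ++ (B ++ Θ))
        (f : C.Multi y B d),
        C.subst Ξ d Θ hL hK hw (comp₀ hL (comp₀ rfl v p) e) f =
          comp₀ hK' (comp₀ (M := m :: (B ++ Θ)) (A := m :: B) rfl v
            (C.subst [m] d [] (M := m :: B) rfl (by simp) (y.subst_cons m []) p f)) e := by
      intro K B hK hK' f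
      refine (subst_comp₀_right (Γ := []) hL (by simp) hL hK hw rfl rfl hK'
        (comp₀ rfl v p) e f).trans (congrArg (fun z => comp₀ hK' z e) ?_)
      exact subst_comp₀_left (Γ := [m]) (B := B) (Γ' := []) (A' := m :: B) rfl rfl rfl (by simp) rfl
        (by simp) rfl rfl v p f
    rw [key hM' (by simp [hM']), key hM (by simp [hM]),
      subst_swap_binary (m := m) (M := m :: A) (M' := m :: A') hΓ hA hA' (by simp) (by simp) (off_le_cons _ _ _) (by simp [hA])
        (by simp [hA']) p f,
      swap_comp₀_right (Γ := Γ) (Δ₁ := A ++ Θ) (Δ₁' := A' ++ Θ) (by simp [hA]) (by simp [hA']) rfl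
        hΓ' _ (by simp [hM']),
      swap_comp₀_left (Γ := m :: Γ) (Δ := Δ) (L' := m :: A') (off_le_cons _ _ _) (by simp [hA])
        (by simp [hA']) _ rfl rfl]
  · obtain rfl : x = tight := by cases x <;> simp_all [off]
    obtain rfl : Ξ = [] := by cases Ξ <;> simp_all [off]
    subst hL
    obtain rfl : w = y := hw
    exact (swap_comp₀_left hΓ hA hA' hM hM' rfl h₂ h₂' g f).symm

end SkewMulticategory

namespace SkewMulticategory

variable {Obj : Type u} {C : SkewMulticategory.{u, v} Obj}

/-! ### Substituting into a crossing -/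

section Nullary

variable {hC : C.LeftRepresentable} {β : C.toShort.ShortBraiding}

/-- `I` classifies nullary multimaps, and left universality of `i` defines `l` by its first
equation. For the second equation, substitute `i` into both sides: the order of the two nullary
substitutions into `l` is immaterial, so the first equation gives equality after substitution of
`i`, and universality of `i` cancels it. -/
theorem exists_unit (hC : C.LeftRepresentable) : ∃ (I : Obj) (i : C.Multi loose [] I)
    (l : C.Multi tight [I, I] I),
    (∀ (a : Obj) (f : C.Multi loose [] a), ∃ p : C.Multi tight [I] a,
      C.subst [] I [] rfl rfl rfl p i = f) ∧
    C.subst [] I [I] rfl rfl rfl l i = C.j (C.id I) ∧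
    C.subst [I] I [] rfl rfl rfl l i = C.id I := by
  obtain ⟨I, i, hi⟩ := exists_classifier hC (x := loose) (A := []) (Nat.zero_le _)
  obtain ⟨l, hl⟩ := (hi [I] [I] rfl I).2 (C.j (C.id I))
  refine ⟨I, i, l, fun a => (hi [] [] rfl a).2, hl, (hi [] [] rfl I).1 ?_⟩
  refine (subst_comp₀_right (x := loose) (A := []) (Γ := []) (Γ₁ := []) (Θ := []) (M := [I])
    rfl rfl rfl rfl rfl rfl rfl rfl l i i).symm.trans ?_
  refine (congrArg (fun k => C.subst [] I [] rfl rfl rfl k i) hl).trans ?_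
  exact C.j_subst' (y := loose) [] I [] rfl rfl rfl rfl (C.id I) i

theorem subst_j_id {Γ Δ L : List Obj} {a c : Obj} (hL : L = Γ ++ a :: Δ) (hL' : L = Γ ++ [a] ++ Δ)
    (hw : tight = tight.subst Γ.length loose) (f : C.Multi tight L c) :
    C.subst Γ a Δ hL hL' hw f (C.j (C.id a)) = f := by
  refine (C.subst_j' Γ a Δ hL hL' hw (Tightness.subst_tight _ _) f (C.id a)).trans ?_
  exact C.subst_id ..

/-- Substituting a unit in the first of two crossing inputs. -/
theorem subst_braid_unit_fst {I m b n : Obj} (i : C.Multi loose [] I)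
    (l : C.Multi tight [I, I] I) (h₁ : C.subst [] I [I] rfl rfl rfl l i = C.j (C.id I))
    (h₂ : C.subst [I] I [] rfl rfl rfl l i = C.id I) (t : C.Multi tight [m, I, b] n) :
    (C.subst [m, b] I [] rfl rfl rfl
      (swap hC (crossing β) [m] I b [] (off_le_cons _ _ _) rfl rfl t) i : C.Multi tight [m, b] n) =
      C.subst [m] I [b] rfl rfl rfl t i := by
  -- Double the unit input by `l` and cross only the second copy with `b`. Filling either copy of
  -- `I` in the half-crossed `z'` with `i` recovers one side: the copy left of `b` gives the crossed
  -- `t`, the copy right of `b` gives `t` itself.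
  let z : C.Multi tight [m, I, I, b] n := C.subst [m] I [b] rfl rfl rfl t l
  let z' : C.Multi tight [m, I, b, I] n :=
    swap hC (crossing β) [m, I] I b [] (off_le_cons _ _ _) rfl rfl z
  -- Checked after crossing the remaining copy of `I` as well, which is injective. Both copies have
  -- then crossed `b`, so `two_in_three_snd` applies and `l` is killed by its right unit law.
  have e₁ : C.subst [m, I, b] I [] rfl rfl rfl z' i = t := by
    refine Function.LeftInverse.injective (swap_swap_of_leftInverse (hC := hC) (β := crossing β)
      (β' := crossingInv β) (fun _ _ _ _ => β.β₃₂.symm_apply_apply) (x := tight) (Γ := [m])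
      (off_le_cons _ _ _) rfl rfl) ?_
    refine (subst_swap_after (Γ := [m]) (Φ := []) (Γ₁ := [m, I, b]) (Γ₁' := [m, b, I]) (Θ := [])
      (Δ := [I]) (Δ' := []) (A := []) (M' := [m, b, I]) (off_le_cons _ _ _) rfl rfl rfl rfl rfl rfl
      rfl rfl rfl rfl rfl rfl rfl rfl z' i).symm.trans ?_
    refine (congrArg (fun k => C.subst [m, b, I] I [] rfl rfl rfl k i)
      (((swap_quaternary_eq_left z').trans (congrArg β.β₄₂ (swap_quaternary_eq_right _ z))).trans
        (β.two_in_three_snd t l))).trans ?_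
    refine (subst_subst (x := tight) (y := tight) (z := loose) [m, b] I [] [I] I [] rfl rfl rfl rfl
      rfl rfl rfl rfl rfl rfl rfl rfl rfl _ l i).symm.trans ?_
    refine (congrArg (C.subst [m, b] I [] rfl rfl rfl _) h₂).trans ?_
    exact (C.subst_id ..).trans (swap_ternary_eq t).symm
  -- The filled copy lies before the crossing, so it can be filled first; the left unit law then
  -- removes `l`.
  have e₂ : C.subst [m] I [b, I] rfl rfl rfl z' i =
      swap hC (crossing β) [m] I b [] (off_le_cons _ _ _) rfl rfl t := by
    refine (subst_swap_before (Γ := [m, I]) (Γ' := [m]) (Γ₁ := [m]) (Γ₂ := []) (Ψ := [I, b])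
      (L := [m, I, I, b]) (L' := [m, I, b, I]) (M := [m, I, b]) (M' := [m, b, I])
      (Ψ' := [b, I]) (A := []) (off_le_cons _ _ _) (off_le_cons _ _ _) rfl rfl rfl rfl rfl rfl rfl
      rfl rfl rfl rfl z i).trans ?_
    refine congrArg (swap hC (crossing β) [m] I b [] (off_le_cons _ _ _) rfl rfl) ?_
    refine (subst_subst (x := tight) (y := tight) (z := loose) [m] I [b] [] I [I] rfl rfl rfl rfl
      rfl rfl rfl rfl rfl rfl rfl rfl rfl t l i).symm.trans ?_
    exact (congrArg (C.subst [m] I [b] rfl rfl rfl t) h₁).trans (subst_j_id ..)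
  -- Filling both copies in the two possible orders gives the two sides.
  refine (congrArg (fun k => C.subst [m, b] I [] rfl rfl rfl k i) e₂.symm).trans
    (Eq.trans ?_ (congrArg (fun k => C.subst [m] I [b] rfl rfl rfl k i) e₁))
  exact subst_subst_comm (x := tight) (y := loose) (z := loose) [m] I [b] I [] rfl rfl rfl rfl rfl
    rfl rfl rfl rfl rfl rfl rfl rfl rfl rfl rfl z' i i

/-- Substituting a unit in the second of two crossing inputs. -/
theorem subst_braid_unit_snd {I m b n : Obj} (i : C.Multi loose [] I)
    (l : C.Multi tight [I, I] I) (h₁ : C.subst [] I [I] rfl rfl rfl l i = C.j (C.id I))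
    (h₂ : C.subst [I] I [] rfl rfl rfl l i = C.id I) (t : C.Multi tight [m, b, I] n) :
    (C.subst [m] I [b] rfl rfl rfl
      (swap hC (crossing β) [m] b I [] (off_le_cons _ _ _) rfl rfl t) i : C.Multi tight [m, b] n) =
      C.subst [m, b] I [] rfl rfl rfl t i := by
  -- The mirror image of the previous argument: here `b` has crossed only the first of two copies of
  -- the unit, and filling the copy to the right of `b` gives the crossed multimap.
  let z : C.Multi tight [m, b, I, I] n := C.subst [m, b] I [] rfl rfl rfl t l
  let z' : C.Multi tight [m, I, b, I] n :=
    swap hC (crossing β) [m] b I [I] (off_le_cons _ _ _) rfl rfl z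
  have e₁ : C.subst [m, I, b] I [] rfl rfl rfl z' i =
      swap hC (crossing β) [m] b I [] (off_le_cons _ _ _) rfl rfl t := by
    refine (subst_swap_after (Γ := [m]) (Φ := []) (Γ₁ := [m, b, I]) (Γ₁' := [m, I, b]) (Θ := [])
      (Δ := [I]) (Δ' := []) (A := []) (M := [m, b, I]) (M' := [m, I, b]) (off_le_cons _ _ _) rfl
      rfl rfl rfl rfl rfl rfl rfl rfl rfl rfl rfl rfl rfl z i).trans ?_
    refine congrArg (swap hC (crossing β) [m] b I [] (off_le_cons _ _ _) rfl rfl) ?_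
    refine (subst_subst (x := tight) (y := tight) (z := loose) [m, b] I [] [I] I [] rfl rfl rfl rfl
      rfl rfl rfl rfl rfl rfl rfl rfl rfl t l i).symm.trans ?_
    exact (congrArg (C.subst [m, b] I [] rfl rfl rfl t) h₂).trans (C.subst_id ..)
  have e₂ : C.subst [m] I [b, I] rfl rfl rfl z' i = t := by
    refine Function.LeftInverse.injective (swap_swap_of_leftInverse (hC := hC) (β := crossing β)
      (β' := crossingInv β) (fun _ _ _ _ => β.β₃₂.symm_apply_apply) (x := tight) (Γ := [m])
      (off_le_cons _ _ _) rfl rfl) ?_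
    refine (subst_swap_before (Γ := [m, I]) (Γ' := [m]) (Γ₁ := [m]) (Γ₂ := []) (Ψ := [b, I])
      (L := [m, I, b, I]) (L' := [m, I, I, b]) (M := [m, b, I]) (M' := [m, I, b])
      (Ψ' := [I, b]) (A := []) (off_le_cons _ _ _) (off_le_cons _ _ _) rfl rfl rfl rfl rfl rfl rfl
      rfl rfl rfl rfl z' i).symm.trans ?_
    refine (congrArg (fun k => C.subst [m] I [I, b] rfl rfl rfl k i)
      (((swap_quaternary_eq_right _ z').trans (congrArg β.β₄₃ (swap_quaternary_eq_left z))).trans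
        (β.two_in_three_trd t l))).trans ?_
    refine (subst_subst (x := tight) (y := tight) (z := loose) [m] I [b] [] I [I] rfl rfl rfl rfl
      rfl rfl rfl rfl rfl rfl rfl rfl rfl _ l i).symm.trans ?_
    refine (congrArg (C.subst [m] I [b] rfl rfl rfl _) h₁).trans ?_
    exact (subst_j_id ..).trans (swap_ternary_eq t).symm
  refine (congrArg (fun k => C.subst [m] I [b] rfl rfl rfl k i) e₁.symm).trans
    (Eq.trans ?_ (congrArg (fun k => C.subst [m, b] I [] rfl rfl rfl k i) e₂))
  exact (subst_subst_comm (x := tight) (y := loose) (z := loose) [m] I [b] I [] rfl rfl rfl rfl rfl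
    rfl rfl rfl rfl rfl rfl rfl rfl rfl rfl rfl z' i i).symm

/-- Every nullary multimap is a unary map applied to the unit `i`, and the unary map passes through
the crossing by naturality. -/
theorem subst_ternary_nullary_fst (hC : C.LeftRepresentable) {m a b n : Obj}
    (t : C.Multi tight [m, a, b] n) (f : C.Multi loose [] a) :
    (C.subst [m, b] a [] rfl rfl rfl ((crossing β).app t) f : C.Multi tight [m, b] n) =
      C.subst [m] a [b] rfl rfl rfl t f := by
  obtain ⟨I, i, l, hi, h₁, h₂⟩ := exists_unit hC
  obtain ⟨p, rfl⟩ := hi a f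
  refine (subst_subst (x := tight) (y := tight) (z := loose) [m, b] a [] [] I [] rfl rfl rfl rfl
    rfl rfl rfl rfl rfl rfl rfl rfl rfl _ p i).trans ?_
  refine (congrArg (fun k => C.subst [m, b] I [] rfl rfl rfl k i)
    ((braid₃_pre_snd β t p).symm.trans (swap_ternary_eq (hC := hC) _).symm)).trans ?_
  refine (subst_braid_unit_fst i l h₁ h₂ _).trans ?_
  exact (subst_subst (x := tight) (y := tight) (z := loose) [m] a [b] [] I [] rfl rfl rfl rfl
    rfl rfl rfl rfl rfl rfl rfl rfl rfl t p i).symm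

theorem subst_ternary_nullary_snd (hC : C.LeftRepresentable) {m a b n : Obj}
    (t : C.Multi tight [m, a, b] n) (f : C.Multi loose [] b) :
    (C.subst [m] b [a] rfl rfl rfl ((crossing β).app t) f : C.Multi tight [m, a] n) =
      C.subst [m, a] b [] rfl rfl rfl t f := by
  obtain ⟨I, i, l, hi, h₁, h₂⟩ := exists_unit hC
  obtain ⟨p, rfl⟩ := hi b f
  refine (subst_subst (x := tight) (y := tight) (z := loose) [m] b [a] [] I [] rfl rfl rfl rfl
    rfl rfl rfl rfl rfl rfl rfl rfl rfl _ p i).trans ?_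
  refine (congrArg (fun k => C.subst [m] I [a] rfl rfl rfl k i)
    ((braid₃_pre_trd β t p).symm.trans (swap_ternary_eq (hC := hC) _).symm)).trans ?_
  refine (subst_braid_unit_snd i l h₁ h₂ _).trans ?_
  exact (subst_subst (x := tight) (y := tight) (z := loose) [m, a] b [] [] I [] rfl rfl rfl rfl
    rfl rfl rfl rfl rfl rfl rfl rfl rfl t p i).symm

end Nullary

section

variable {hC : C.LeftRepresentable} {β : C.toShort.ShortBraiding}

/-- A substitution into one of the inputs `a`, `b` of a factored multimap `g ∘ (t ∘ e)` affects only
`t`. This reduces the lemmas on substitution into a crossing input to ternary multimaps. -/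
theorem subst_comp₀_comp₀ {x y : Tightness} {A B K K' Φ Ψ Ψ₁ Γ₁ Δ L L₁ M M₁ : List Obj}
    {m n c d : Obj} (hK : m :: K = m :: Φ ++ d :: Ψ) (hK' : m :: K' = m :: Φ ++ B ++ Ψ)
    (hL₁ : L₁ = A ++ K) (hL : L = L₁ ++ Δ) (hM₁ : M₁ = A ++ K') (hM : M = M₁ ++ Δ)
    (hΓ₁ : Γ₁ = A ++ Φ) (hΨ₁ : Ψ₁ = Ψ ++ Δ) (h₁ : L = Γ₁ ++ d :: Ψ₁) (h₂ : M = Γ₁ ++ B ++ Ψ₁)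
    (hw : x = x.subst Γ₁.length y) (g : C.Multi tight (n :: Δ) c) (t : C.Multi tight (m :: K) n)
    (e : C.Multi x A m) (f : C.Multi y B d) :
    C.subst Γ₁ d Ψ₁ h₁ h₂ hw (comp₀ hL g (comp₀ hL₁ t e)) f =
      comp₀ hM g (comp₀ hM₁ (C.subst (m :: Φ) d Ψ hK hK' (y.subst_cons m Φ) t f) e) := by
  obtain rfl : K = Φ ++ d :: Ψ := by simpa using hK
  obtain rfl : K' = Φ ++ B ++ Ψ := by simpa using hK'
  refine (subst_comp₀_left (Γ := Γ₁) (Γ' := Ψ) (A' := M₁) hL hΨ₁ (by simp [hL₁, hΓ₁])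
    (by simp [hM₁, hΓ₁]) h₁ h₂ hM hw g _ f).trans (congrArg (comp₀ hM g) ?_)
  exact subst_comp₀_right hL₁ hΓ₁ (by simp [hL₁, hΓ₁]) (by simp [hM₁, hΓ₁]) hw hK hK' hM₁ t e f

variable {x : Tightness} {Γ Γ₁ Δ L L' M : List Obj} {a b c : Obj}

/-- Substitution into one of two crossing inputs is settled here for nullary, unary and binary `f`:
filling an input removes its strand and with it the crossing, a unary map slides along its strand,
and a binary map doubles its strand. Larger arities are built from these by induction. -/
theorem subst_swap_nullary_fst (hΓ : x.off ≤ Γ.length) (hL : L = Γ ++ a :: b :: Δ)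
    (hL' : L' = Γ ++ b :: a :: Δ) (hΓ₁ : Γ₁ = Γ ++ [b]) (k₁ : L' = Γ₁ ++ a :: Δ)
    (k₂ : M = Γ₁ ++ [] ++ Δ) (k₁' : L = Γ ++ a :: (b :: Δ)) (k₂' : M = Γ ++ [] ++ b :: Δ)
    (hw : x = x.subst Γ₁.length loose) (hw' : x = x.subst Γ.length loose)
    (g : C.Multi x L c) (f : C.Multi loose [] a) :
    C.subst Γ₁ a Δ k₁ k₂ hw (swap hC (crossing β) Γ a b Δ hΓ hL hL' g) f =
      C.subst Γ a (b :: Δ) k₁' k₂' hw' g f := by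
  obtain ⟨m, n, e, t, v, rfl⟩ := exists_comp₀_comp₀ hC hΓ rfl
    (hL.trans (by simp : _ = (Γ ++ [a, b]) ++ Δ)) g
  rw [swap_comp₀_comp₀ hΓ hL hL' rfl _ rfl (by simp [hL'])]
  refine (subst_comp₀_comp₀ (Φ := [b]) (Ψ := []) (K' := [b]) (M₁ := Γ ++ [b]) rfl rfl rfl _ rfl
    (by simp [k₂, hΓ₁]) hΓ₁ rfl k₁ k₂ hw v _ e f).trans ?_
  refine Eq.trans ?_ (subst_comp₀_comp₀ (Φ := []) (Ψ := [b]) (K' := [b]) (M₁ := Γ ++ [b]) rfl rfl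
    rfl _ rfl (by simp [k₂, hΓ₁]) (by simp) rfl k₁' k₂' hw' v t e f).symm
  exact congrArg (fun k => comp₀ _ v (comp₀ rfl k e)) (subst_ternary_nullary_fst hC t f)

theorem subst_swap_nullary_snd (hΓ : x.off ≤ Γ.length) (hL : L = Γ ++ a :: b :: Δ)
    (hL' : L' = Γ ++ b :: a :: Δ) (hΓ₁ : Γ₁ = Γ ++ [a]) (k₁ : L' = Γ ++ b :: (a :: Δ))
    (k₂ : M = Γ ++ [] ++ a :: Δ) (k₁' : L = Γ₁ ++ b :: Δ) (k₂' : M = Γ₁ ++ [] ++ Δ)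
    (hw : x = x.subst Γ.length loose) (hw' : x = x.subst Γ₁.length loose)
    (g : C.Multi x L c) (f : C.Multi loose [] b) :
    C.subst Γ b (a :: Δ) k₁ k₂ hw (swap hC (crossing β) Γ a b Δ hΓ hL hL' g) f =
      C.subst Γ₁ b Δ k₁' k₂' hw' g f := by
  obtain ⟨m, n, e, t, v, rfl⟩ := exists_comp₀_comp₀ hC hΓ rfl
    (hL.trans (by simp : _ = (Γ ++ [a, b]) ++ Δ)) g
  rw [swap_comp₀_comp₀ hΓ hL hL' rfl _ rfl (by simp [hL'])]
  refine (subst_comp₀_comp₀ (Φ := []) (Ψ := [a]) (K' := [a]) (M₁ := Γ ++ [a]) rfl rfl rfl _ rfl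
    (by simp [k₂]) (by simp) rfl k₁ k₂ hw v _ e f).trans ?_
  refine Eq.trans ?_ (subst_comp₀_comp₀ (Φ := [a]) (Ψ := []) (K' := [a]) (M₁ := Γ ++ [a]) rfl rfl
    rfl _ rfl (by simp [k₂]) hΓ₁ rfl k₁' k₂' hw' v t e f).symm
  exact congrArg (fun k => comp₀ _ v (comp₀ rfl k e)) (subst_ternary_nullary_snd hC t f)

theorem subst_swap_unary_fst {a' : Obj} {M' : List Obj} (hΓ : x.off ≤ Γ.length)
    (hL : L = Γ ++ a :: b :: Δ)
    (hL' : L' = Γ ++ b :: a :: Δ) (hΓ₁ : Γ₁ = Γ ++ [b]) (k₁ : L' = Γ₁ ++ a :: Δ)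
    (k₂ : M' = Γ₁ ++ [a'] ++ Δ) (k₁' : L = Γ ++ a :: (b :: Δ)) (k₂' : M = Γ ++ [a'] ++ b :: Δ)
    (hM : M = Γ ++ a' :: b :: Δ) (hM' : M' = Γ ++ b :: a' :: Δ)
    (hw : x = x.subst Γ₁.length tight) (hw' : x = x.subst Γ.length tight)
    (g : C.Multi x L c) (f : C.Multi tight [a'] a) :
    C.subst Γ₁ a Δ k₁ k₂ hw (swap hC (crossing β) Γ a b Δ hΓ hL hL' g) f =
      swap hC (crossing β) Γ a' b Δ hΓ hM hM' (C.subst Γ a (b :: Δ) k₁' k₂' hw' g f) := by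
  obtain ⟨m, n, e, t, v, rfl⟩ := exists_comp₀_comp₀ hC hΓ rfl
    (hL.trans (by simp : _ = (Γ ++ [a, b]) ++ Δ)) g
  rw [swap_comp₀_comp₀ hΓ hL hL' rfl _ rfl (by simp [hL'])]
  refine (subst_comp₀_comp₀ (Φ := [b]) (Ψ := []) (K' := [b, a']) (M₁ := Γ ++ [b, a']) rfl rfl rfl _
    rfl (by simp [hM']) hΓ₁ rfl k₁ k₂ hw v _ e f).trans ?_
  refine Eq.trans ?_ (congrArg (swap hC (crossing β) Γ a' b Δ hΓ hM hM')
    (subst_comp₀_comp₀ (Φ := []) (Ψ := [b]) (K' := [a', b]) (M₁ := Γ ++ [a', b]) rfl rfl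
    rfl _ rfl (by simp [hM]) (by simp) rfl k₁' k₂' hw' v t e f).symm)
  refine Eq.trans ?_ (swap_comp₀_comp₀ hΓ hM hM' rfl _ rfl (by simp [hM']) v _ e).symm
  exact congrArg (fun k => comp₀ _ v (comp₀ rfl k e)) (braid₃_pre_snd β t f).symm

theorem subst_swap_unary_snd {b' : Obj} {M' : List Obj} (hΓ : x.off ≤ Γ.length)
    (hL : L = Γ ++ a :: b :: Δ)
    (hL' : L' = Γ ++ b :: a :: Δ) (hΓ₁ : Γ₁ = Γ ++ [a]) (k₁ : L' = Γ ++ b :: (a :: Δ))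
    (k₂ : M' = Γ ++ [b'] ++ a :: Δ) (k₁' : L = Γ₁ ++ b :: Δ) (k₂' : M = Γ₁ ++ [b'] ++ Δ)
    (hM : M = Γ ++ a :: b' :: Δ) (hM' : M' = Γ ++ b' :: a :: Δ)
    (hw : x = x.subst Γ.length tight) (hw' : x = x.subst Γ₁.length tight)
    (g : C.Multi x L c) (f : C.Multi tight [b'] b) :
    C.subst Γ b (a :: Δ) k₁ k₂ hw (swap hC (crossing β) Γ a b Δ hΓ hL hL' g) f =
      swap hC (crossing β) Γ a b' Δ hΓ hM hM' (C.subst Γ₁ b Δ k₁' k₂' hw' g f) := by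
  obtain ⟨m, n, e, t, v, rfl⟩ := exists_comp₀_comp₀ hC hΓ rfl
    (hL.trans (by simp : _ = (Γ ++ [a, b]) ++ Δ)) g
  rw [swap_comp₀_comp₀ hΓ hL hL' rfl _ rfl (by simp [hL'])]
  refine (subst_comp₀_comp₀ (Φ := []) (Ψ := [a]) (K' := [b', a]) (M₁ := Γ ++ [b', a]) rfl rfl rfl _
    rfl (by simp [hM']) (by simp) rfl k₁ k₂ hw v _ e f).trans ?_
  refine Eq.trans ?_ (congrArg (swap hC (crossing β) Γ a b' Δ hΓ hM hM')
    (subst_comp₀_comp₀ (Φ := [a]) (Ψ := []) (K' := [a, b']) (M₁ := Γ ++ [a, b']) rfl rfl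
    rfl _ rfl (by simp [hM]) hΓ₁ rfl k₁' k₂' hw' v t e f).symm)
  refine Eq.trans ?_ (swap_comp₀_comp₀ hΓ hM hM' rfl _ rfl (by simp [hM']) v _ e).symm
  exact congrArg (fun k => comp₀ _ v (comp₀ rfl k e)) (braid₃_pre_trd β t f).symm

/-- The doubled strand crosses `b` one half at a time, starting with the adjacent half `q`. On the
ternary factor this is the axiom `two_in_three_snd`. -/
theorem subst_swap_binary_fst {p q : Obj} {M₁ M' Γ₂ : List Obj} (hΓ : x.off ≤ Γ.length)
    (hL : L = Γ ++ a :: b :: Δ)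
    (hL' : L' = Γ ++ b :: a :: Δ) (hΓ₁ : Γ₁ = Γ ++ [b]) (k₁ : L' = Γ₁ ++ a :: Δ)
    (k₂ : M' = Γ₁ ++ [p, q] ++ Δ) (k₁' : L = Γ ++ a :: (b :: Δ)) (k₂' : M = Γ ++ [p, q] ++ b :: Δ)
    (hΓ₂ : Γ₂ = Γ ++ [p]) (hΓ₂' : x.off ≤ Γ₂.length)
    (hM : M = Γ₂ ++ q :: b :: Δ) (hM₁ : M₁ = Γ₂ ++ b :: q :: Δ)
    (hM₁' : M₁ = Γ ++ p :: b :: (q :: Δ)) (hM' : M' = Γ ++ b :: p :: (q :: Δ))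
    (hw : x = x.subst Γ₁.length tight) (hw' : x = x.subst Γ.length tight)
    (g : C.Multi x L c) (f : C.Multi tight [p, q] a) :
    C.subst Γ₁ a Δ k₁ k₂ hw (swap hC (crossing β) Γ a b Δ hΓ hL hL' g) f =
      swap hC (crossing β) Γ p b (q :: Δ) hΓ hM₁' hM' (swap hC (crossing β) Γ₂ q b Δ hΓ₂' hM hM₁
        (C.subst Γ a (b :: Δ) k₁' k₂' hw' g f)) := by
  obtain ⟨m, n, e, t, v, rfl⟩ := exists_comp₀_comp₀ hC hΓ rfl
    (hL.trans (by simp : _ = (Γ ++ [a, b]) ++ Δ)) g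
  rw [swap_comp₀_comp₀ hΓ hL hL' rfl _ rfl (by simp [hL'])]
  refine (subst_comp₀_comp₀ (Φ := [b]) (Ψ := []) (K' := [b, p, q]) (M₁ := Γ ++ [b, p, q]) rfl rfl
    rfl _ rfl (by simp [hM']) hΓ₁ rfl k₁ k₂ hw v _ e f).trans ?_
  refine Eq.trans ?_ (congrArg (fun k => swap hC (crossing β) Γ p b (q :: Δ) hΓ hM₁' hM'
      (swap hC (crossing β) Γ₂ q b Δ hΓ₂' hM hM₁ k))
    (subst_comp₀_comp₀ (Φ := []) (Ψ := [b]) (K' := [p, q, b]) (M₁ := Γ ++ [p, q, b]) rfl rfl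
    rfl _ rfl (by simp [hM, hΓ₂]) (by simp) rfl k₁' k₂' hw' v t e f).symm)
  rw [swap_comp₀_left (Δ := []) (Δ' := Δ) (Δ₂ := Δ) (Γ := Γ₂) (L' := Γ ++ [p, b, q]) hΓ₂' (by simp [hΓ₂])
      (by simp [hΓ₂]) _ (by simp [hM₁']) rfl,
    swap_comp₀_right (Γ := [p]) (Δ₁' := [p, b, q]) rfl rfl hΓ₂ _ _ rfl,
    swap_comp₀_left (Δ := [q]) (Δ' := Δ) (Δ₂ := q :: Δ) (L' := Γ ++ [b, p, q]) hΓ rfl rfl _ (by simp [hM']) rfl,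
    swap_comp₀_right (Γ := []) (Δ₁' := [b, p, q]) rfl rfl (by simp) hΓ _ rfl]
  refine congrArg (fun k => comp₀ _ v (comp₀ rfl k e)) ?_
  exact ((swap_quaternary_eq_left _).trans ((congrArg β.β₄₂ (swap_quaternary_eq_right _ _)).trans
    (β.two_in_three_snd t f))).symm

/-- Now `a` crosses the two halves of the other strand, meeting `p` before `q`; on the ternary
factor this is the axiom `two_in_three_trd`. -/
theorem subst_swap_binary_snd {p q : Obj} {M₁ M' Γ₂ : List Obj} (hΓ : x.off ≤ Γ.length)
    (hL : L = Γ ++ a :: b :: Δ)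
    (hL' : L' = Γ ++ b :: a :: Δ) (hΓ₁ : Γ₁ = Γ ++ [a]) (k₁ : L' = Γ ++ b :: (a :: Δ))
    (k₂ : M' = Γ ++ [p, q] ++ a :: Δ) (k₁' : L = Γ₁ ++ b :: Δ) (k₂' : M = Γ₁ ++ [p, q] ++ Δ)
    (hΓ₂ : Γ₂ = Γ ++ [p]) (hΓ₂' : x.off ≤ Γ₂.length)
    (hM : M = Γ ++ a :: p :: (q :: Δ)) (hM₁ : M₁ = Γ ++ p :: a :: (q :: Δ))
    (hM₁' : M₁ = Γ₂ ++ a :: q :: Δ) (hM' : M' = Γ₂ ++ q :: a :: Δ)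
    (hw : x = x.subst Γ.length tight) (hw' : x = x.subst Γ₁.length tight)
    (g : C.Multi x L c) (f : C.Multi tight [p, q] b) :
    C.subst Γ b (a :: Δ) k₁ k₂ hw (swap hC (crossing β) Γ a b Δ hΓ hL hL' g) f =
      swap hC (crossing β) Γ₂ a q Δ hΓ₂' hM₁' hM' (swap hC (crossing β) Γ a p (q :: Δ) hΓ hM hM₁
        (C.subst Γ₁ b Δ k₁' k₂' hw' g f)) := by
  obtain ⟨m, n, e, t, v, rfl⟩ := exists_comp₀_comp₀ hC hΓ rfl
    (hL.trans (by simp : _ = (Γ ++ [a, b]) ++ Δ)) g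
  rw [swap_comp₀_comp₀ hΓ hL hL' rfl _ rfl (by simp [hL'])]
  refine (subst_comp₀_comp₀ (Φ := []) (Ψ := [a]) (K' := [p, q, a]) (M₁ := Γ ++ [p, q, a]) rfl rfl
    rfl _ rfl (by simp [hM', hΓ₂]) (by simp) rfl k₁ k₂ hw v _ e f).trans ?_
  refine Eq.trans ?_ (congrArg (fun k => swap hC (crossing β) Γ₂ a q Δ hΓ₂' hM₁' hM'
      (swap hC (crossing β) Γ a p (q :: Δ) hΓ hM hM₁ k))
    (subst_comp₀_comp₀ (Φ := [a]) (Ψ := []) (K' := [a, p, q]) (M₁ := Γ ++ [a, p, q]) rfl rfl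
    rfl _ rfl (by simp [hM]) hΓ₁ rfl k₁' k₂' hw' v t e f).symm)
  rw [swap_comp₀_left (Δ := [q]) (Δ' := Δ) (Δ₂ := q :: Δ) (L' := Γ ++ [p, a, q]) hΓ rfl rfl _ (by simp [hM₁]) rfl,
    swap_comp₀_right (Γ := []) (Δ₁' := [p, a, q]) rfl rfl (by simp) hΓ _ rfl,
    swap_comp₀_left (Δ := []) (Δ' := Δ) (Δ₂ := Δ) (Γ := Γ₂) (L' := Γ ++ [p, q, a]) hΓ₂' (by simp [hΓ₂])
      (by simp [hΓ₂]) _ (by simp [hM', hΓ₂]) rfl,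
    swap_comp₀_right (Γ := [p]) (Δ₁' := [p, q, a]) rfl rfl hΓ₂ _ _ rfl]
  refine congrArg (fun k => comp₀ _ v (comp₀ rfl k e)) ?_
  exact ((swap_quaternary_eq_right _ _).trans ((congrArg β.β₄₃ (swap_quaternary_eq_left _)).trans
    (β.two_in_three_trd t f))).symm

end

end SkewMulticategory

/-! ### Generators of the acting subgroups, padding, cabling, and the kernel of the map to
permutations. -/

namespace BraidGroup

theorem σ_mem {n k : ℕ} {x : Tightness} (h₀ : x.off ≤ k) (h : k + 1 < n) : σ n k ∈ braids n x := by
  cases x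
  · exact σ_mem_braids h₀ h _
  · exact Subgroup.mem_top _

theorem closure_σ (n : ℕ) : Subgroup.closure {r | ∃ k, k + 1 < n ∧ r = σ n k} = ⊤ := by
  refine top_unique ?_
  rw [← PresentedGroup.closure_range_of (braidRels n)]
  refine Subgroup.closure_mono ?_
  rintro _ ⟨k, rfl⟩
  exact ⟨k, k.2, by rw [σ, dif_pos k.2]⟩

theorem braids_eq_closure (n : ℕ) (x : Tightness) :
    braids n x = Subgroup.closure {r | ∃ k, x.off ≤ k ∧ k + 1 < n ∧ r = σ n k} := by
  cases x
  · rfl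
  · rw [braids, ← closure_σ]
    simp [off]

theorem braids_induction {n : ℕ} {x : Tightness} {P : ∀ r : BraidGroup n, r ∈ braids n x → Prop}
    (gen : ∀ k (h₀ : x.off ≤ k) (h : k + 1 < n), P (σ n k) (σ_mem h₀ h))
    (one : P 1 (one_mem _))
    (mul : ∀ r s (hr : r ∈ braids n x) (hs : s ∈ braids n x), P r hr → P s hs →
      P (r * s) (mul_mem hr hs))
    (inv : ∀ r (hr : r ∈ braids n x), P r hr → P r⁻¹ (inv_mem hr))
    (r : BraidGroup n) (hr : r ∈ braids n x) : P r hr := by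
  have e := braids_eq_closure n x
  suffices h : ∀ r (hr : r ∈ Subgroup.closure {r | ∃ k, x.off ≤ k ∧ k + 1 < n ∧ r = σ n k}),
      P r (e ▸ hr) from h r (e ▸ hr)
  intro r hr
  induction hr using Subgroup.closure_induction with
  | mem r h =>
    obtain ⟨k, h₀, h, rfl⟩ := h
    exact gen k h₀ h
  | one => exact one
  | mul r s hr hs ihr ihs => exact mul _ _ _ _ ihr ihs
  | inv r hr ih => exact inv _ _ ih

theorem induction {n : ℕ} {P : BraidGroup n → Prop} (gen : ∀ k, k + 1 < n → P (σ n k)) (one : P 1)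
    (mul : ∀ r s, P r → P s → P (r * s)) (inv : ∀ r, P r → P r⁻¹) (r : BraidGroup n) : P r :=
  braids_induction (x := loose) (P := fun r _ => P r) (fun k _ h => gen k h) one
    (fun r s _ _ => mul r s) (fun r _ => inv r) r (Subgroup.mem_top r)

theorem perm_σ_val {n k : ℕ} (h : k + 1 < n) (i : Fin n) :
    ((perm (σ n k) i : Fin n) : ℕ) = natSwap k i := by
  rw [perm_σ h, adjSwap_val h]

/-- Braids that act on tight multimaps leave the first strand alone. -/
theorem perm_fst {n : ℕ} {r : BraidGroup n} (hr : r ∈ braids n tight) (i : Fin n)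
    (hi : (i : ℕ) = 0) : perm r i = i := by
  induction r, hr using braids_induction with
  | gen k h₀ h =>
    ext
    rw [perm_σ_val h, hi, natSwap_lt h₀]
  | one => simp
  | mul r s hr hs ihr ihs => rw [map_mul, Equiv.Perm.mul_apply, ihs, ihr]
  | inv r hr ih => rw [map_inv, Equiv.Perm.inv_eq_iff_eq, ih]

/-- The type of a substitution depends on the position only through its being the first one in a
tight multimap, and braids acting on tight multimaps fix the first position and hence preserve the
others. -/
theorem subst_perm {n : ℕ} {x : Tightness} {r : BraidGroup n} (hr : r ∈ braids n x) (i : Fin n)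
    (y : Tightness) : x.subst ((perm r i : Fin n) : ℕ) y = x.subst (i : ℕ) y := by
  cases x
  · by_cases hi : (i : ℕ) = 0
    · rw [perm_fst hr i hi]
    · have h' : ((perm r i : Fin n) : ℕ) ≠ 0 := fun h => by
        have e := perm_fst hr (perm r i) h
        rw [(perm r).injective e] at h
        exact hi h
      obtain ⟨a, ha⟩ := Nat.exists_eq_succ_of_ne_zero hi
      obtain ⟨b, hb⟩ := Nat.exists_eq_succ_of_ne_zero h'
      rw [ha, hb]
      rfl
  · rfl

/-! ### Padding and cabling -/

theorem off_subst_le {x y : Tightness} {i k : ℕ} (h : y.off ≤ k) : (x.subst i y).off ≤ i + k := by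
  cases x <;> cases y <;> cases i <;> simp_all [Tightness.subst, off]
  all_goals omega

/-- If the outer multimap is tight and `k` is positive, the first strand is one of the trivial
strands added before `r`. If `k = 0`, the composite has the type of the inner multimap, whose braids
are those allowed. -/
theorem pad_mem {m p : ℕ} {x y : Tightness} (k : ℕ) (h : k + m ≤ p) {r : BraidGroup m}
    (hr : r ∈ braids m y) : pad k h r ∈ braids p (x.subst k y) := by
  induction r, hr using braids_induction with
  | gen j h₀ hj =>
    rw [pad_σ k h hj]
    exact σ_mem (off_subst_le h₀) (by omega)
  | one => rw [map_one]; exact one_mem _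
  | mul r s hr hs ihr ihs => rw [map_mul]; exact mul_mem ihr ihs
  | inv r hr ih => rw [map_inv]; exact inv_mem ih

theorem blockR_mem {p k m : ℕ} {x : Tightness} (h : x.off ≤ k) (hp : k + m < p) :
    blockR p k m ∈ braids p x := by
  induction m with
  | zero => exact one_mem _
  | succ m ih => exact mul_mem (ih (by omega)) (σ_mem (by omega) (by omega))

theorem blockL_mem {p k m : ℕ} {x : Tightness} (h : x.off ≤ k) (hp : k + m < p) :
    blockL p k m ∈ braids p x := by
  induction m with
  | zero => exact one_mem _
  | succ m ih => exact mul_mem (σ_mem (by omega) (by omega)) (ih (by omega))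

theorem off_subst_of_le {x y : Tightness} {i k : ℕ} (h : x.off ≤ k) (hi : k ≤ i) :
    (x.subst i y).off ≤ k := by
  cases x <;> cases y <;> cases i <;> simp_all [Tightness.subst, off]

theorem off_subst_of_lt {x y : Tightness} {i k m : ℕ} (h : x.off ≤ k) (hi : i < k)
    (hy : y.off ≤ m) : (x.subst i y).off ≤ k + m - 1 := by
  cases x <;> cases y <;> cases i <;> simp_all [Tightness.subst, off]
  all_goals omega

theorem cable_inv {n m p : ℕ} (h : p + 1 = n + m) (i : Fin n) (r : BraidGroup n) :
    cable h i r⁻¹ = (cable h (perm r⁻¹ i) r)⁻¹ := by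
  refine eq_inv_of_mul_eq_one_right ?_
  rw [← cable_mul, mul_inv_cancel, cable_one]

/-- The hypothesis on `m` rules out a tight nullary multimap: deleting the first strand turns `σ 1`
into `σ 0`, which acts on loose multimaps only. -/
theorem cable_mem {n m p : ℕ} {x y : Tightness} (h : p + 1 = n + m) (hy : y.off ≤ m)
    {r : BraidGroup n} (hr : r ∈ braids n x) :
    ∀ i : Fin n, cable h i r ∈ braids p (x.subst (i : ℕ) y) := by
  induction r, hr using braids_induction with
  | gen k h₀ hk =>
    intro i
    rw [cable_σ h i hk]
    rcases (show (i : ℕ) < k ∨ (i : ℕ) = k ∨ (i : ℕ) = k + 1 ∨ k + 1 < i by omega) with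
      hi | hi | hi | hi
    · rw [cableGen_lt hi]
      exact σ_mem (off_subst_of_lt h₀ hi hy) (by omega)
    · rw [hi, cableGen_self]
      exact blockR_mem (off_subst_of_le h₀ le_rfl) (by omega)
    · rw [hi, cableGen_succ]
      exact blockL_mem (off_subst_of_le h₀ (by omega)) (by omega)
    · rw [cableGen_gt hi]
      exact σ_mem (off_subst_of_le h₀ (by omega)) (by omega)
  | one =>
    intro i
    rw [cable_one]
    exact one_mem _
  | mul r s hr hs ihr ihs =>
    intro i
    rw [cable_mul]
    refine mul_mem ?_ (ihs i)
    -- The factor `r` is cabled at position `perm s i`, which gives the same type as position `i`.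
    rw [← subst_perm hs]
    exact ihr _
  | inv r hr ih =>
    intro i
    rw [cable_inv, ← subst_perm (inv_mem hr)]
    exact inv_mem (ih _)

/-- The braid that remains after removing the first strand. -/
def dropFirst (p : ℕ) : braids (p + 1) tight →* BraidGroup p where
  toFun r := cable (p := p) (n := p + 1) (m := 0) rfl 0 r.1
  map_one' := cable_one ..
  -- Cabling is only a cocycle in general; it is multiplicative here because position `0` is fixed.
  map_mul' r s := by rw [Subgroup.coe_mul, cable_mul, perm_fst s.2 0 rfl]

theorem dropFirst_σ {p k : ℕ} (h₀ : tight.off ≤ k) (h : k + 1 < p + 1) :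
    dropFirst p ⟨σ (p + 1) k, σ_mem h₀ h⟩ = σ p (k - 1) :=
  (cable_σ (p := p) (m := 0) rfl 0 h).trans (cableGen_lt h₀)

/-! ### Braids with trivial permutation -/

theorem perm_pad {m p : ℕ} (k : ℕ) (h : k + m ≤ p) (r : BraidGroup m) :
    (∀ (i : Fin m) (j : Fin p), (j : ℕ) = k + i →
      ((perm (pad k h r) j : Fin p) : ℕ) = k + (perm r i : Fin m)) ∧
    ∀ j : Fin p, ((j : ℕ) < k ∨ k + m ≤ j) → perm (pad k h r) j = j := by
  induction r using BraidGroup.induction with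
  | gen l hl =>
    rw [pad_σ k h hl]
    refine ⟨fun i j hj => ?_, fun j hj => Fin.ext ?_⟩
    · rw [perm_σ_val (by omega), perm_σ_val hl, hj]
      unfold natSwap
      split_ifs <;> omega
    · rw [perm_σ_val (by omega)]
      rcases hj with hj | hj
      · exact natSwap_lt (by omega)
      · exact natSwap_gt (by omega)
  | one => simp
  | mul r s ihr ihs =>
    simp only [map_mul, Equiv.Perm.mul_apply]
    exact ⟨fun i j hj => ihr.1 _ _ (ihs.1 i j hj), fun j hj => by rw [ihs.2 j hj, ihr.2 j hj]⟩
  | inv r ih =>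
    simp only [map_inv]
    refine ⟨fun i j hj => ?_, fun j hj => ?_⟩
    · have hp : k + ((perm r)⁻¹ i : Fin m) < p := by omega
      have := ih.1 ((perm r)⁻¹ i) ⟨_, hp⟩ rfl
      rw [← Equiv.Perm.mul_apply, mul_inv_cancel, Equiv.Perm.one_apply, ← hj] at this
      rw [← Fin.ext this, ← Equiv.Perm.mul_apply, inv_mul_cancel, Equiv.Perm.one_apply]
    · rw [Equiv.Perm.inv_eq_iff_eq, ih.2 j hj]

theorem blockR_succ (p k m : ℕ) : blockR p k (m + 1) = σ p k * blockR p (k + 1) m := by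
  induction m with
  | zero => simp [blockR]
  | succ m ih =>
    rw [blockR, ih, blockR, show k + (m + 1) = k + 1 + m by omega, mul_assoc]

/-- A crossing between two strands that are both passed over by the strand of the block slides
through it, shifted by one position. Crossings before the end of the block commute with its last
factor; at the end the braid relation does the work. -/
theorem blockR_slide {p k m i : ℕ} (h : k ≤ i) (h' : i + 1 < k + m) (hp : k + m < p) :
    σ p (i + 1) * blockR p k m = blockR p k m * σ p i := by
  induction m with
  | zero => omega
  | succ m ih =>
    by_cases hi : i + 1 < k + m
    · rw [blockR, ← mul_assoc, ih hi (by omega), mul_assoc, mul_assoc, σ_comm (by omega)]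
    · obtain ⟨m, rfl⟩ := Nat.exists_eq_succ_of_ne_zero (show m ≠ 0 by omega)
      obtain rfl : i = k + m := by omega
      have c : σ p (k + m + 1) * blockR p k m = blockR p k m * σ p (k + m + 1) :=
        (blockR_comm (by omega)).symm
      simp only [blockR]
      rw [← add_assoc, mul_assoc (blockR p k m), ← mul_assoc, c, mul_assoc, ← mul_assoc (σ p _),
        ← σ_braid (by omega)]
      simp only [mul_assoc]

theorem perm_blockR {p k m : ℕ} (h : k + m < p) (i : Fin p) (hi : (i : ℕ) = k + m) :
    ((perm (blockR p k m) i : Fin p) : ℕ) = k := by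
  induction m generalizing i with
  | zero => simpa [blockR] using hi
  | succ m ih =>
    rw [blockR, map_mul, Equiv.Perm.mul_apply]
    refine ih (by omega) _ ?_
    rw [perm_σ_val (by omega), hi]
    exact natSwap_succ _

/-- The normal subgroup of the braid group generated by the squares of the generators. -/
def squares (n : ℕ) : Subgroup (BraidGroup n) :=
  Subgroup.normalClosure {r | ∃ k, k + 1 < n ∧ r = σ n k * σ n k}

instance (n : ℕ) : (squares n).Normal := Subgroup.normalClosure_normal

theorem sq_mem_squares {n k : ℕ} (h : k + 1 < n) : σ n k * σ n k ∈ squares n :=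
  Subgroup.subset_normalClosure ⟨k, h, rfl⟩

theorem squares_le_ker (n : ℕ) : squares n ≤ (perm (n := n)).ker := by
  refine Subgroup.normalClosure_le_normal ?_
  rintro _ ⟨k, h, rfl⟩
  rw [SetLike.mem_coe, MonoidHom.mem_ker, map_mul, perm_σ h, adjSwap, dif_pos h,
    Equiv.swap_mul_self]

theorem pad_mem_squares {m p k : ℕ} (h : k + m ≤ p) {r : BraidGroup m} (hr : r ∈ squares m) :
    pad k h r ∈ squares p := by
  have : squares m ≤ (squares p).comap (pad k h) := by
    refine Subgroup.normalClosure_le_normal ?_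
    rintro _ ⟨i, hi, rfl⟩
    rw [SetLike.mem_coe, Subgroup.mem_comap, map_mul, pad_σ k h hi]
    exact sq_mem_squares (by omega)
  exact this hr

theorem pad_zero_σ {n p k : ℕ} (h : k + 1 < n) {h' : 0 + n ≤ p} :
    pad 0 h' (σ n k) = σ p k :=
  (pad_σ 0 h' h).trans (congrArg _ (zero_add k))

/-- Modulo squares, the braids on the first `n` strands have the blocks `blockR j m` with `j + m =
n` as coset representatives, as for the symmetric group. The set of such products contains `1` and
is stable under left multiplication by generators, which suffices because generators are their own
inverses in the quotient. -/
theorem exists_blockR_mul_pad {n : ℕ} (r : BraidGroup (n + 1)) :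
    ∃ (j m : ℕ) (y : BraidGroup n), j + m = n ∧
      (r : BraidGroup (n + 1) ⧸ squares (n + 1)) =
        (blockR (n + 1) j m * pad 0 (by omega) y : BraidGroup (n + 1)) := by
  have step : ∀ k, k + 1 < n + 1 → ∀ r : BraidGroup (n + 1),
      (∃ (j m : ℕ) (y : BraidGroup n), j + m = n ∧
        (r : BraidGroup (n + 1) ⧸ squares (n + 1)) =
          (blockR (n + 1) j m * pad 0 (by omega) y : BraidGroup (n + 1))) →
      ∃ (j m : ℕ) (y : BraidGroup n), j + m = n ∧
        ((σ (n + 1) k * r : BraidGroup (n + 1)) : BraidGroup (n + 1) ⧸ squares (n + 1)) =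
          (blockR (n + 1) j m * pad 0 (by omega) y : BraidGroup (n + 1)) := by
    rintro k hk r ⟨j, m, y, rfl, hr⟩
    rw [QuotientGroup.mk_mul, hr, ← QuotientGroup.mk_mul, ← mul_assoc]
    -- The crossing lies entirely to the left of the block and commutes with it, extends the block,
    -- cancels its first factor up to a square, or slides through it.
    rcases (show k + 1 < j ∨ k + 1 = j ∨ k = j ∨ j < k by omega) with h | rfl | rfl | h
    · refine ⟨j, m, σ _ k * y, rfl, ?_⟩
      rw [← blockR_comm (by omega), map_mul, pad_zero_σ (by omega), mul_assoc]
    · exact ⟨k, m + 1, y, by omega, by rw [blockR_succ]⟩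
    · obtain ⟨m, rfl⟩ := Nat.exists_eq_add_one_of_ne_zero (show m ≠ 0 by omega)
      refine ⟨k + 1, m, y, by omega, ?_⟩
      rw [blockR_succ, ← mul_assoc, mul_assoc, QuotientGroup.mk_mul,
        (QuotientGroup.eq_one_iff _).2 (sq_mem_squares hk), one_mul]
    · obtain ⟨i, rfl⟩ := Nat.exists_eq_add_one_of_ne_zero (show k ≠ 0 by omega)
      refine ⟨j, m, σ _ i * y, rfl, ?_⟩
      rw [blockR_slide (by omega) (by omega) (by omega), map_mul,
        pad_zero_σ (by omega), mul_assoc]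
  have hr : r ∈ Subgroup.closure {r | ∃ k, k + 1 < n + 1 ∧ r = σ (n + 1) k} := by
    rw [closure_σ]; trivial
  induction hr using Subgroup.closure_induction_left with
  | one => exact ⟨n, 0, 1, rfl, by simp [blockR]⟩
  | mul_left x hx y hy ih =>
    obtain ⟨k, hk, rfl⟩ := hx
    exact step k hk y ih
  | inv_mul_cancel x hx y hy ih =>
    obtain ⟨k, hk, rfl⟩ := hx
    have e : ((σ (n + 1) k)⁻¹ : BraidGroup (n + 1) ⧸ squares (n + 1)) = (σ (n + 1) k : _) := by
      rw [inv_eq_iff_mul_eq_one, ← QuotientGroup.mk_mul]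
      exact (QuotientGroup.eq_one_iff _).2 (sq_mem_squares hk)
    rw [QuotientGroup.mk_mul, QuotientGroup.mk_inv, e, ← QuotientGroup.mk_mul]
    exact step k hk y ih

/-- A braid with trivial permutation is a product of conjugates of squares of generators and
their inverses. -/
theorem mem_squares {n : ℕ} (r : BraidGroup n) (hr : perm r = 1) : r ∈ squares n := by
  induction n with
  | zero =>
    induction r using BraidGroup.induction with
    | gen k h => omega
    | one => exact one_mem _
    | mul r s ihr ihs => exact mul_mem (ihr (Subsingleton.elim _ _)) (ihs (Subsingleton.elim _ _))
    | inv r ih => exact inv_mem (ih (Subsingleton.elim _ _))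
  | succ n ih =>
    obtain ⟨j, m, y, hj, e⟩ := exists_blockR_mul_pad r
    have h₁ := QuotientGroup.eq.1 e.symm
    have h₂ := squares_le_ker _ h₁
    rw [MonoidHom.mem_ker, map_mul, hr, mul_one, map_inv, inv_eq_one, map_mul] at h₂
    -- The padded braid fixes the last position and the block sends it to `j`, so a trivial
    -- permutation forces `j = n` and the block is empty.
    have h₃ := congrArg (fun π => ((π (Fin.last n) : Fin (n + 1)) : ℕ)) h₂
    simp only [Equiv.Perm.mul_apply, Equiv.Perm.one_apply] at h₃
    rw [(perm_pad 0 (by omega) y).2 _ (Or.inr (by simp)),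
      perm_blockR (by omega) _ (by simp [hj]), Fin.val_last] at h₃
    obtain rfl : m = 0 := by omega
    simp only [blockR, one_mul, map_one] at h₁ h₂
    have hy : perm y = 1 := by
      ext i
      have := (perm_pad 0 (by omega) y).1 i i.castSucc (by simp)
      rw [h₂] at this
      simpa using this.symm
    have := mul_mem (pad_mem_squares (p := n + 1) (k := 0) (by omega) (ih y hy)) h₁
    rwa [mul_inv_cancel_left] at this

end BraidGroup

/-- The domain of `r^* f` is determined by `r` and the domain of `f`, so actions may be compared in
the sum over all domains. -/
theorem Rearranges.eq {Obj : Type u} {n : ℕ} {π : Equiv.Perm (Fin n)} {L M M' : List Obj}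
    (h : Rearranges π L M) (h' : Rearranges π L M') : M = M' := by
  refine List.ext_getElem? fun i => ?_
  by_cases hi : i < n
  · exact (h.2.2 ⟨i, hi⟩).trans (h'.2.2 ⟨i, hi⟩).symm
  · rw [List.getElem?_eq_none (by rw [h.2.1]; omega), List.getElem?_eq_none (by rw [h'.2.1]; omega)]

theorem exists_eq_append_cons_cons {Obj : Type u} {L : List Obj} {k : ℕ} (h : k + 1 < L.length) :
    ∃ Γ a b Δ, L = Γ ++ a :: b :: Δ ∧ Γ.length = k := by
  refine ⟨L.take k, L[k], L[k + 1], L.drop (k + 2), ?_, by simp; omega⟩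
  rw [List.getElem_cons_drop, List.getElem_cons_drop, List.take_append_drop]

/-! ### The action of the braid groups generated by the exchanges. -/

namespace SkewMulticategory

open BraidGroup

variable {Obj : Type u} {C : SkewMulticategory.{u, v} Obj}

/-- The multimaps of a given type and codomain. -/
abbrev Multimaps (C : SkewMulticategory.{u, v} Obj) (x : Tightness) (c : Obj) : Type (max u v) :=
  Σ L, C.Multi x L c

variable (hC : C.LeftRepresentable) (β : Crossing C)

/-- `q` is obtained from the `n`-ary multimap `p` by swapping the inputs `k` and `k + 1`. -/
def IsSwap {x : Tightness} {c : Obj} (n k : ℕ) (p q : C.Multimaps x c) : Prop :=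
  ∃ (Γ : List Obj) (a b : Obj) (Δ : List Obj) (hΓ : x.off ≤ Γ.length) (hL : p.1 = Γ ++ a :: b :: Δ)
    (hM : q.1 = Γ ++ b :: a :: Δ), Γ.length = k ∧ p.1.length = n ∧
      q.2 = swap hC β Γ a b Δ hΓ hL hM p.2

variable {hC β} in
-- The splitting of the domain is determined by the length `k` of its first part. Uniqueness makes
-- the choice in `swapFun` harmless.
theorem IsSwap.unique {x : Tightness} {c : Obj} {n k : ℕ} {p q q' : C.Multimaps x c}
    (h : IsSwap hC β n k p q) (h' : IsSwap hC β n k p q') : q = q' := by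
  obtain ⟨L, f⟩ := p
  obtain ⟨M, g⟩ := q
  obtain ⟨M', g'⟩ := q'
  obtain ⟨Γ, a, b, Δ, hΓ, hL, hM, hk, hn, hg⟩ := h
  obtain ⟨Γ', a', b', Δ', hΓ', hL', hM', hk', hn', hg'⟩ := h'
  dsimp only at *
  obtain ⟨rfl, e⟩ := List.append_inj (hL.symm.trans hL') (by omega)
  simp only [List.cons.injEq] at e
  obtain ⟨rfl, rfl, rfl⟩ := e
  obtain rfl : M = Γ ++ b :: a :: Δ := hM
  obtain rfl : M' = Γ ++ b :: a :: Δ := hM'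
  exact congrArg _ (hg.trans hg'.symm)

open Classical in
/-- Swap the inputs `k` and `k + 1` of an `n`-ary multimap, if this is possible. -/
noncomputable def swapFun {x : Tightness} {c : Obj} (n k : ℕ) (p : C.Multimaps x c) :
    C.Multimaps x c :=
  if h : ∃ q, IsSwap hC β n k p q then h.choose else p

theorem swapFun_eq {x : Tightness} {c : Obj} {n k : ℕ} {Γ Δ L M : List Obj} {a b : Obj}
    (hΓ : x.off ≤ Γ.length) (hL : L = Γ ++ a :: b :: Δ) (hM : M = Γ ++ b :: a :: Δ)
    (hk : Γ.length = k) (hn : L.length = n) (f : C.Multi x L c) :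
    swapFun hC β n k ⟨L, f⟩ = ⟨M, swap hC β Γ a b Δ hΓ hL hM f⟩ := by
  have h : IsSwap hC β n k ⟨L, f⟩ ⟨M, swap hC β Γ a b Δ hΓ hL hM f⟩ :=
    ⟨Γ, a, b, Δ, hΓ, hL, hM, hk, hn, rfl⟩
  have h' : ∃ q, IsSwap hC β n k ⟨L, f⟩ q := ⟨_, h⟩
  rw [swapFun, dif_pos h']
  exact h'.choose_spec.unique h

theorem swapFun_of_length_ne {x : Tightness} {c : Obj} {n k : ℕ} (p : C.Multimaps x c)
    (h : p.1.length ≠ n) : swapFun hC β n k p = p := by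
  rw [swapFun, dif_neg]
  rintro ⟨q, Γ, a, b, Δ, hΓ, hL, hM, hk, hn, hg⟩
  exact h hn

variable {hC β} in
theorem swapFun_swapFun {β' : Crossing C}
    (h : ∀ (a₁ a₂ a₃ b : Obj) (t : C.Multi tight [a₁, a₂, a₃] b), β'.app (β.app t) = t)
    {x : Tightness} {c : Obj} (n k : ℕ) (p : C.Multimaps x c) :
    swapFun hC β' n k (swapFun hC β n k p) = p := by
  obtain ⟨L, f⟩ := p
  by_cases hn : L.length = n ∧ x.off ≤ k ∧ k + 1 < L.length
  · obtain ⟨hn, h₀, hk⟩ := hn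
    obtain ⟨Γ, a, b, Δ, rfl, rfl⟩ := exists_eq_append_cons_cons hk
    rw [swapFun_eq hC β h₀ rfl rfl rfl hn, swapFun_eq hC β' h₀ rfl rfl rfl (by simpa using hn),
      swap_swap_of_leftInverse h]
  -- Whether an exchange is possible depends on the type and the domain but not on the crossing, so
  -- both operations fix the multimap here.
  · have key : ∀ β : Crossing C, swapFun hC β n k ⟨L, f⟩ = ⟨L, f⟩ := fun β => by
      rw [swapFun, dif_neg]
      rintro ⟨q, Γ, a, b, Δ, hΓ, hL, hM, rfl, rfl, hg⟩
      dsimp only at hL hn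
      exact hn ⟨rfl, hΓ, by simp [hL]⟩
    rw [key, key]

theorem swapFun_comm {x : Tightness} {c : Obj} {n k l : ℕ} (hk : x.off ≤ k) (hl : k + 2 ≤ l)
    (hn : l + 1 < n) (p : C.Multimaps x c) :
    swapFun hC β n l (swapFun hC β n k p) = swapFun hC β n k (swapFun hC β n l p) := by
  obtain ⟨L, f⟩ := p
  by_cases h : L.length = n
  · obtain ⟨Γ, a, b, Δ', rfl, rfl⟩ := exists_eq_append_cons_cons (L := L) (k := k) (by omega)
    obtain ⟨Δ, d, e, Θ, rfl, hΔ⟩ := exists_eq_append_cons_cons (L := Δ') (k := l - (Γ.length + 2))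
      (by simp at h; omega)
    rw [swapFun_eq hC β hk rfl (M := Γ ++ b :: a :: (Δ ++ d :: e :: Θ)) rfl rfl h,
      swapFun_eq hC β (Γ := Γ ++ b :: a :: Δ) (a := d) (b := e) (Δ := Θ) (by simp; omega) (by simp)
        (M := Γ ++ b :: a :: (Δ ++ e :: d :: Θ)) (by simp) (by simp; omega)
        (by rw [← h]; simp),
      swapFun_eq hC β (Γ := Γ ++ a :: b :: Δ) (a := d) (b := e) (Δ := Θ) (by simp; omega) (by simp)
        (M := Γ ++ a :: b :: (Δ ++ e :: d :: Θ)) (by simp) (by simp; omega)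
        h,
      swapFun_eq hC β hk rfl (M := Γ ++ b :: a :: (Δ ++ e :: d :: Θ)) rfl rfl
        (by rw [← h]; simp)]
    refine congrArg _ ?_
    exact swap_swap_comm hk _ _ rfl rfl rfl rfl rfl rfl _ _ _ _ _ _ f
  · simp only [swapFun_of_length_ne hC β ⟨L, f⟩ h]

theorem swapFun_braid (β : C.toShort.ShortBraiding) {x : Tightness} {c : Obj} {n k : ℕ}
    (hk : x.off ≤ k) (hn : k + 2 < n) (p : C.Multimaps x c) :
    swapFun hC (crossing β) n k (swapFun hC (crossing β) n (k + 1)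
        (swapFun hC (crossing β) n k p)) =
      swapFun hC (crossing β) n (k + 1) (swapFun hC (crossing β) n k
        (swapFun hC (crossing β) n (k + 1) p)) := by
  obtain ⟨L, f⟩ := p
  by_cases h : L.length = n
  · obtain ⟨Γ, a, b, Δ', rfl, rfl⟩ := exists_eq_append_cons_cons (L := L) (k := k) (by omega)
    obtain ⟨d, Δ, rfl⟩ : ∃ d Δ, Δ' = d :: Δ :=
      List.exists_cons_of_length_pos (by simp at h; omega)
    have h₁ : ∀ d : Obj, x.off ≤ (Γ ++ [d]).length := fun d => by simp; omega
    have h₂ : ∀ d e g : Obj, (Γ ++ d :: e :: g :: Δ).length = n := fun d e g => by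
      rw [← h]; simp
    rw [swapFun_eq hC _ hk rfl (M := Γ ++ b :: a :: d :: Δ) rfl rfl h,
      swapFun_eq hC _ (Γ := Γ ++ [b]) (a := a) (b := d) (Δ := Δ) (h₁ b) (by simp) (M := Γ ++ b :: d :: a :: Δ) (by simp) (by simp) (h₂ ..),
      swapFun_eq hC _ hk rfl (M := Γ ++ d :: b :: a :: Δ) rfl rfl (h₂ ..),
      swapFun_eq hC _ (Γ := Γ ++ [a]) (a := b) (b := d) (Δ := Δ) (h₁ a) (by simp) (M := Γ ++ a :: d :: b :: Δ) (by simp) (by simp) (h₂ ..),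
      swapFun_eq hC _ hk rfl (M := Γ ++ d :: a :: b :: Δ) rfl rfl (h₂ ..),
      swapFun_eq hC _ (Γ := Γ ++ [d]) (a := a) (b := b) (Δ := Δ) (h₁ d) (by simp) (M := Γ ++ d :: b :: a :: Δ) (by simp) (by simp) (h₂ ..)]
    refine congrArg _ ?_
    exact swap_braid hk rfl rfl rfl _ _ _ rfl rfl _ _ rfl rfl _ _ rfl rfl _ _ f
  · simp only [swapFun_of_length_ne hC _ ⟨L, f⟩ h]

/-- `swapFun` as a permutation. -/
noncomputable def swapPerm (β : C.toShort.ShortBraiding) (x : Tightness) (c : Obj) (n k : ℕ) :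
    Equiv.Perm (C.Multimaps x c) where
  toFun := swapFun hC (crossing β) n k
  invFun := swapFun hC (crossingInv β) n k
  left_inv := swapFun_swapFun (fun _ _ _ _ t => β.β₃₂.symm_apply_apply t) n k
  right_inv := swapFun_swapFun (fun _ _ _ _ t => β.β₃₂.apply_symm_apply t) n k

/-- The opposite group appears because `(rs)^* = s^* r^*`. Exchanges satisfy the Artin relations
wherever they are defined, which settles loose multimaps. For tight ones no presentation of the
subgroup is needed: deleting the first strand maps it to a full braid group with the indices lowered
by one, and the universal property is used there. -/
theorem exists_actionHom (β : C.toShort.ShortBraiding) (x : Tightness) (c : Obj) (n : ℕ) :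
    ∃ Φ : braids n x →* (Equiv.Perm (C.Multimaps x c))ᵐᵒᵖ,
      ∀ k (h₀ : x.off ≤ k) (h : k + 1 < n),
        Φ ⟨σ n k, σ_mem h₀ h⟩ = MulOpposite.op (swapPerm hC β x c n k) := by
  have braid : ∀ k, x.off ≤ k → k + 2 < n →
      MulOpposite.op (swapPerm hC β x c n k) * MulOpposite.op (swapPerm hC β x c n (k + 1)) *
        MulOpposite.op (swapPerm hC β x c n k) =
      MulOpposite.op (swapPerm hC β x c n (k + 1)) * MulOpposite.op (swapPerm hC β x c n k) *
        MulOpposite.op (swapPerm hC β x c n (k + 1)) := fun k h₀ h =>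
    MulOpposite.unop_injective (Equiv.ext fun p => swapFun_braid hC β h₀ h p)
  have comm : ∀ i j, x.off ≤ i → i + 2 ≤ j → j + 1 < n →
      MulOpposite.op (swapPerm hC β x c n i) * MulOpposite.op (swapPerm hC β x c n j) =
      MulOpposite.op (swapPerm hC β x c n j) * MulOpposite.op (swapPerm hC β x c n i) :=
    fun i j h₀ h hj => MulOpposite.unop_injective
      (Equiv.ext fun p => swapFun_comm hC (crossing β) h₀ h hj p)
  cases x with
  | loose =>
    refine ⟨(BraidGroup.lift (fun k => MulOpposite.op (swapPerm hC β loose c n k))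
      (fun k => braid k (Nat.zero_le _)) (fun i j => comm i j (Nat.zero_le _))).comp
        (braids n loose).subtype, fun k h₀ h => ?_⟩
    rw [MonoidHom.comp_apply]
    exact lift_σ (n := n) (G := (Equiv.Perm (C.Multimaps loose c))ᵐᵒᵖ) _ _ _ h
  | tight =>
    cases n with
    | zero => exact ⟨1, fun k h₀ h => absurd h (by omega)⟩
    | succ n =>
      -- The shift to `k + 1` undoes the lowering of indices by `dropFirst`.
      refine ⟨(BraidGroup.lift (fun k => MulOpposite.op (swapPerm hC β tight c (n + 1) (k + 1)))
        (fun k hk => braid (k + 1) (by simp [off]) (by omega))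
        (fun i j hi hj => comm (i + 1) (j + 1) (by simp [off]) (by omega) (by omega))).comp
          (dropFirst n), fun k h₀ h => ?_⟩
      obtain ⟨k, rfl⟩ := Nat.exists_eq_add_one_of_ne_zero (show k ≠ 0 by simp [off] at h₀; omega)
      rw [MonoidHom.comp_apply, dropFirst_σ h₀ h, Nat.add_sub_cancel, lift_σ _ _ _ (by omega)]

/-- The action of braids on multimaps. -/
noncomputable def braidFun (β : C.toShort.ShortBraiding) {x : Tightness} {c : Obj} {n : ℕ}
    (r : BraidGroup n) (hr : r ∈ braids n x) : Equiv.Perm (C.Multimaps x c) :=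
  ((exists_actionHom hC β x c n).choose ⟨r, hr⟩).unop

section

variable (β : C.toShort.ShortBraiding) {x : Tightness} {c : Obj} {n : ℕ}

theorem braidFun_σ {k : ℕ} {Γ Δ L M : List Obj} {a b : Obj}
    (hΓ : x.off ≤ Γ.length) (hL : L = Γ ++ a :: b :: Δ) (hM : M = Γ ++ b :: a :: Δ)
    (hk : Γ.length = k) (hn : L.length = n) (hr : σ n k ∈ braids n x) (f : C.Multi x L c) :
    braidFun hC β (σ n k) hr ⟨L, f⟩ = ⟨M, swap hC (crossing β) Γ a b Δ hΓ hL hM f⟩ := by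
  have h : k + 1 < n := by rw [← hn, ← hk, hL]; simp
  rw [braidFun, (exists_actionHom hC β x c n).choose_spec k (hk ▸ hΓ) h]
  exact swapFun_eq hC (crossing β) hΓ hL hM hk hn f

theorem braidFun_one (hr) (p : C.Multimaps x c) : braidFun hC β (1 : BraidGroup n) hr p = p := by
  have e : (⟨1, hr⟩ : braids n x) = 1 := rfl
  rw [braidFun, e, map_one]
  rfl

theorem braidFun_mul {r s : BraidGroup n} (hr : r ∈ braids n x) (hs : s ∈ braids n x) (hrs)
    (p : C.Multimaps x c) :
    braidFun hC β (r * s) hrs p = braidFun hC β s hs (braidFun hC β r hr p) := by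
  have e : (⟨r * s, hrs⟩ : braids n x) = ⟨r, hr⟩ * ⟨s, hs⟩ := rfl
  rw [braidFun, e, map_mul]
  rfl

theorem braidFun_inv {r : BraidGroup n} (hr : r ∈ braids n x) (hr')
    (p : C.Multimaps x c) :
    braidFun hC β r⁻¹ hr' p = (braidFun hC β r hr).symm p := by
  rw [Equiv.eq_symm_apply, ← braidFun_mul hC β hr' hr (mul_mem hr' hr)]
  have e : (⟨r⁻¹ * r, mul_mem hr' hr⟩ : braids n x) = 1 := Subtype.ext (inv_mul_cancel r)
  rw [braidFun, e, map_one]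
  rfl

theorem braidFun_congr {r s : BraidGroup n} (h : r = s) (hr : r ∈ braids n x) (hs)
    (p : C.Multimaps x c) : braidFun hC β r hr p = braidFun hC β s hs p := by
  subst h
  rfl

/-- The statement on lengths is kept separate and unconditional so that the induction over products
and inverses knows that intermediate multimaps are still `n`-ary. -/
theorem braidFun_rearranges {r : BraidGroup n} (hr : r ∈ braids n x) :
    ∀ p : C.Multimaps x c, (braidFun hC β r hr p).1.length = p.1.length ∧
      (p.1.length = n → Rearranges (perm r) p.1 (braidFun hC β r hr p).1) := by
  induction r, hr using braids_induction with
  | gen k h₀ h =>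
    rintro ⟨L, f⟩
    by_cases hL : L.length = n
    · obtain ⟨Γ, a, b, Δ, rfl, rfl⟩ := exists_eq_append_cons_cons (L := L) (k := k) (by omega)
      rw [braidFun_σ hC β h₀ rfl rfl rfl hL]
      exact ⟨by simp, fun _ => rearranges_σ Γ a b Δ rfl (by rw [← hL]; simp; omega)⟩
    · rw [braidFun, (exists_actionHom hC β x c n).choose_spec k h₀ h]
      change (swapFun hC (crossing β) n k ⟨L, f⟩).1.length = _ ∧ _
      rw [swapFun_of_length_ne hC _ _ hL]
      exact ⟨rfl, fun h => absurd h hL⟩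
  | one =>
    intro p
    rw [braidFun_one]
    exact ⟨rfl, fun h => ⟨h, h, fun i => by simp⟩⟩
  | mul r s hr hs ihr ihs =>
    intro p
    rw [braidFun_mul hC β hr hs]
    refine ⟨(ihs _).1.trans (ihr _).1, fun h => ?_⟩
    rw [map_mul]
    exact ((ihr p).2 h).trans ((ihs _).2 ((ihr p).1.trans h))
  | inv r hr ih =>
    intro p
    rw [braidFun_inv hC β hr]
    obtain ⟨q, rfl⟩ := (braidFun hC β r hr).surjective p
    rw [Equiv.symm_apply_apply]
    refine ⟨(ih q).1.symm, fun h => ?_⟩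
    rw [map_inv]
    exact ((ih q).2 ((ih q).1.symm.trans h)).symm

theorem braidFun_fst {r : BraidGroup n} (hr : r ∈ braids n x) {L M : List Obj}
    (h : Rearranges (perm r) L M) (f : C.Multi x L c) : (braidFun hC β r hr ⟨L, f⟩).1 = M :=
  ((braidFun_rearranges hC β hr ⟨L, f⟩).2 h.1).eq h

/-- The action of a braid on the multimaps with a given domain. -/
noncomputable def braidAct {r : BraidGroup n} (hr : r ∈ braids n x) {L M : List Obj}
    (h : Rearranges (perm r) L M) (f : C.Multi x L c) : C.Multi x M c :=
  cast (congrArg (fun M => C.Multi x M c) (braidFun_fst hC β hr h f)) (braidFun hC β r hr ⟨L, f⟩).2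

/-- This replaces the cast in `braidAct` by an equation between pairs of a domain and a multimap,
the form in which the axioms of a braiding are verified. -/
theorem braidFun_eq_mk {r : BraidGroup n} (hr : r ∈ braids n x) {L M : List Obj}
    (h : Rearranges (perm r) L M) (f : C.Multi x L c) :
    braidFun hC β r hr ⟨L, f⟩ = ⟨M, braidAct hC β hr h f⟩ := by
  refine Sigma.ext (braidFun_fst hC β hr h f) ?_
  exact (cast_heq _ _).symm

variable {hC β} in
theorem braidAct_eq_of_braidFun_eq {r : BraidGroup n} {hr : r ∈ braids n x} {L M : List Obj}
    {h : Rearranges (perm r) L M} {f : C.Multi x L c} {g : C.Multi x M c}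
    (e : braidFun hC β r hr ⟨L, f⟩ = ⟨M, g⟩) : braidAct hC β hr h f = g := by
  rw [braidFun_eq_mk hC β hr h, Sigma.mk.injEq] at e
  exact eq_of_heq e.2

end

end SkewMulticategory

theorem Tightness.subst_of_off_le {x : Tightness} {k : ℕ} (h : x.off ≤ k) (y : Tightness) :
    x = x.subst k y := by
  cases x <;> cases k <;> simp_all [Tightness.subst, off]

theorem exists_eq_append_of_append_eq {α : Type*} {A B C D : List α} (h : A ++ B = C ++ D)
    (hl : A.length ≤ C.length) : ∃ E, C = A ++ E ∧ B = E ++ D := by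
  rcases List.append_eq_append_iff.1 h with h | ⟨E, rfl, rfl⟩
  · exact h
  · obtain rfl : E = [] := by simpa using hl
    exact ⟨[], by simp⟩

theorem exists_eq_append_cons_of_append_eq {α : Type*} {A B C D : List α} {d : α}
    (h : A ++ B = C ++ d :: D) (hl : C.length < A.length) :
    ∃ E, A = C ++ d :: E ∧ D = E ++ B := by
  obtain ⟨E, rfl, hE⟩ := exists_eq_append_of_append_eq h.symm hl.le
  cases E with
  | nil => simp at hl
  | cons e E =>
    obtain ⟨rfl, rfl⟩ := List.cons.inj hE
    exact ⟨E, rfl, rfl⟩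

/-! ### Compatibility of the action with `j` and with substitution. -/

namespace SkewMulticategory

open BraidGroup

variable {Obj : Type u} {C : SkewMulticategory.{u, v} Obj} (hC : C.LeftRepresentable)
  (β : C.toShort.ShortBraiding)

theorem subst_comp₀ {x y t w : Tightness} {A A' Γ Δ Δ₂ Ψ L M N : List Obj} {m b c : Obj}
    (hA : A' = A ++ Ψ) (hΔ₂ : Δ₂ = Ψ ++ Δ) (hL : L = Γ ++ b :: Δ) (hN : N = Γ ++ A' ++ Δ)
    (hw : w = x.subst Γ.length y) (hM : M = Γ ++ m :: Ψ ++ Δ) (ht : t = x.subst Γ.length tight)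
    (hM' : M = Γ ++ m :: Δ₂) (hN' : N = Γ ++ A ++ Δ₂) (hw' : w = t.subst Γ.length y)
    (g : C.Multi x L c) (u : C.Multi tight (m :: Ψ) b) (e : C.Multi y A m) :
    C.subst Γ b Δ hL hN hw g (comp₀ hA u e) =
      C.subst Γ m Δ₂ hM' hN' hw' (C.subst Γ b Δ hL hM ht g u) e :=
  C.subst_subst Γ b Δ [] m Ψ (List.append_nil _).symm hΔ₂ hL rfl hA rfl hN hw hM ht hM' hN' hw' g u e

variable {hC β} in
/-- A map of multimaps commutes with the action of braids if it does so for the generators. -/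
theorem braidFun_equivariant {x y : Tightness} {b c : Obj} {m p : ℕ}
    (φ : BraidGroup m →* BraidGroup p) (hφ : ∀ r ∈ braids m y, φ r ∈ braids p x)
    (F : C.Multimaps y b → C.Multimaps x c)
    (hF : ∀ k (h₀ : y.off ≤ k) (h : k + 1 < m) q, q.1.length = m →
      braidFun hC β (φ (σ m k)) (hφ _ (σ_mem h₀ h)) (F q) =
        F (braidFun hC β (σ m k) (σ_mem h₀ h) q))
    {r : BraidGroup m} (hr : r ∈ braids m y) : ∀ q, q.1.length = m →
      braidFun hC β (φ r) (hφ r hr) (F q) = F (braidFun hC β r hr q) := by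
  induction r, hr using braids_induction with
  | gen k h₀ h => exact hF k h₀ h
  | one =>
    intro q hq
    rw [braidFun_one, braidFun_congr hC β (map_one φ) _ (one_mem _), braidFun_one]
  | mul r s hr hs ihr ihs =>
    intro q hq
    rw [braidFun_congr hC β (map_mul φ r s) _ (mul_mem (hφ r hr) (hφ s hs)),
      braidFun_mul hC β (hφ r hr) (hφ s hs), ihr q hq,
      ihs _ ((braidFun_rearranges hC β hr q).1.trans hq), ← braidFun_mul]
  | inv r hr ih =>
    intro q hq
    -- With the multimap written as `r^* q`, the claim for `r⁻¹` is the claim for `r` at `q`.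
    rw [braidFun_congr hC β (map_inv φ r) _ (inv_mem (hφ r hr)), braidFun_inv hC β (hφ r hr),
      braidFun_inv hC β hr, Equiv.symm_apply_eq]
    obtain ⟨q, rfl⟩ := (braidFun hC β r hr).surjective q
    rw [Equiv.symm_apply_apply, ih q ((braidFun_rearranges hC β hr q).1.symm.trans hq)]

theorem braidAct_j {n : ℕ} {L M : List Obj} {c : Obj} (r : BraidGroup n)
    (hr : r ∈ braids n tight) (hr' : r ∈ braids n loose)
    (hM : Rearranges (perm r) L M) (f : C.Multi tight L c) :
    braidAct hC β hr' hM (C.j f) = C.j (braidAct hC β hr hM f) := by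
  refine braidAct_eq_of_braidFun_eq ?_
  refine (braidFun_equivariant (x := loose) (y := tight) (MonoidHom.id (BraidGroup n))
    (fun r _ => Subgroup.mem_top r)
    (fun q : C.Multimaps tight c => ⟨q.1, C.j q.2⟩) ?_ hr ⟨L, f⟩ hM.1).trans
    (by rw [braidFun_eq_mk hC β hr hM])
  rintro k h₀ h ⟨L, f⟩ hL
  replace hL : L.length = n := hL
  obtain ⟨Γ, a, b, Δ, rfl, rfl⟩ := exists_eq_append_cons_cons (L := L) (k := k) (by omega)
  rw [braidFun_σ hC β h₀ rfl rfl rfl hL]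
  refine (braidFun_σ hC β (Nat.zero_le _) rfl rfl rfl hL _ _).trans ?_
  exact congrArg _ (swap_j h₀ _ _ _ f)

theorem subst_braidAct {x y w : Tightness} {m p : ℕ} {L A A' M M' : List Obj} {c : Obj}
    (Γ : List Obj) (b : Obj) (Δ : List Obj) (hL : L = Γ ++ b :: Δ)
    (hM : M = Γ ++ A ++ Δ) (hM' : M' = Γ ++ A' ++ Δ) (hw : w = x.subst Γ.length y)
    (r : BraidGroup m) (hr : r ∈ braids m y) (hA : Rearranges (perm r) A A')
    (h : Γ.length + m ≤ p) (hr' : pad Γ.length h r ∈ braids p w)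
    (hA' : Rearranges (perm (pad Γ.length h r)) M M')
    (g : C.Multi x L c) (f : C.Multi y A b) :
    C.subst Γ b Δ hL hM' hw g (braidAct hC β hr hA f) =
      braidAct hC β hr' hA' (C.subst Γ b Δ hL hM hw g f) := by
  subst hM hM'
  symm
  refine braidAct_eq_of_braidFun_eq ?_
  -- Substitution into `g` is treated as a map of multimaps that is equivariant along the padding
  -- homomorphism; only generators remain, and there it is `subst_swap`.
  refine (braidFun_equivariant (pad Γ.length h) (fun r hr => hw ▸ pad_mem _ h hr)
    (fun q : C.Multimaps y b => ⟨Γ ++ q.1 ++ Δ, C.subst Γ b Δ hL rfl hw g q.2⟩) ?_ hr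
    ⟨A, f⟩ hA.1).trans (by rw [braidFun_eq_mk hC β hr hA])
  rintro k h₀ hk ⟨B, f⟩ hB
  replace hB : B.length = m := hB
  obtain ⟨Ξ, a, a', Ψ, rfl, rfl⟩ := exists_eq_append_cons_cons (L := B) (k := k) (by omega)
  rw [braidFun_σ hC β h₀ rfl rfl rfl hB, braidFun_congr hC β (pad_σ _ h hk) _
    (σ_mem (hw ▸ off_subst_le h₀) (by omega)),
    braidFun_σ hC β (Γ := Γ ++ Ξ) (a := a) (b := a') (Δ := Ψ ++ Δ)
      (M := Γ ++ (Ξ ++ a' :: a :: Ψ) ++ Δ) (by rw [hw]; simpa using off_subst_le h₀)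
      (by simp) (by simp) (by simp) (by rw [← hA'.1]; simp [hA.1, ← hB]; omega)]
  refine congrArg _ (Eq.symm ?_)
  exact subst_swap h₀ rfl rfl _ _ _ _ rfl rfl _ _ _ g f

section

variable {hC β} {x y : Tightness} {Γ Δ L L' M M' Γ₁ : List Obj} {a b c : Obj}

/-- Induction on the arity of `f`, splitting off its last input: `f = u ∘ e` with `u` binary. By the
binary case, `a` first crosses the strand of `m` and then that of `q`. Substituting `e` turns the
first crossing into a block by induction and passes before the second one. This mirrors the
recursion of `blockR`, since `(rs)^* = s^* r^*`. -/
theorem braidFun_blockR {p k : ℕ} {A : List Obj} (hΓ : x.off ≤ Γ.length)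
    (hL : L = Γ ++ a :: b :: Δ) (hL' : L' = Γ ++ b :: a :: Δ) (hΓ₁ : Γ₁ = Γ ++ [a])
    (k₁ : L' = Γ ++ b :: (a :: Δ)) (k₂ : M' = Γ ++ A ++ a :: Δ) (k₁' : L = Γ₁ ++ b :: Δ)
    (k₂' : M = Γ₁ ++ A ++ Δ) (hw : x = x.subst Γ.length y) (hw' : x = x.subst Γ₁.length y)
    (hA : y.off ≤ A.length) (hk : Γ.length = k) (hp : M.length = p)
    (hr : blockR p k A.length ∈ braids p x) (g : C.Multi x L c) (f : C.Multi y A b) :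
    braidFun hC β (blockR p k A.length) hr ⟨M, C.subst Γ₁ b Δ k₁' k₂' hw' g f⟩ =
      ⟨M', C.subst Γ b (a :: Δ) k₁ k₂ hw (swap hC (crossing β) Γ a b Δ hΓ hL hL' g) f⟩ := by
  subst hΓ₁
  induction A using List.reverseRecOn generalizing b L L' M M' Δ with
  | nil =>
    cases y with
    | tight => simp [off] at hA
    | loose =>
      obtain rfl : M = M' := by simp [k₂, k₂']
      refine (braidFun_one hC β _ _).trans ?_
      rw [subst_swap_nullary_snd hΓ hL hL' rfl k₁ k₂ k₁' k₂']
  | append_singleton A q ih =>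
    by_cases h : A.length < y.off
    · cases y with
      | loose => simp [off] at h
      | tight =>
        obtain rfl : A = [] := by
          simpa [off] using h
        have e : blockR p k ([] ++ [q]).length = σ p k := by simp [blockR]
        rw [braidFun_congr hC β e hr (e ▸ hr),
          subst_swap_unary_snd hΓ hL hL' rfl k₁ k₂ k₁' k₂' (by simp [k₂']) (by simp [k₂]) hw hw',
          braidFun_σ hC β hΓ (a := a) (b := q) (Δ := Δ) (M := M') (by simp [k₂']) (by simp [k₂]) hk hp]
    · have h : y.off ≤ A.length := by omega
      obtain ⟨m, e, u, rfl⟩ := exists_comp₀ hC h (rfl : A ++ [q] = A ++ [q]) f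
      have hp' : Γ.length + A.length + Δ.length + 2 = p := by
        rw [← hp, k₂']; simp; omega
      have s : blockR p k (A ++ [q]).length = blockR p k A.length * σ p (k + A.length) := by
        simp [blockR]
      have hr₁ : blockR p k A.length ∈ braids p x := blockR_mem (hk ▸ hΓ) (by omega)
      have hr₂ : σ p (k + A.length) ∈ braids p x := σ_mem (by omega) (by omega)
      -- Behind `Γ`, substitution never changes the type, because no first input of a tight multimap
      -- is involved.
      have hw₂ : ∀ z Γ₂, x = x.subst (Γ ++ Γ₂).length z := fun z Γ₂ =>
        Tightness.subst_of_off_le (by simp; omega) z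
      rw [braidFun_congr hC β s hr (mul_mem hr₁ hr₂), braidFun_mul hC β hr₁ hr₂]
      rw [subst_comp₀ (t := x) rfl (Δ₂ := q :: Δ) rfl k₁' k₂' hw'
        (M := Γ ++ [a] ++ [m, q] ++ Δ) rfl (hw₂ _ _) (by simp) (by simp [k₂']) hw' g u e]
      rw [ih (Δ := q :: Δ) (b := m) (L := Γ ++ [a] ++ [m, q] ++ Δ) (L' := Γ ++ m :: a :: q :: Δ)
        (M' := Γ ++ A ++ a :: q :: Δ) (by simp) rfl rfl rfl h hp hr₁ _ e (by simp)
        (by simp [k₂'])]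
      rw [braidFun_σ hC β (Γ := Γ ++ A) (a := a) (b := q) (Δ := Δ) (M := M')
        (by simp; omega) (by simp) (by simp [k₂]) (by simp [hk]) (by simp; omega)]
      refine congrArg _ ?_
      rw [subst_comp₀ (t := x) rfl (Δ₂ := q :: a :: Δ) rfl k₁ k₂ hw
        (M := Γ ++ [m, q] ++ a :: Δ) rfl (by simpa using hw₂ tight []) (by simp)
        (by simp [k₂]) hw _ u e]
      rw [subst_swap_binary_snd (M := Γ ++ [a] ++ [m, q] ++ Δ) (M₁ := Γ ++ m :: a :: q :: Δ)
        hΓ hL hL' rfl k₁ (by simp) k₁' rfl rfl (Γ₂ := Γ ++ [m]) (by simp; omega)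
        (by simp) (by simp) (by simp) (by simp)
        (by simpa using hw₂ tight []) (hw₂ _ _) g u]
      exact (subst_swap_before (by simp; omega) (by simp; omega) (by simp) (by simp) (by simp)
        (by simp [k₂]) rfl (by simp) hw (by simp) (by simp) (by simp) (by simp [k₂]) _ e).symm

/-- The same induction for the other crossing strand. Now the last input `q` of `f` is the one next
to `b`, so it crosses first and the block of the remaining inputs follows, as in the recursion of
`blockL`. -/
theorem braidFun_blockL {p k : ℕ} {A : List Obj} (hΓ : x.off ≤ Γ.length)
    (hL : L = Γ ++ a :: b :: Δ) (hL' : L' = Γ ++ b :: a :: Δ) (hΓ₁ : Γ₁ = Γ ++ [b])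
    (k₁ : L' = Γ₁ ++ a :: Δ) (k₂ : M' = Γ₁ ++ A ++ Δ) (k₁' : L = Γ ++ a :: (b :: Δ))
    (k₂' : M = Γ ++ A ++ b :: Δ) (hw : x = x.subst Γ₁.length y) (hw' : x = x.subst Γ.length y)
    (hA : y.off ≤ A.length) (hk : Γ.length = k) (hp : M.length = p)
    (hr : blockL p k A.length ∈ braids p x) (g : C.Multi x L c) (f : C.Multi y A a) :
    braidFun hC β (blockL p k A.length) hr ⟨M, C.subst Γ a (b :: Δ) k₁' k₂' hw' g f⟩ =
      ⟨M', C.subst Γ₁ a Δ k₁ k₂ hw (swap hC (crossing β) Γ a b Δ hΓ hL hL' g) f⟩ := by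
  subst hΓ₁
  induction A using List.reverseRecOn generalizing a L L' M M' Δ with
  | nil =>
    cases y with
    | tight => simp [off] at hA
    | loose =>
      obtain rfl : M = M' := by simp [k₂, k₂']
      refine (braidFun_one hC β _ _).trans ?_
      rw [subst_swap_nullary_fst hΓ hL hL' rfl k₁ k₂ k₁' k₂']
  | append_singleton A q ih =>
    by_cases h : A.length < y.off
    · cases y with
      | loose => simp [off] at h
      | tight =>
        obtain rfl : A = [] := by
          simpa [off] using h
        have e : blockL p k ([] ++ [q]).length = σ p k := by simp [blockL]
        rw [braidFun_congr hC β e hr (e ▸ hr),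
          subst_swap_unary_fst hΓ hL hL' rfl k₁ k₂ k₁' k₂' (by simp [k₂']) (by simp [k₂]) hw hw',
          braidFun_σ hC β hΓ (a := q) (b := b) (Δ := Δ) (M := M') (by simp [k₂']) (by simp [k₂]) hk hp]
    · have h : y.off ≤ A.length := by omega
      obtain ⟨m, e, u, rfl⟩ := exists_comp₀ hC h (rfl : A ++ [q] = A ++ [q]) f
      have hp' : Γ.length + A.length + Δ.length + 2 = p := by
        rw [← hp, k₂']; simp; omega
      have s : blockL p k (A ++ [q]).length = σ p (k + A.length) * blockL p k A.length := by
        simp [blockL]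
      have hr₁ : blockL p k A.length ∈ braids p x := blockL_mem (hk ▸ hΓ) (by omega)
      have hr₂ : σ p (k + A.length) ∈ braids p x := σ_mem (by omega) (by omega)
      have hw₂ : ∀ z Γ₂, x = x.subst (Γ ++ Γ₂).length z := fun z Γ₂ =>
        Tightness.subst_of_off_le (by simp; omega) z
      rw [braidFun_congr hC β s hr (mul_mem hr₂ hr₁), braidFun_mul hC β hr₂ hr₁]
      rw [subst_comp₀ (t := x) rfl (Δ₂ := q :: b :: Δ) rfl k₁' k₂' hw'
        (M := Γ ++ [m, q] ++ b :: Δ) rfl (by simpa using hw₂ tight []) (by simp)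
        (by simp [k₂']) hw' g u e]
      rw [braidFun_σ hC β (Γ := Γ ++ A) (a := q) (b := b) (Δ := Δ) (M := Γ ++ A ++ b :: q :: Δ)
        (by simp; omega) (by simp [k₂']) rfl (by simp [hk]) (by simp [k₂']; omega)]
      rw [subst_comp₀ (t := x) rfl (Δ₂ := q :: Δ) rfl k₁ k₂ hw
        (M := Γ ++ [b] ++ [m, q] ++ Δ) rfl (hw₂ _ _) (by simp) (by simp [k₂]) hw _ u e]
      rw [subst_swap_binary_fst (M := Γ ++ [m, q] ++ b :: Δ) (M₁ := Γ ++ m :: b :: q :: Δ)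
        hΓ hL hL' rfl k₁ rfl k₁' rfl (Γ₂ := Γ ++ [m]) rfl (by simp; omega)
        (by simp) (by simp) (by simp) (by simp)
        (hw₂ _ _) (by simpa using hw₂ tight []) g u]
      rw [← ih (Δ := q :: Δ) (a := m) (L := Γ ++ m :: b :: q :: Δ)
        (L' := Γ ++ [b] ++ [m, q] ++ Δ) (M := Γ ++ A ++ b :: q :: Δ) rfl (by simp) rfl rfl h
        (by simp; omega) hr₁ _ e (by simp) (by simp [k₂])]
      refine congrArg _ (congrArg _ (Eq.symm ?_))
      exact subst_swap_before (by simp; omega) (by simp; omega) (by simp) (by simp) (by simp [k₂'])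
        (by simp) rfl (by simp) hw' (by simp) (by simp [k₂']) (by simp) (by simp) _ e

end

/-- The action of braids is compatible with substitution on the left, by cabling. -/
theorem braidFun_cable {x y w : Tightness} {n m p : ℕ} {A : List Obj} {b c : Obj}
    (f : C.Multi y A b) (hA : A.length = m) (h : p + 1 = n + m) (r : BraidGroup n)
    (hr : r ∈ braids n x) :
    ∀ {L L' M M' : List Obj} (Γ Γ' Δ Δ' : List Obj) (hL : L = Γ ++ b :: Δ) (hM : M = Γ ++ A ++ Δ)
    (hw : w = x.subst Γ.length y)
    (hL' : L' = Γ' ++ b :: Δ') (hM' : M' = Γ' ++ A ++ Δ') (hw' : w = x.subst Γ'.length y)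
    (i : Fin n) (_ : (i : ℕ) = Γ'.length) (_ : ((perm r i : Fin n) : ℕ) = Γ.length)
    (_ : L.length = n) (hr' : cable h i r ∈ braids p w)
    (g : C.Multi x L c) (g' : C.Multi x L' c), braidFun hC β r hr ⟨L, g⟩ = ⟨L', g'⟩ →
      braidFun hC β (cable h i r) hr' ⟨M, C.subst Γ b Δ hL hM hw g f⟩ =
        ⟨M', C.subst Γ' b Δ' hL' hM' hw' g' f⟩ := by
  subst hA
  induction r, hr using braids_induction with
  | gen k h₀ hk =>
    intro L L' M M' Γ Γ' Δ Δ' hL hM hw hL' hM' hw' i hi hi' hn hr' g g' e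
    obtain ⟨Ξ, a, a', Θ, hΞ, hΞk⟩ := exists_eq_append_cons_cons (L := L) (k := k) (by omega)
    rw [perm_σ_val hk] at hi'
    rw [braidFun_σ hC β (hΞk ▸ h₀) hΞ rfl hΞk hn, Sigma.mk.injEq] at e
    obtain ⟨hΞ', e⟩ := e
    have hp : M.length = p := by
      rw [hL] at hn
      rw [hM]; simp at hn ⊢; omega
    have hf := off_le_length f
    have h₀' : x.off ≤ Ξ.length := hΞk ▸ h₀
    subst hΞ'
    obtain rfl := eq_of_heq e
    have s := cable_σ h i hk
    -- The cabled strand ends before the crossing, at its first or second position, or after it.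
    -- Only the middle cases replace the crossing by a block; the first one shifts it and the last
    -- one leaves it in place.
    rcases (show (i : ℕ) < k ∨ (i : ℕ) = k ∨ (i : ℕ) = k + 1 ∨ k + 1 < i by omega) with
      hik | hik | hik | hik
    · rw [cableGen_lt hik] at s
      rw [natSwap_lt hik] at hi'
      rw [braidFun_congr hC β s hr' (s ▸ hr')]
      have hL₁ := hΞ.symm.trans hL
      obtain ⟨Ψ, hΨ, hΔ⟩ := exists_eq_append_cons_of_append_eq hL₁ (by omega)
      obtain ⟨Ψ', hΨ', hΔ'⟩ := exists_eq_append_cons_of_append_eq hL' (by omega)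
      obtain ⟨rfl, e⟩ := List.append_inj (hΨ.symm.trans hΨ') (by omega)
      obtain rfl := (List.cons.inj e).2
      have hw₁ : w.off ≤ (Γ ++ A ++ Ψ).length := by
        rw [hw]
        refine (off_subst_of_lt h₀ (by omega : Γ.length < k) hf).trans ?_
        rw [← hΞk, hΨ]; simp; omega
      rw [braidFun_σ hC β (Γ := Γ ++ A ++ Ψ) (a := a) (b := a') (Δ := Θ) (M := M') hw₁
        (by simp [hM, hΔ]) (by simp [hM', hΔ']) (by rw [← hΞk, hΨ]; simp; omega) hp]
      refine congrArg _ (Eq.symm ?_)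
      exact subst_swap_before h₀' hw₁ _ _ _ _ hΨ rfl hw _ _ _ _ g f
    · rw [hik, cableGen_self] at s
      rw [hik, natSwap_self] at hi'
      rw [braidFun_congr hC β s hr' (s ▸ hr')]
      obtain ⟨rfl, e⟩ := List.append_inj hL' (by omega)
      simp only [List.cons.injEq] at e
      obtain ⟨rfl, rfl⟩ := e
      have hL₁ : (Ξ ++ [a]) ++ a' :: Θ = Γ ++ a' :: Δ := by rw [← hL, hΞ]; simp
      obtain ⟨rfl, e⟩ := List.append_inj hL₁ (by simp; omega)
      obtain rfl := (List.cons.inj e).2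
      obtain rfl : w = x := hw'.trans (subst_of_off_le h₀' y).symm
      exact braidFun_blockR h₀' hΞ rfl rfl rfl hM' hL hM hw' hw hf hΞk hp _ g f
    · rw [hik, cableGen_succ] at s
      rw [hik, natSwap_succ] at hi'
      rw [braidFun_congr hC β s hr' (s ▸ hr')]
      obtain ⟨rfl, e⟩ := List.append_inj (hΞ.symm.trans hL) (by omega)
      simp only [List.cons.injEq] at e
      obtain ⟨rfl, rfl⟩ := e
      have hL₁ : (Ξ ++ [a']) ++ a :: Θ = Γ' ++ a :: Δ' := by rw [← hL']; simp
      obtain ⟨rfl, e⟩ := List.append_inj hL₁ (by simp; omega)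
      obtain rfl := (List.cons.inj e).2
      obtain rfl : w = x := hw.trans (subst_of_off_le h₀' y).symm
      exact braidFun_blockL h₀' hΞ rfl rfl _ hM' hL hM hw' hw hf hΞk hp _ g f
    · rw [cableGen_gt hik] at s
      rw [natSwap_gt hik] at hi'
      rw [braidFun_congr hC β s hr' (s ▸ hr')]
      obtain ⟨Φ, hΦ, hΔ⟩ := exists_eq_append_of_append_eq
        (show (Ξ ++ [a, a']) ++ Θ = Γ ++ b :: Δ by rw [← hL, hΞ]; simp) (by simp; omega)
      obtain ⟨Φ', hΦ', hΔ'⟩ := exists_eq_append_of_append_eq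
        (show (Ξ ++ [a', a]) ++ Θ = Γ' ++ b :: Δ' by rw [← hL']; simp) (by simp; omega)
      have hl : Φ.length = Φ'.length := by
        have h₁ := congrArg List.length hΦ
        have h₂ := congrArg List.length hΦ'
        simp at h₁ h₂; omega
      obtain ⟨rfl, e⟩ := List.append_inj (hΔ.symm.trans hΔ') hl
      obtain rfl := (List.cons.inj e).2
      obtain rfl : w = x := hw.trans (subst_of_off_le (by omega) y).symm
      rw [braidFun_σ hC β (Γ := Ξ) (a := a) (b := a') (Δ := Φ ++ A ++ Δ) (M := M') h₀'
        (by simp [hM, hΦ]) (by simp [hM', hΦ']) hΞk hp]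
      refine congrArg _ (Eq.symm ?_)
      exact subst_swap_after h₀' _ _ _ _ hΔ rfl (by simp [hΦ]) (by simp [hΦ']) hw hw' _ _ _ _ g f
  | one =>
    intro L L' M M' Γ Γ' Δ Δ' hL hM hw hL' hM' hw' i hi hi' hn hr' g g' e
    rw [braidFun_congr hC β (cable_one h i) hr' (one_mem _), braidFun_one]
    rw [braidFun_one, Sigma.mk.injEq] at e
    rw [map_one, Equiv.Perm.one_apply, hi] at hi'
    obtain ⟨rfl, e⟩ := e
    obtain rfl := eq_of_heq e
    obtain ⟨rfl, e⟩ := List.append_inj (hL.symm.trans hL') hi'.symm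
    obtain rfl := (List.cons.inj e).2
    obtain rfl : M = M' := hM.trans hM'.symm
    rfl
  | mul r s hr hs ihr ihs =>
    intro L L' M M' Γ Γ' Δ Δ' hL hM hw hL' hM' hw' i hi hi' hn hr' g g' e
    rw [braidFun_mul hC β hr hs] at e
    obtain ⟨⟨L₁, g₁⟩, e₁⟩ : ∃ q, braidFun hC β r hr ⟨L, g⟩ = q := ⟨_, rfl⟩
    rw [e₁] at e
    have hn₁ : L₁.length = n := by
      have := (braidFun_rearranges hC β hr ⟨L, g⟩).1
      rw [e₁] at this
      exact this.trans hn
    -- To cut the intermediate domain at the cabled strand, its object `b` is located at position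
    -- `perm s i`, where the strand passes between `s` and `r`.
    have h₁ : L₁[((perm s i : Fin n) : ℕ)]? = some b := by
      have := ((braidFun_rearranges hC β hs ⟨L₁, g₁⟩).2 hn₁).2.2 i
      rw [e] at this
      rw [← this]
      change L'[(i : ℕ)]? = _
      rw [hL', hi]
      simp
    obtain ⟨Γ₁, Δ₁, hL₁, hΓ₁⟩ : ∃ Γ₁ Δ₁, L₁ = Γ₁ ++ b :: Δ₁ ∧ Γ₁.length = (perm s i : Fin n) := by
      obtain ⟨hlt, e⟩ := List.getElem?_eq_some_iff.1 h₁
      refine ⟨L₁.take (perm s i : Fin n), L₁.drop ((perm s i : Fin n) + 1), ?_, by simp; omega⟩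
      rw [← e, List.getElem_cons_drop, List.take_append_drop]
    have hw₁ : w = x.subst Γ₁.length y := by
      rw [hΓ₁, subst_perm hs, hi, hw']
    have m₁ : cable h (perm s i) r ∈ braids p w := by
      rw [hw₁, hΓ₁]; exact cable_mem h (off_le_length f) hr _
    have m₂ : cable h i s ∈ braids p w := by
      rw [hw', ← hi]; exact cable_mem h (off_le_length f) hs _
    rw [braidFun_congr hC β (cable_mul h i r s) hr' (mul_mem m₁ m₂), braidFun_mul hC β m₁ m₂,
      ihr Γ Γ₁ Δ Δ₁ hL hM hw hL₁ rfl hw₁ (perm s i) hΓ₁.symm (by rw [← hi', map_mul]; rfl) hn m₁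
        g g₁ e₁]
    exact ihs Γ₁ Γ' Δ₁ Δ' hL₁ rfl hw₁ hL' hM' hw' i hi hΓ₁.symm hn₁ m₂ g₁ g' e
  | inv r hr ih =>
    intro L L' M M' Γ Γ' Δ Δ' hL hM hw hL' hM' hw' i hi hi' hn hr' g g' e
    -- The inverse reverses the strand, so the induction hypothesis is used with the two sides
    -- interchanged and the strand ending at `perm r⁻¹ i`.
    have m₁ : cable h (perm r⁻¹ i) r ∈ braids p w := by
      rw [hw, ← hi']; exact cable_mem h (off_le_length f) hr _
    rw [braidFun_congr hC β (cable_inv h i r) hr' (inv_mem m₁), braidFun_inv hC β m₁,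
      Equiv.symm_apply_eq]
    rw [braidFun_inv hC β hr, Equiv.symm_apply_eq] at e
    have hn' : L'.length = n := by
      have := (braidFun_rearranges hC β hr ⟨L', g'⟩).1
      rw [← e] at this
      exact this.symm.trans hn
    exact (ih Γ' Γ Δ' Δ hL' hM' hw' hL hM hw (perm r⁻¹ i) hi' (by rw [map_inv, ← hi]; simp) hn' m₁
      g' g e.symm).symm

end SkewMulticategory

theorem Rearranges.eq_of_one {Obj : Type u} {n : ℕ} {L M : List Obj}
    (h : Rearranges (1 : Equiv.Perm (Fin n)) L M) : L = M :=
  Rearranges.eq (π := (1 : Equiv.Perm (Fin n))) (L := L) ⟨h.1, h.1, fun _ => rfl⟩ h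

theorem ShortSkewMulticategory.ShortBraiding.ext {Obj : Type u}
    {S : ShortSkewMulticategory.{u, v} Obj} {β β' : S.ShortBraiding}
    (h₃₂ : ∀ {a₁ a₂ a₃ b : Obj} (f : S.T₃ a₁ a₂ a₃ b), β.β₃₂ f = β'.β₃₂ f)
    (h₄₂ : ∀ {a₁ a₂ a₃ a₄ b : Obj} (f : S.T₄ a₁ a₂ a₃ a₄ b), β.β₄₂ f = β'.β₄₂ f)
    (h₄₃ : ∀ {a₁ a₂ a₃ a₄ b : Obj} (f : S.T₄ a₁ a₂ a₃ a₄ b), β.β₄₃ f = β'.β₄₃ f) : β = β' := by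
  obtain ⟨β₃₂, β₄₂, β₄₃, _, _, _, _, _, _, _, _, _⟩ := β
  obtain ⟨β₃₂', β₄₂', β₄₃', _, _, _, _, _, _, _, _, _⟩ := β'
  obtain rfl : @β₃₂ = @β₃₂' := by
    funext a₁ a₂ a₃ b
    exact Equiv.ext h₃₂
  obtain rfl : @β₄₂ = @β₄₂' := by
    funext a₁ a₂ a₃ a₄ b
    exact Equiv.ext h₄₂
  obtain rfl : @β₄₃ = @β₄₃' := by
    funext a₁ a₂ a₃ a₄ b
    exact Equiv.ext h₄₃
  rfl

/-! ### The bijection with short braidings, and its restriction to symmetries. -/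

namespace SkewMulticategory

open BraidGroup

variable {Obj : Type u} {C : SkewMulticategory.{u, v} Obj}

namespace Braiding

/-- The braiding that extends a short braiding. -/
noncomputable def ofShort (hC : C.LeftRepresentable) (β : C.toShort.ShortBraiding) : C.Braiding where
  act r hr h f := braidAct hC β hr h f
  act_one h hL f := braidAct_eq_of_braidFun_eq (braidFun_one hC β h _)
  act_mul r s hr hs hrs hM hN hN' f := braidAct_eq_of_braidFun_eq <| by
    rw [braidFun_mul hC β hr hs, braidFun_eq_mk hC β hr hM, braidFun_eq_mk hC β hs hN]
  act_j := braidAct_j hC β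
  subst_act := subst_braidAct hC β
  act_subst Γ Γ' b Δ Δ' hL hM hw hL' hM' hw' r hr hLL' i hi hi' hA h hr' hMM' g f :=
    (braidAct_eq_of_braidFun_eq (braidFun_cable hC β f hA h r hr Γ Γ' Δ Δ' hL hM hw hL' hM' hw' i
      hi hi' hLL'.1 hr' g _ (braidFun_eq_mk hC β hr hLL' g))).symm

theorem act_σ_ofShort (hC : C.LeftRepresentable) (β : C.toShort.ShortBraiding) {x : Tightness} {n k : ℕ}
    {Γ Δ L M : List Obj} {a b c : Obj} (hΓ : x.off ≤ Γ.length) (hL : L = Γ ++ a :: b :: Δ)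
    (hM : M = Γ ++ b :: a :: Δ) (hk : Γ.length = k) (hr : σ n k ∈ braids n x)
    (h : Rearranges (perm (σ n k)) L M) (f : C.Multi x L c) :
    (ofShort hC β).act (σ n k) hr h f =
      SkewMulticategory.swap hC (crossing β) Γ a b Δ hΓ hL hM f :=
  braidAct_eq_of_braidFun_eq (h := h) (braidFun_σ hC β hΓ hL hM hk h.1 hr f)

theorem toShort_ofShort (hC : C.LeftRepresentable) (β : C.toShort.ShortBraiding) : (ofShort hC β).toShort = β := by
  refine ShortSkewMulticategory.ShortBraiding.ext (fun {a₁ a₂ a₃ b} f => ?_)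
    (fun {a₁ a₂ a₃ a₄ b} f => ?_) (fun {a₁ a₂ a₃ a₄ b} f => ?_)
  · exact (act_σ_ofShort hC β (off_le_cons _ _ _) rfl rfl rfl _
      (rearranges_σ [a₁] a₂ a₃ [] rfl rfl) f).trans (swap_ternary_eq f)
  · exact (act_σ_ofShort hC β (off_le_cons _ _ _) rfl rfl rfl _
      (rearranges_σ [a₁] a₂ a₃ [a₄] rfl rfl) f).trans (swap_quaternary_eq_left f)
  · exact (act_σ_ofShort hC β (off_le_cons _ _ _) rfl rfl rfl _
      (rearranges_σ [a₁, a₂] a₃ a₄ [] rfl rfl) f).trans (swap_quaternary_eq_right _ f)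

/-- Uniqueness on generators. In `g ∘ (t ∘ e)`, compatibility with substitution on the right carries
the crossing from the composite to `t ∘ e`, and compatibility on the left carries it from there to
the ternary `t`, where it is `β₃₂` by definition. -/
theorem act_σ_eq_swap (hC : C.LeftRepresentable) (B : C.Braiding) {x : Tightness} {n k : ℕ}
    {Γ Δ L M : List Obj} {a b c : Obj} (hΓ : x.off ≤ Γ.length) (hL : L = Γ ++ a :: b :: Δ)
    (hM : M = Γ ++ b :: a :: Δ) (hk : Γ.length = k) (hr : σ n k ∈ braids n x)
    (h : Rearranges (perm (σ n k)) L M) (f : C.Multi x L c) :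
    B.act (σ n k) hr h f =
      SkewMulticategory.swap hC (crossing B.toShort) Γ a b Δ hΓ hL hM f := by
  have hn : Γ.length + 2 + Δ.length = n := by rw [← h.1, hL]; simp; omega
  have hL₁ : L = (Γ ++ [a, b]) ++ Δ := by simp [hL]
  have hM₁ : M = (Γ ++ [b, a]) ++ Δ := by simp [hM]
  obtain ⟨m, p, e, t, g, rfl⟩ := exists_comp₀_comp₀ hC hΓ rfl hL₁ f
  rw [swap_comp₀_comp₀ hΓ hL hM rfl hL₁ rfl hM₁ g t e]
  have e₁ : pad ([] : List Obj).length (by simp; omega) (σ (Γ.length + 2) k) = σ n k := by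
    rw [pad_σ _ _ (by omega)]; simp
  have m₁ : σ (Γ.length + 2) k ∈ braids (Γ.length + 2) x := σ_mem (hk ▸ hΓ) (by omega)
  have r₁ : Rearranges (perm (σ (Γ.length + 2) k)) (Γ ++ [a, b]) (Γ ++ [b, a]) :=
    rearranges_σ Γ a b [] hk (by simp)
  have h₁ := B.subst_act [] p Δ rfl hL₁ hM₁ rfl (σ (Γ.length + 2) k) m₁ r₁ (by simp; omega)
    (e₁ ▸ hr) (e₁ ▸ h) g (comp₀ rfl t e)
  -- In the crossing `σ 1` on three strands, replacing the first strand by `Γ.length` strands moves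
  -- the crossing to position `1 + Γ.length - 1 = k`.
  have e₂ : cable (m := Γ.length) (p := Γ.length + 2) (by omega) 0 (σ 3 1) = σ (Γ.length + 2) k := by
    rw [cable_σ _ _ (by omega), cableGen_lt (by simp), ← hk]
    congr 1
    omega
  have m₂ : σ 3 1 ∈ braids 3 tight := σ_mem_braids (by decide) (by decide) _
  have h₂ := B.act_subst (x := tight) (w := x) [] [] m [a, b] [b, a] rfl (rfl : Γ ++ [a, b] = [] ++ Γ ++ [a, b])
    rfl rfl (rfl : Γ ++ [b, a] = [] ++ Γ ++ [b, a]) rfl (σ 3 1) m₂ (rearranges_σ [m] a b [] rfl rfl) 0 rfl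
    (by rw [perm_fst m₂ 0 rfl]; rfl) rfl (by omega) (e₂ ▸ m₁) (e₂ ▸ r₁) t e
  refine (B.act_congr _ _ _ _ e₁.symm _).trans (h₁.symm.trans ?_)
  refine congrArg _ ?_
  exact (B.act_congr _ _ _ _ e₂.symm _).trans h₂.symm

/-- Two actions that agree on generators agree; this gives injectivity and also lets symmetry be
tested on the constructed action. -/
theorem braidFun_toShort (hC : C.LeftRepresentable) (B : C.Braiding) {x : Tightness} {n : ℕ} {c : Obj} (r : BraidGroup n)
    (hr : r ∈ braids n x) : ∀ {L M : List Obj} (h : Rearranges (perm r) L M) (f : C.Multi x L c),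
      braidFun hC B.toShort r hr ⟨L, f⟩ = ⟨M, B.act r hr h f⟩ := by
  induction r, hr using braids_induction with
  | gen k h₀ hk =>
    intro L M h f
    obtain ⟨Γ, a, b, Δ, rfl, rfl⟩ := exists_eq_append_cons_cons (L := L) (k := k)
      (by rw [h.1]; exact hk)
    obtain rfl := h.eq (rearranges_σ Γ a b Δ rfl (by rw [← h.1]; simp; omega))
    rw [braidFun_σ hC _ h₀ rfl rfl rfl h.1, act_σ_eq_swap hC B h₀ rfl rfl rfl]
  | one =>
    intro L M h f
    obtain rfl := Rearranges.eq_of_one (map_one (perm (n := n)) ▸ h)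
    rw [braidFun_one, B.act_one]
  | mul r s hr hs ihr ihs =>
    intro L M h f
    obtain ⟨L₁, hr'⟩ : ∃ L₁, Rearranges (perm r) L L₁ :=
      ⟨_, (braidFun_rearranges hC B.toShort hr ⟨L, f⟩).2 h.1⟩
    obtain ⟨L₂, hs'⟩ : ∃ L₂, Rearranges (perm s) L₁ L₂ :=
      ⟨_, (braidFun_rearranges hC B.toShort hs ⟨L₁, B.act r hr hr' f⟩).2 hr'.2.1⟩
    have h' := hr'.trans hs'
    rw [← map_mul] at h'
    obtain rfl := h'.eq h
    rw [braidFun_mul hC _ hr hs, B.act_mul r s hr hs _ hr' hs', ihr hr', ihs hs']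
  | inv r hr ih =>
    intro L M h f
    have h' := h.symm
    rw [map_inv, inv_inv] at h'
    rw [braidFun_inv hC _ hr, Equiv.symm_apply_eq, ih h']
    have h₁ : Rearranges (perm (r⁻¹ * r)) L L := by
      rw [map_mul]; exact h.trans h'
    have h₂ := h₁
    rw [inv_mul_cancel] at h₂
    rw [← B.act_mul r⁻¹ r (inv_mem hr) hr (mul_mem (inv_mem hr) hr) h h' h₁,
      B.act_congr _ (one_mem _) h₁ h₂ (inv_mul_cancel r), B.act_one]

theorem toShort_injective (hC : C.LeftRepresentable) : Function.Injective (toShort : C.Braiding → C.toShort.ShortBraiding) := by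
  intro B B' e
  have key : ∀ {x : Tightness} {n : ℕ} {L M : List Obj} {c : Obj} (r : BraidGroup n)
      (hr : r ∈ braids n x) (h : Rearranges (perm r) L M) (f : C.Multi x L c),
      B.act r hr h f = B'.act r hr h f := fun r hr h f => by
    have h₁ := braidFun_toShort hC B r hr h f
    rw [e, braidFun_toShort hC B' r hr h f, Sigma.mk.injEq] at h₁
    exact (eq_of_heq h₁.2).symm
  obtain ⟨act, _, _, _, _, _⟩ := B
  obtain ⟨act', _, _, _, _, _⟩ := B'
  obtain rfl : @act = @act' := by
    funext x n L M c r hr h f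
    exact key r hr h f
  rfl

end Braiding

/-- The square of a generator acts as a double exchange, hence trivially if `β₃₂` is an involution,
and the kernel of the action pulled back along `ψ` is normal. The homomorphism `ψ` allows the normal
closure to be taken in a full braid group even when the acting group is a proper subgroup. -/
theorem braidFun_of_mem_squares {hC : C.LeftRepresentable} {β : C.toShort.ShortBraiding} (hβ : β.IsSymmetry) {x : Tightness}
    {n q : ℕ} {c : Obj} (ψ : BraidGroup q →* braids n x)
    (hψ : ∀ k, k + 1 < q → ∃ l, ∃ (h₀ : x.off ≤ l) (h : l + 1 < n), ψ (σ q k) = ⟨σ n l, σ_mem h₀ h⟩)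
    {s : BraidGroup q} (hs : s ∈ squares q) (p : C.Multimaps x c) :
    braidFun hC β (ψ s).1 (ψ s).2 p = p := by
  have le : squares q ≤ ((exists_actionHom hC β x c n).choose.comp ψ).ker := by
    refine Subgroup.normalClosure_le_normal ?_
    rintro _ ⟨k, hk, rfl⟩
    obtain ⟨l, h₀, h, e⟩ := hψ k hk
    rw [SetLike.mem_coe, MonoidHom.mem_ker, map_mul, MonoidHom.comp_apply, e,
      (exists_actionHom hC β x c n).choose_spec l h₀ h]
    refine MulOpposite.unop_injective (Equiv.ext fun p => ?_)
    exact swapFun_swapFun (β' := crossing β) (β := crossing β)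
      (fun a₁ a₂ a₃ b t => hβ (a₁ := a₁) (a₂ := a₂) (a₃ := a₃) (b := b) t) n l p
  have h := le hs
  rw [MonoidHom.mem_ker] at h
  exact congrArg (fun Φ : (Equiv.Perm (C.Multimaps x c))ᵐᵒᵖ => Φ.unop p) h

/-- Loose case: a braid with trivial permutation lies in the normal closure of the squares. Tight
case: apply this to the braid with the first strand deleted, and add that strand back. -/
theorem braidFun_of_perm_eq_one {hC : C.LeftRepresentable} {β : C.toShort.ShortBraiding} (hβ : β.IsSymmetry) {x : Tightness}
    {n : ℕ} {c : Obj} {r : BraidGroup n} (hr : r ∈ braids n x) (h : perm r = 1)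
    (p : C.Multimaps x c) : braidFun hC β r hr p = p := by
  cases x with
  | loose =>
    exact braidFun_of_mem_squares hβ ((MonoidHom.id _).codRestrict (braids n loose)
      fun _ => Subgroup.mem_top _) (fun k hk => ⟨k, Nat.zero_le _, hk, rfl⟩) (mem_squares r h) p
  | tight =>
    cases n with
    | zero =>
      have e : r = 1 := by
        clear hr h
        induction r using BraidGroup.induction with
        | gen k h => omega
        | one => rfl
        | mul r s ihr ihs => rw [ihr, ihs, one_mul]
        | inv r ih => rw [ih, inv_one]
      rw [braidFun_congr hC β e hr (one_mem _), braidFun_one]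
    | succ n =>
      have hpad : ∀ s, pad (m := n) (p := n + 1) 1 (by omega) s ∈ braids (n + 1) tight := fun s =>
        pad_mem (x := tight) (y := loose) 1 _ (Subgroup.mem_top s)
      -- Deleting the untouched first strand and adding it back is the identity on the acting
      -- subgroup, as seen on generators.
      have e : pad (p := n + 1) 1 (by omega) (dropFirst n ⟨r, hr⟩) = r := by
        clear h
        induction r, hr using braids_induction with
        | gen k h₀ h =>
          have h₁ : 1 ≤ k := h₀
          rw [dropFirst_σ h₀ h, pad_σ _ _ (by omega), Nat.add_sub_cancel' h₁]
        | one => exact (congrArg _ (map_one _)).trans (map_one _)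
        | mul r s hr hs ihr ihs =>
          exact (congrArg _ (map_mul (dropFirst n) ⟨r, hr⟩ ⟨s, hs⟩)).trans
            ((map_mul _ _ _).trans (congrArg₂ _ ihr ihs))
        | inv r hr ih =>
          exact (congrArg _ (map_inv (dropFirst n) ⟨r, hr⟩)).trans
            ((map_inv _ _).trans (congrArg _ ih))
      have h' : perm (dropFirst n ⟨r, hr⟩) = 1 := by
        ext i
        have := (perm_pad 1 (by omega : 1 + n ≤ n + 1) (dropFirst n ⟨r, hr⟩)).1 i ⟨1 + i, by omega⟩ rfl
        rw [e, h] at this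
        simp at this
        simp [← this]
      rw [braidFun_congr hC β e.symm hr (hpad _)]
      exact braidFun_of_mem_squares hβ ((pad 1 (by omega : 1 + n ≤ n + 1)).codRestrict (braids (n + 1) tight) hpad)
        (fun k hk => ⟨1 + k, by simp [off], by omega, Subtype.ext (pad_σ _ _ hk)⟩)
        (mem_squares _ h') p

theorem Braiding.isSymmetry_iff (hC : C.LeftRepresentable) (B : C.Braiding) : B.IsSymmetry ↔ B.toShort.IsSymmetry := by
  refine ⟨fun h a₁ a₂ a₃ b f => ?_, fun h x n L M c r s hr hs hL hL' f e => ?_⟩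
  · have m := σ_mem_braids (n := 3) (k := 1) (by decide) (by decide) tight
    have r₁ := rearranges_σ (n := 3) (k := 1) [a₁] a₂ a₃ [] rfl rfl
    have r₂ := rearranges_σ (n := 3) (k := 1) [a₁] a₃ a₂ [] rfl rfl
    have r := r₁.trans r₂
    rw [← map_mul] at r
    have e : perm (σ 3 1 * σ 3 1) = perm (1 : BraidGroup 3) := by
      rw [map_one]
      exact squares_le_ker 3 (sq_mem_squares (by decide))
    refine (B.act_mul _ _ m m (mul_mem m m) r₁ r₂ r f).symm.trans ?_
    exact (h _ _ _ (one_mem _) _ (e ▸ r) f e).trans (B.act_one _ _ f)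
  -- Writing `r = (r s⁻¹) s` reduces the comparison to a braid with trivial permutation.
  · have h₁ : perm (r * s⁻¹) = 1 := by rw [map_mul, map_inv, e, mul_inv_cancel]
    have h₂ : braidFun hC B.toShort r hr ⟨L, f⟩ = braidFun hC B.toShort s hs ⟨L, f⟩ := by
      have m := mul_mem hr (inv_mem hs)
      rw [braidFun_congr hC _ (inv_mul_cancel_right r s).symm hr (mul_mem m hs),
        braidFun_mul hC _ m hs, braidFun_of_perm_eq_one h m h₁]
    rw [Braiding.braidFun_toShort hC B r hr hL, Braiding.braidFun_toShort hC B s hs hL',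
      Sigma.mk.injEq] at h₂
    exact eq_of_heq h₂.2

end SkewMulticategory

end SkewMulti

theorem mainTheorem8 {Obj : Type u} (C : SkewMulti.SkewMulticategory.{u, v} Obj)
    (hC : C.LeftRepresentable) :
    Function.Bijective
        (SkewMulti.SkewMulticategory.Braiding.toShort : C.Braiding → C.toShort.ShortBraiding) ∧
      ∀ B : C.Braiding, B.IsSymmetry ↔ B.toShort.IsSymmetry :=
  ⟨⟨SkewMulti.SkewMulticategory.Braiding.toShort_injective hC, fun β =>
    ⟨SkewMulti.SkewMulticategory.Braiding.ofShort hC β,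
      SkewMulti.SkewMulticategory.Braiding.toShort_ofShort hC β⟩⟩,
    SkewMulti.SkewMulticategory.Braiding.isSymmetry_iff hC⟩
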